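/- **Setting.** Let $1\le d\le 3$, $m=d+2$, $\gamma>1$, $s_0\in\mathbb R$. For a state $u=(\rho,\rho V,\rho E)\in\mathbb R^m$ put $p=(\gamma-1)(\rho E-\rho|V|^2/2)$, let $X_u=\{\rho>0,\ p>0\}$, let $F(u)$ be the Euler flux with columns $F_{\cdot j}=(\rho V_j,\ \rho V_iV_j+\delta_{ij}p,\ V_j(\rho E+p))$, and let $F_n=F\cdot n$. With $s=\log(p/\rho^\gamma)-s_0$ let $H=-\rho s$, $\mathcal F=HV$, $\mathcal F_n=\mathcal F\cdot n$, and let $v(u)=(\gamma-1)\big(\tfrac{-s}{\gamma-1}+\tfrac{\gamma+1}{\gamma-1}-\tfrac{\rho E}{p},\ \tfrac{\rho V}{p},\ -\tfrac{\rho}{p}\big)$ be the entropy variables, $X_v=v(X_u)$, and $u(v)$ the inverse map. Fluxes are also written as functions of $v$. Put $A_n=\partial F_n/\partial u$, $\tilde A_0=\partial u/\partial v$, $\tilde A_n=A_n\tilde A_0$, and $|\tilde A_n|_{\tilde A_0}=\tilde A_0|\tilde A_0^{-1}\tilde A_n|$, where $|P\,\mathrm{diag}(\lambda)P^{-1}|=P\,\mathrm{diag}(|\lambda|)P^{-1}$.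 For all $v_1,v_2\in X_v$ let $\theta\mapsto\tilde v(\theta;v_1,v_2)$ be a smooth path $[0,1]\to X_v$ from $v_1$ to $v_2$. Define $$\sigma_{MV}(v_1,v_2;n)=\int_0^1(1-\theta)\big(|\tilde A_n(\tilde v(\theta;v_1,v_2))|_{\tilde A_0}+|\tilde A_n(\tilde v(\theta;v_2,v_1))|_{\tilde A_0}\big)d\theta,$$ $$\Sigma(v_1,v_2;n)=\int_0^1(1-\theta)\big(\tilde A_n(\tilde v(\theta;v_1,v_2))-\tilde A_n(\tilde v(\theta;v_2,v_1))\big)d\theta .$$ **Discretization.** Let $\Omega\subset\mathbb R^d$ be open, bounded and connected, and let $\mathcal T_h$ be a finite mesh of $\Omega$ of disjoint, non-singular elements $K=\psi_K(K_{ref})$ with faces $\phi_F(F_{ref})$, where $K_{ref}$, $F_{ref}$ are polytopes and $\psi_K$, $\phi_F$ are injective polynomial maps of degree at most $p$ with derivative of full rank. Every face lies on one side of each adjacent element; it belongs to exactly one element if it lies on $\partial\Omega$, and to exactly two otherwise. Let $\partial\mathcal T_h$ be the collection of element boundaries (interior faces count twice), with outward unit normal $n$. Let $\mathcal V_h^k$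 be the $\mathbb R^m$-valued functions on $\mathcal T_h$ that are polynomial of degree $\le k$ on $K_{ref}$ after composition with each $\psi_K$, and let $\mathcal M_h^k$ be the $\mathbb R^m$-valued functions on the faces that are polynomial of degree $\le k$ on $F_{ref}$ after composition with each $\phi_F$ and continuous on the union of a prescribed (arbitrary) set of faces. For a stabilization matrix $\sigma$ let $\hat f_h=\tfrac12(F(\hat v_h)+F(v_h))\cdot n+\tfrac12\sigma(\hat v_h,v_h;n)(v_h-\hat v_h)$. A solution of the entropy-variable hybridized DG discretization is a pair $(v_h(t),\hat v_h(t))\in\mathcal V_h^k\times\mathcal M_h^k$, with $v_h$ differentiable in $t$, such that for all $t\in(0,t_f)$ and all $(w,\mu)\in\mathcal V_h^k\times\mathcal M_h^k$ $$(\partial_t u(v_h),w)_{\mathcal T_h}-(F(v_h),\nabla w)_{\mathcal T_h}+\langle\hat f_h,w\rangle_{\partial\mathcal T_h}=0,\qquad \langle\hat f_h,\mu\rangle_{\partial\mathcal T_h\setminus\partial\Omega}+\langle\hat b_h(\hat v_h,v_h;v^{\partial\Omega}),\mu\rangle_{\partial\Omega}=0,$$ and $(v_h(0)-v(u_0),w)_{\mathcal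 T_h}=0$ for all $w\in\mathcal V_h^k$. Here $\hat b_h$ is an arbitrary boundary condition term, integrable over $\partial\Omega$ along the solution. Let $$\mathcal B_{\partial\Omega}=\int_{\partial\Omega}\mathcal F_n(\hat v_h)-\int_{\partial\Omega}\hat v_h^tF_n(\hat v_h)+\int_{\partial\Omega}\hat v_h^t(\hat f_h-\hat b_h).$$ **Statement.** Put $A^{\pm}_{n,\tilde A_0}=\tfrac12(A_n\pm|A_n|)\tilde A_0$ and $$\mathcal D(v_h,\hat v_h)=\int_{\partial\mathcal T_h}\int_0^1(1-\theta)(v_h-\hat v_h)^t\Big(A^+_{n,\tilde A_0}(\tilde v(\theta;v_h,\hat v_h);n)-A^-_{n,\tilde A_0}(\tilde v(\theta;\hat v_h,v_h);n)\Big)(v_h-\hat v_h)\,d\theta .$$ 1. On $X_v$, for all $n$: $|\tilde A_n|_{\tilde A_0}=|A_n|\tilde A_0$ and $A^{\pm}_{n,\tilde A_0}=\tfrac12(\tilde A_n\pm|\tilde A_n|_{\tilde A_0})$. 2. For every choice of the paths $\tilde v$ and all $(v_h,\hat v_h)\in\mathcal V_h^k\times\mathcal M_h^k$ with values in $X_v$,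 $$\tfrac12\int_{\partial\mathcal T_h}(v_h-\hat v_h)^t\big[\sigma_{MV}(\hat v_h,v_h;n)-\Sigma(\hat v_h,v_h;n)\big](v_h-\hat v_h)=\mathcal D(v_h,\hat v_h).$$ 3. Let $\tilde v(\theta;v_1,v_2)=(1-\theta)v_1+\theta v_2$ be the straight paths, and let $(v_h,\hat v_h)$ be a solution of the discretization with $\sigma=\sigma_{MV}$. At every $t\in(0,t_f)$ at which $v_h$ (on the closed elements) and $\hat v_h$ (on the faces) take values in $X_v$, the total generalized entropy $\int_{\mathcal T_h}H(u(v_h))$ is differentiable in time and $$\frac{d}{dt}\int_{\mathcal T_h}H(u(v_h))+\mathcal D(v_h,\hat v_h)+\mathcal B_{\partial\Omega}(\hat v_h,v_h;v^{\partial\Omega})=0 .$$ -/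

import Mathlib

open MeasureTheory Set Function
open scoped Matrix ContDiff

noncomputable section

namespace EntropyHDG

/-! ### The compressible Euler equations in `d` space dimensions -/

/-- Index set of the `m = d + 2` components: mass, momentum, energy. -/
abbrev Comp (d : ℕ) : Type := Unit ⊕ (Fin d ⊕ Unit)

/-- The state space `ℝ^m`, used for conservation variables and for entropy variables. -/
abbrev State (d : ℕ) : Type := Comp d → ℝ

/-- The state with the given mass, momentum and energy components. -/
def mkState {d : ℕ} (a : ℝ) (b : Fin d → ℝ) (c : ℝ) : State d :=
  Sum.elim (fun _ => a) (Sum.elim b (fun _ => c))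

/-- Density `ρ`. -/
def density {d : ℕ} (u : State d) : ℝ := u (Sum.inl ())

/-- Total energy per unit volume `ρE`. -/
def energy {d : ℕ} (u : State d) : ℝ := u (Sum.inr (Sum.inr ()))

/-- Velocity `V = (ρV) / ρ`. -/
def velocity {d : ℕ} (u : State d) : Fin d → ℝ := fun i => u (Sum.inr (Sum.inl i)) / density u

/-- Pressure of a calorically perfect gas, `p = (γ - 1) (ρE - ρ |V|² / 2)`. -/
def pressure {d : ℕ} (γ : ℝ) (u : State d) : ℝ :=
  (γ - 1) * (energy u - density u * (velocity u ⬝ᵥ velocity u) / 2)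

/-- The set `X_u` of physical states. -/
def physicalU (d : ℕ) (γ : ℝ) : Set (State d) := {u | 0 < density u ∧ 0 < pressure γ u}

/-- The inviscid flux `F(u)`; the entry `flux γ u i j` is `F_{ij}`. -/
def flux {d : ℕ} (γ : ℝ) (u : State d) : Matrix (Comp d) (Fin d) ℝ :=
  Matrix.of fun i j =>
    mkState (density u * velocity u j)
      (fun l => density u * velocity u l * velocity u j + if l = j then pressure γ u else 0)
      (velocity u j * (energy u + pressure γ u)) i

/-- `F(u) · n`. -/
def fluxN {d : ℕ} (γ : ℝ) (n : Fin d → ℝ) (u : State d) : State d := flux γ u *ᵥ n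

/-- Non-dimensional thermodynamic entropy `s = log (p / ρ^γ) - s₀`. -/
def thermoEntropy {d : ℕ} (γ s0 : ℝ) (u : State d) : ℝ :=
  Real.log (pressure γ u / density u ^ γ) - s0

/-- Generalized entropy `H = - ρ s`. -/
def entropyH {d : ℕ} (γ s0 : ℝ) (u : State d) : ℝ := -density u * thermoEntropy γ s0 u

/-- Normal entropy flux `𝓕(u) · n`, where `𝓕 = H V`. -/
def entropyFluxN {d : ℕ} (γ s0 : ℝ) (n : Fin d → ℝ) (u : State d) : ℝ :=
  (entropyH γ s0 u • velocity u) ⬝ᵥ n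

/-- Entropy variables `v(u)`. -/
def entropyVars {d : ℕ} (γ s0 : ℝ) (u : State d) : State d :=
  (γ - 1) • mkState
    (-thermoEntropy γ s0 u / (γ - 1) + (γ + 1) / (γ - 1) - energy u / pressure γ u)
    (fun i => density u * velocity u i / pressure γ u)
    (-density u / pressure γ u)

/-- The set `X_v = v(X_u)` of physical states in entropy variables. -/
def physicalV (d : ℕ) (γ s0 : ℝ) : Set (State d) := entropyVars γ s0 '' physicalU d γ

/-- The inverse mapping `u(v)`, defined on `X_v`. -/
def consVars {d : ℕ} (γ s0 : ℝ) (v : State d) : State d :=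
  invFunOn (entropyVars γ s0) (physicalU d γ) v

/-! ### Absolute values of matrices and stabilization matrices -/

/-- The Jacobian matrix of a map between state spaces. -/
def jacobian {d : ℕ} (f : State d → State d) (w : State d) : Matrix (Comp d) (Comp d) ℝ :=
  Matrix.of fun i j => fderiv ℝ f w (Pi.single j 1) i

/-- `A` is diagonalizable over the reals: `A = P diag(l) P⁻¹`. -/
def IsDiagonalization {ι : Type} [Fintype ι] [DecidableEq ι] (A : Matrix ι ι ℝ)
    (Pl : Matrix ι ι ℝ × (ι → ℝ)) : Prop :=
  IsUnit Pl.1.det ∧ A = Pl.1 * Matrix.diagonal Pl.2 * Pl.1⁻¹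

open Classical in
/-- The absolute value `|A| = P diag(|l|) P⁻¹` of a real diagonalizable matrix
`A = P diag(l) P⁻¹`. See `matAbs_eq` for the independence of the diagonalization. -/
def matAbs {ι : Type} [Fintype ι] [DecidableEq ι] (A : Matrix ι ι ℝ) : Matrix ι ι ℝ :=
  if h : ∃ Pl, IsDiagonalization A Pl then
    h.choose.1 * Matrix.diagonal (fun i => |h.choose.2 i|) * h.choose.1⁻¹
  else 0

theorem matAbs_eq {ι : Type} [Fintype ι] [DecidableEq ι] {A : Matrix ι ι ℝ}
    {Pl : Matrix ι ι ℝ × (ι → ℝ)} (h : IsDiagonalization A Pl) :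
    matAbs A = Pl.1 * Matrix.diagonal (fun i => |Pl.2 i|) * Pl.1⁻¹ := by
  have hex : ∃ Pl, IsDiagonalization A Pl := ⟨Pl, h⟩
  obtain ⟨P, l⟩ := Pl
  unfold matAbs
  rw [dif_pos hex]
  obtain ⟨hQ, hAQ⟩ := hex.choose_spec
  obtain ⟨hP, hAP⟩ := h
  set Q := hex.choose.1
  set e := hex.choose.2
  simp only at hP hAP ⊢
  have h1 : (Q⁻¹ * P) * Matrix.diagonal l = Matrix.diagonal e * (Q⁻¹ * P) := by
    have h2 : Q⁻¹ * (Q * Matrix.diagonal e * Q⁻¹) * P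
        = Q⁻¹ * (P * Matrix.diagonal l * P⁻¹) * P := by rw [← hAQ, ← hAP]
    calc (Q⁻¹ * P) * Matrix.diagonal l
        = Q⁻¹ * (P * Matrix.diagonal l * (P⁻¹ * P)) := by
          rw [Matrix.nonsing_inv_mul _ hP]; simp [Matrix.mul_assoc]
      _ = Q⁻¹ * (P * Matrix.diagonal l * P⁻¹) * P := by simp only [Matrix.mul_assoc]
      _ = Q⁻¹ * (Q * Matrix.diagonal e * Q⁻¹) * P := h2.symm
      _ = (Q⁻¹ * Q) * Matrix.diagonal e * (Q⁻¹ * P) := by simp only [Matrix.mul_assoc]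
      _ = Matrix.diagonal e * (Q⁻¹ * P) := by rw [Matrix.nonsing_inv_mul _ hQ]; simp
  have h3 : (Q⁻¹ * P) * Matrix.diagonal (fun i => |l i|)
      = Matrix.diagonal (fun i => |e i|) * (Q⁻¹ * P) := by
    ext i j
    have := congrFun (congrFun h1 i) j
    rw [Matrix.mul_diagonal, Matrix.diagonal_mul] at this ⊢
    rcases eq_or_ne ((Q⁻¹ * P) i j) 0 with h0 | h0
    · simp [h0]
    · have : l j = e i := by
        have h4 : (Q⁻¹ * P) i j * l j = (Q⁻¹ * P) i j * e i := by rw [this, mul_comm]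
        exact mul_left_cancel₀ h0 h4
      rw [this, mul_comm]
  calc Q * Matrix.diagonal (fun i => |e i|) * Q⁻¹
      = Q * (Matrix.diagonal (fun i => |e i|) * (Q⁻¹ * P)) * P⁻¹ := by
        simp only [Matrix.mul_assoc]; rw [Matrix.mul_nonsing_inv _ hP]; simp
    _ = Q * ((Q⁻¹ * P) * Matrix.diagonal (fun i => |l i|)) * P⁻¹ := by rw [h3]
    _ = (Q * Q⁻¹) * P * Matrix.diagonal (fun i => |l i|) * P⁻¹ := by
        simp only [Matrix.mul_assoc]
    _ = P * Matrix.diagonal (fun i => |l i|) * P⁻¹ := by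
        rw [Matrix.mul_nonsing_inv _ hQ]; simp

/-- `A_n = (∂F/∂u) · n`, evaluated at the state with entropy variables `v`. -/
def jacN {d : ℕ} (γ s0 : ℝ) (n : Fin d → ℝ) (v : State d) : Matrix (Comp d) (Comp d) ℝ :=
  jacobian (fluxN γ n) (consVars γ s0 v)

/-- The metric tensor `Ã₀ = ∂u/∂v`. -/
def metric {d : ℕ} (γ s0 : ℝ) (v : State d) : Matrix (Comp d) (Comp d) ℝ :=
  jacobian (consVars γ s0) v

/-- `Ã_n = A_n Ã₀`. -/
def symJacN {d : ℕ} (γ s0 : ℝ) (n : Fin d → ℝ) (v : State d) : Matrix (Comp d) (Comp d) ℝ :=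
  jacN γ s0 n v * metric γ s0 v

/-- The generalized absolute value `|Ã_n|_{Ã₀} = Ã₀ |Ã₀⁻¹ Ã_n|`. -/
def genAbs {d : ℕ} (γ s0 : ℝ) (n : Fin d → ℝ) (v : State d) : Matrix (Comp d) (Comp d) ℝ :=
  metric γ s0 v * matAbs ((metric γ s0 v)⁻¹ * symJacN γ s0 n v)

/-- `A⁺_{n,Ã₀} = A_n⁺ Ã₀` with `A_n⁺ = (A_n + |A_n|) / 2`. -/
def jacPlus {d : ℕ} (γ s0 : ℝ) (n : Fin d → ℝ) (v : State d) : Matrix (Comp d) (Comp d) ℝ :=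
  ((1 / 2 : ℝ) • (jacN γ s0 n v + matAbs (jacN γ s0 n v))) * metric γ s0 v

/-- `A⁻_{n,Ã₀} = A_n⁻ Ã₀` with `A_n⁻ = (A_n - |A_n|) / 2`. -/
def jacMinus {d : ℕ} (γ s0 : ℝ) (n : Fin d → ℝ) (v : State d) : Matrix (Comp d) (Comp d) ℝ :=
  ((1 / 2 : ℝ) • (jacN γ s0 n v - matAbs (jacN γ s0 n v))) * metric γ s0 v

/-- A choice, for all `v₁, v₂ ∈ X_v`, of a smooth path `θ ↦ path θ v₁ v₂` in `X_v` from `v₁`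
to `v₂`. -/
structure IsPath {d : ℕ} (γ s0 : ℝ) (path : ℝ → State d → State d → State d) : Prop where
  smooth : ∀ v₁ ∈ physicalV d γ s0, ∀ v₂ ∈ physicalV d γ s0,
    ContDiffOn ℝ ∞ (fun θ => path θ v₁ v₂) (Icc 0 1)
  mem : ∀ v₁ ∈ physicalV d γ s0, ∀ v₂ ∈ physicalV d γ s0, ∀ θ ∈ Icc (0 : ℝ) 1,
    path θ v₁ v₂ ∈ physicalV d γ s0
  source : ∀ v₁ ∈ physicalV d γ s0, ∀ v₂ ∈ physicalV d γ s0, path 0 v₁ v₂ = v₁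
  target : ∀ v₁ ∈ physicalV d γ s0, ∀ v₂ ∈ physicalV d γ s0, path 1 v₁ v₂ = v₂

/-- The mean-value stabilization matrix `σ_MV(v₁, v₂; n)`. -/
def sigmaMV {d : ℕ} (γ s0 : ℝ) (path : ℝ → State d → State d → State d)
    (v₁ v₂ : State d) (n : Fin d → ℝ) : Matrix (Comp d) (Comp d) ℝ :=
  Matrix.of fun i j => ∫ θ in (0 : ℝ)..1, (1 - θ) *
    (genAbs γ s0 n (path θ v₁ v₂) i j + genAbs γ s0 n (path θ v₂ v₁) i j)

/-- The matrix `Σ(v₁, v₂; n)`. -/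
def bigSigma {d : ℕ} (γ s0 : ℝ) (path : ℝ → State d → State d → State d)
    (v₁ v₂ : State d) (n : Fin d → ℝ) : Matrix (Comp d) (Comp d) ℝ :=
  Matrix.of fun i j => ∫ θ in (0 : ℝ)..1, (1 - θ) *
    (symJacN γ s0 n (path θ v₁ v₂) i j - symJacN γ s0 n (path θ v₂ v₁) i j)

/-- The inviscid numerical flux `f̂_h(v̂, v)` for a stabilization matrix `σ(v̂, v; n)`. -/
def numFlux {d : ℕ} (γ s0 : ℝ)
    (σ : State d → State d → (Fin d → ℝ) → Matrix (Comp d) (Comp d) ℝ)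
    (vhat v : State d) (n : Fin d → ℝ) : State d :=
  (1 / 2 : ℝ) • (fluxN γ n (consVars γ s0 vhat) + fluxN γ n (consVars γ s0 v))
    + (1 / 2 : ℝ) • (σ vhat v n *ᵥ (v - vhat))

/-! ### Meshes -/

/-- A full-dimensional compact convex polytope in `ℝ^n` (a simplex, a cube, ...), given by its
facets: `N j` is the outward unit normal of the facet `j`, and no facet is redundant. It serves
as reference element and as reference face. For `n = 0` it is the one-point space. -/
structure Polytope (n : ℕ) where
  Facet : Type
  [fintypeFacet : Fintype Facet]
  N : Facet → Fin n → ℝ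
  c : Facet → ℝ
  unit : ∀ j, N j ⬝ᵥ N j = 1
  facet_nonempty : ∀ j, ∃ x, N j ⬝ᵥ x = c j ∧ ∀ i, i ≠ j → N i ⬝ᵥ x < c i
  solid : ∃ x, ∀ j, N j ⬝ᵥ x < c j
  bounded : Bornology.IsBounded {x | ∀ j, N j ⬝ᵥ x ≤ c j}

attribute [instance] Polytope.fintypeFacet

/-- The points of the (closed) polytope. -/
def Polytope.carrier {n : ℕ} (P : Polytope n) : Set (Fin n → ℝ) := {x | ∀ j, P.N j ⬝ᵥ x ≤ P.c j}

/-- The points of the (closed) facet `j`. -/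
def Polytope.facet {n : ℕ} (P : Polytope n) (j : P.Facet) : Set (Fin n → ℝ) :=
  {x | x ∈ P.carrier ∧ P.N j ⬝ᵥ x = P.c j}

/-- The polynomial map `ℝ^a → ℝ^b` with components `q i`. -/
def polyMap {a b : ℕ} (q : Fin b → MvPolynomial (Fin a) ℝ) (x : Fin a → ℝ) : Fin b → ℝ :=
  fun i => MvPolynomial.eval x (q i)

/-- The Jacobian matrix of `polyMap q`. -/
def polyJac {a b : ℕ} (q : Fin b → MvPolynomial (Fin a) ℝ) (x : Fin a → ℝ) :
    Matrix (Fin b) (Fin a) ℝ :=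
  Matrix.of fun i j => MvPolynomial.eval x (MvPolynomial.pderiv j (q i))

/-- A partition of `Ω ⊆ ℝ^d`, `d = n + 1`, into finitely many disjoint, non-singular, `p`-th
degree curved elements `K = ψ_K(K_ref)`, together with the set of its faces `F = φ_F(F_ref)`.
Every face lies in one side `ψ_K(facet j)` of each element that it bounds. -/
structure Mesh (n p : ℕ) (Ω : Set (Fin (n + 1) → ℝ)) where
  /-- reference element -/
  Kref : Polytope (n + 1)
  /-- reference face -/
  Fref : Polytope n
  Elem : Type
  Face : Type
  [fintypeElem : Fintype Elem]
  [fintypeFace : Fintype Face]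
  /-- the parametric mappings of the elements -/
  psi : Elem → Fin (n + 1) → MvPolynomial (Fin (n + 1)) ℝ
  /-- the parametric mappings of the faces -/
  phi : Face → Fin (n + 1) → MvPolynomial (Fin n) ℝ
  psi_degree : ∀ K i, (psi K i).totalDegree ≤ p
  phi_degree : ∀ F i, (phi F i).totalDegree ≤ p
  psi_injOn : ∀ K, InjOn (polyMap (psi K)) Kref.carrier
  psi_nonsingular : ∀ K, ∀ x ∈ Kref.carrier, (polyJac (psi K) x).det ≠ 0
  phi_injOn : ∀ F, InjOn (polyMap (phi F)) Fref.carrier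
  phi_nonsingular : ∀ F, ∀ s ∈ Fref.carrier,
    ((polyJac (phi F) s)ᵀ * polyJac (phi F) s).det ≠ 0
  elem_subset : ∀ K, polyMap (psi K) '' interior Kref.carrier ⊆ Ω
  elem_disjoint : ∀ K L, K ≠ L → Disjoint (polyMap (psi K) '' interior Kref.carrier)
    (polyMap (psi L) '' interior Kref.carrier)
  elem_cover : closure Ω = ⋃ K, polyMap (psi K) '' Kref.carrier
  face_disjoint : ∀ F G, F ≠ G → Disjoint (polyMap (phi F) '' interior Fref.carrier)
    (polyMap (phi G) '' interior Fref.carrier)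
  side_cover : ∀ K j, polyMap (psi K) '' Kref.facet j ⊆
    ⋃ F, ⋃ (_ : polyMap (phi F) '' Fref.carrier ⊆ polyMap (psi K) '' Kref.facet j),
      polyMap (phi F) '' Fref.carrier
  /-- a face on the boundary of `Ω` belongs to exactly one element -/
  boundary_face : ∀ F, polyMap (phi F) '' Fref.carrier ⊆ frontier Ω →
    ∃ K j, ∀ L l, polyMap (phi F) '' Fref.carrier ⊆ polyMap (psi L) '' Kref.facet l ↔
      (L = K ∧ l = j)
  /-- any other face belongs to exactly two elements -/
  interior_face : ∀ F, ¬ polyMap (phi F) '' Fref.carrier ⊆ frontier Ω →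
    ∃ K j K' j', K ≠ K' ∧
      ∀ L l, polyMap (phi F) '' Fref.carrier ⊆ polyMap (psi L) '' Kref.facet l ↔
        ((L = K ∧ l = j) ∨ (L = K' ∧ l = j'))

attribute [instance] Mesh.fintypeElem Mesh.fintypeFace

namespace Mesh

variable {n p : ℕ} {Ω : Set (Fin (n + 1) → ℝ)} (M : Mesh n p Ω)

/-- The (open) element `K`. -/
def elem (K : M.Elem) : Set (Fin (n + 1) → ℝ) := polyMap (M.psi K) '' interior M.Kref.carrier

/-- The closure of the element `K`. -/
def closedElem (K : M.Elem) : Set (Fin (n + 1) → ℝ) := polyMap (M.psi K) '' M.Kref.carrier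

/-- The side of the element `K` that corresponds to the facet `j` of the reference element. -/
def side (K : M.Elem) (j : M.Kref.Facet) : Set (Fin (n + 1) → ℝ) :=
  polyMap (M.psi K) '' M.Kref.facet j

/-- The (closed) face `F`. -/
def face (F : M.Face) : Set (Fin (n + 1) → ℝ) := polyMap (M.phi F) '' M.Fref.carrier

/-- The set `𝓔_h^B` of boundary faces. -/
def boundaryFaces : Set M.Face := {F | M.face F ⊆ frontier Ω}

/-- Unnormalized outward normal: the gradient of `N_j · ψ_K⁻¹`, i.e. `(Dψ_K)⁻ᵀ N_j`, at the
point `x` of the side `j` of `K`. -/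
def conormal (K : M.Elem) (j : M.Kref.Facet) (x : Fin (n + 1) → ℝ) : Fin (n + 1) → ℝ :=
  ((polyJac (M.psi K) (invFunOn (polyMap (M.psi K)) M.Kref.carrier x))⁻¹)ᵀ *ᵥ M.Kref.N j

/-- The unit normal pointing outwards from `K` at the point `x` of the side `j` of `K`. -/
def normal (K : M.Elem) (j : M.Kref.Facet) (x : Fin (n + 1) → ℝ) : Fin (n + 1) → ℝ :=
  (Real.sqrt (M.conormal K j x ⬝ᵥ M.conormal K j x))⁻¹ • M.conormal K j x

/-- The surface element of the parametrization `φ_F`. -/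
def surfElem (F : M.Face) (s : Fin n → ℝ) : ℝ :=
  Real.sqrt (((polyJac (M.phi F) s)ᵀ * polyJac (M.phi F) s).det)

/-- The surface integral of `g` over the face `F`. -/
def faceInt (F : M.Face) (g : (Fin (n + 1) → ℝ) → ℝ) : ℝ :=
  ∫ s in M.Fref.carrier, g (polyMap (M.phi F) s) * M.surfElem F s

open Classical in
/-- `skelInt S g` is the sum, over all elements `K` and all faces `F ∈ S` of `K`, of the surface
integrals of `x ↦ g K F x (n x)`, where `n` is the unit normal pointing outwards from `K`.
So `S = univ`
gives the integral over `∂𝓣_h`, in which each interior face is counted twice, the set of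
boundary faces gives the integral over `∂Ω`, and its complement the one over `∂𝓣_h \ ∂Ω`. -/
def skelInt (S : Set M.Face)
    (g : M.Elem → M.Face → (Fin (n + 1) → ℝ) → (Fin (n + 1) → ℝ) → ℝ) : ℝ :=
  ∑ K, ∑ j, ∑ F, if F ∈ S ∧ M.face F ⊆ M.side K j then
    M.faceInt F (fun x => g K F x (M.normal K j x)) else 0

/-- The sum over all elements `K` of the volume integrals of `g K`. -/
def volInt (g : M.Elem → (Fin (n + 1) → ℝ) → ℝ) : ℝ := ∑ K, ∫ x in M.elem K, g K x

/-! ### Finite element spaces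

A function on `𝓣_h` is a family of functions, one for each (closed) element, and a function on
the skeleton `𝓔_h` is a family of functions, one for each (closed) face. Values outside of the
element or face are irrelevant. -/

/-- Functions on `𝓣_h` with values in the state space. -/
abbrev ElemFun : Type := M.Elem → (Fin (n + 1) → ℝ) → State (n + 1)

/-- Functions on `𝓔_h` with values in the state space. -/
abbrev FaceFun : Type := M.Face → (Fin (n + 1) → ℝ) → State (n + 1)

/-- The space `𝓥_h^k`. -/
def spaceV (k : ℕ) : Set M.ElemFun :=
  {w | ∀ K i, ∃ q : MvPolynomial (Fin (n + 1)) ℝ, q.totalDegree ≤ k ∧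
    ∀ x ∈ M.Kref.carrier, w K (polyMap (M.psi K) x) i = MvPolynomial.eval x q}

/-- The space `𝓜_h^k` of functions that are continuous on the part `EE` of the skeleton. -/
def spaceM (k : ℕ) (EE : Set M.Face) : Set M.FaceFun :=
  {μ | (∀ F i, ∃ q : MvPolynomial (Fin n) ℝ, q.totalDegree ≤ k ∧
      ∀ s ∈ M.Fref.carrier, μ F (polyMap (M.phi F) s) i = MvPolynomial.eval s q) ∧
    ∀ F ∈ EE, ∀ G ∈ EE, ∀ x ∈ M.face F ∩ M.face G, μ F x = μ G x}

/-- Pointwise physical numerical states. -/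
def IsPhysical (γ s0 : ℝ) (v : M.ElemFun) (vhat : M.FaceFun) : Prop :=
  (∀ K, ∀ x ∈ M.closedElem K, v K x ∈ physicalV (n + 1) γ s0) ∧
  ∀ F, ∀ x ∈ M.face F, vhat F x ∈ physicalV (n + 1) γ s0

/-! ### The discretization -/

/-- `(v_h, v̂_h)` solves the entropy-variable hybridized DG discretization of the unsteady
compressible Euler equations on `(0, tf)`, with stabilization matrix `σ`, boundary condition term
`bhat F v̂ v v^∂Ω n`, boundary state `vbd` and initial condition `u₀`. -/
structure IsHDGSolution (k : ℕ) (EE : Set M.Face) (γ s0 tf : ℝ)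
    (σ : State (n + 1) → State (n + 1) → (Fin (n + 1) → ℝ) →
      Matrix (Comp (n + 1)) (Comp (n + 1)) ℝ)
    (bhat : M.Face → State (n + 1) → State (n + 1) → State (n + 1) → (Fin (n + 1) → ℝ) →
      State (n + 1))
    (vbd : ℝ → (Fin (n + 1) → ℝ) → State (n + 1))
    (u₀ : (Fin (n + 1) → ℝ) → State (n + 1))
    (v : ℝ → M.ElemFun) (vhat : ℝ → M.FaceFun) : Prop where
  mem_V : ∀ t ∈ Ico 0 tf, v t ∈ M.spaceV k
  mem_M : ∀ t ∈ Ioo 0 tf, vhat t ∈ M.spaceM k EE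
  differentiable : ∀ t ∈ Ioo 0 tf, ∀ K, ∀ x ∈ M.closedElem K,
    DifferentiableAt ℝ (fun τ => v τ K x) t
  /-- the boundary condition term is integrable, so that its pairing with `μ` makes sense -/
  bhat_integrable : ∀ t ∈ Ioo 0 tf, ∀ K j, ∀ F ∈ M.boundaryFaces, M.face F ⊆ M.side K j →
    ∀ i, IntegrableOn (fun s => (fun x =>
      bhat F (vhat t F x) (v t K x) (vbd t x) (M.normal K j x) i) (polyMap (M.phi F) s)
        * M.surfElem F s) M.Fref.carrier
  elem_eq : ∀ t ∈ Ioo 0 tf, ∀ w ∈ M.spaceV k,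
    M.volInt (fun K x => deriv (fun τ => consVars γ s0 (v τ K x)) t ⬝ᵥ w K x)
      - M.volInt (fun K x => ∑ i, ∑ l, flux γ (consVars γ s0 (v t K x)) i l
          * fderiv ℝ (w K) x (Pi.single l 1) i)
      + M.skelInt univ (fun K F x ν => numFlux γ s0 σ (vhat t F x) (v t K x) ν ⬝ᵥ w K x) = 0
  face_eq : ∀ t ∈ Ioo 0 tf, ∀ μ ∈ M.spaceM k EE,
    M.skelInt M.boundaryFacesᶜ
        (fun K F x ν => numFlux γ s0 σ (vhat t F x) (v t K x) ν ⬝ᵥ μ F x)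
      + M.skelInt M.boundaryFaces
        (fun K F x ν => bhat F (vhat t F x) (v t K x) (vbd t x) ν ⬝ᵥ μ F x) = 0
  init_eq : ∀ w ∈ M.spaceV k,
    M.volInt (fun K x => (v 0 K x - entropyVars γ s0 (u₀ x)) ⬝ᵥ w K x) = 0

/-- The total generalized entropy `∫_{𝓣_h} H(u(v_h))`. -/
def totalEntropy (γ s0 : ℝ) (v : M.ElemFun) : ℝ :=
  M.volInt (fun K x => entropyH γ s0 (consVars γ s0 (v K x)))

/-- The boundary term `𝓑_{∂Ω}(v̂_h, v_h; v^∂Ω)`. -/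
def boundaryTerm (γ s0 : ℝ)
    (σ : State (n + 1) → State (n + 1) → (Fin (n + 1) → ℝ) →
      Matrix (Comp (n + 1)) (Comp (n + 1)) ℝ)
    (bhat : M.Face → State (n + 1) → State (n + 1) → State (n + 1) → (Fin (n + 1) → ℝ) →
      State (n + 1))
    (vbd : (Fin (n + 1) → ℝ) → State (n + 1)) (v : M.ElemFun) (vhat : M.FaceFun) : ℝ :=
  M.skelInt M.boundaryFaces (fun _ F x ν => entropyFluxN γ s0 ν (consVars γ s0 (vhat F x)))
    - M.skelInt M.boundaryFaces
        (fun _ F x ν => vhat F x ⬝ᵥ fluxN γ ν (consVars γ s0 (vhat F x)))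
    + M.skelInt M.boundaryFaces (fun K F x ν => vhat F x ⬝ᵥ
        (numFlux γ s0 σ (vhat F x) (v K x) ν - bhat F (vhat F x) (v K x) (vbd x) ν))

/-- The face term `½ ∫_{∂𝓣_h} (v_h - v̂_h)ᵀ [σ(v̂_h, v_h; n) - Σ(v̂_h, v_h; n)] (v_h - v̂_h)` of
the entropy identity for a general stabilization matrix `σ`. -/
def faceTerm (γ s0 : ℝ) (path : ℝ → State (n + 1) → State (n + 1) → State (n + 1))
    (σ : State (n + 1) → State (n + 1) → (Fin (n + 1) → ℝ) →
      Matrix (Comp (n + 1)) (Comp (n + 1)) ℝ)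
    (v : M.ElemFun) (vhat : M.FaceFun) : ℝ :=
  1 / 2 * M.skelInt univ (fun K F x ν => (v K x - vhat F x) ⬝ᵥ
    ((σ (vhat F x) (v K x) ν - bigSigma γ s0 path (vhat F x) (v K x) ν) *ᵥ (v K x - vhat F x)))

/-- The term `∫_{∂𝓣_h} ∫₀¹ (1 - θ) (v_h - v̂_h)ᵀ (A⁺_{n,Ã₀}(ṽ(θ; v_h, v̂_h); n)
- A⁻_{n,Ã₀}(ṽ(θ; v̂_h, v_h); n)) (v_h - v̂_h) dθ`. -/
def meanValueFaceTerm (γ s0 : ℝ) (path : ℝ → State (n + 1) → State (n + 1) → State (n + 1))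
    (v : M.ElemFun) (vhat : M.FaceFun) : ℝ :=
  M.skelInt univ (fun K F x ν => ∫ θ in (0 : ℝ)..1, (1 - θ) * ((v K x - vhat F x) ⬝ᵥ
    ((jacPlus γ s0 ν (path θ (v K x) (vhat F x)) - jacMinus γ s0 ν (path θ (vhat F x) (v K x)))
      *ᵥ (v K x - vhat F x))))

end Mesh

end EntropyHDG

end

/-! The balance comes from testing the element equation with `w = v_h` and the face equation with `μ
= v̂_h`. Two potentials make the result telescope.

In entropy variables, `(γ-1)ρ` has gradient `u` (`hasFDerivAt_rhoE`) and `v·u = H + (γ-1)ρ`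
(`dotProduct_consE`). Hence `dH = v·du`, and the time term is the derivative of the total entropy.
The potential flux `ψ_n = (γ-1)ρ V_n = v·F_n - 𝓕_n` has gradient `F_n`
(`hasFDerivAt_potentialFlux`), so `F(v_h):∇v_h` is the divergence of `ψ(v_h)` and the volume term
becomes the integral of `ψ_n(v_h)` over element boundaries (`volInt_flux_fderiv`). Since `ψ_n(v̂_h)`
is odd in the normal, its integrals over interior faces cancel. It can therefore be inserted on all
faces at the price of a term on `∂Ω`, which is absorbed by `boundaryTerm`.

What remains on each face is `f̂·(v-v̂) - (ψ_n(v)-ψ_n(v̂))`. Because `Ã_n` is the Hessian of `ψ_n`,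
integrating by parts in `θ` along the segment and along its reverse identifies this with `½
xᵗ(σ-Σ)x`, `x = v - v̂` (`numFlux_entropy_balance`). Pairing the terms of `σ_MV - Σ` by path, rather
than by matrix, gives the form with `A⁺` and `A⁻` (`dotProduct_sigmaMV_sub_bigSigma`); the latter
step works for every choice of paths.

Splitting integrals needs regularity of `|A_n|`. The Euler Jacobian is conjugate to `V_n + S` with
`S` symmetric and `S³ = a²S`, `a = c|n|` (`jacobian_fluxN_mul`, `acoustic_pow_three`). So `|V_n +
S|` is an explicit quadratic polynomial in `S`, continuous in the state and in `n ≠ 0`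
(`matAbs_smul_one_add`).

The geometric input is the divergence theorem on curved elements. On a polytope it is the
fundamental theorem of calculus on lines. The Piola identity transports it to the element, and a
bordered determinant converts facet measure into surface measure (`integral_divergence_elem`).
Normals on the two sides of a face are opposite almost everywhere, since otherwise the two elements
would overlap.

Finally, `v_h` is only assumed differentiable in time pointwise. Interpolation in the
finite-dimensional space reduces this to finitely many nodal values, after which the total entropy
can be differentiated under the integral. -/

noncomputable section

namespace EntropyHDG

/-! ### The Euler equations in entropy variables -/

section Euler

variable {d : ℕ}

/-- The vector of momentum components. -/
def momentum (u : State d) : Fin d → ℝ := fun i => u (Sum.inr (Sum.inl i))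

@[simp] theorem density_mkState (a : ℝ) (b : Fin d → ℝ) (c : ℝ) : density (mkState a b c) = a := rfl
@[simp] theorem momentum_mkState (a : ℝ) (b : Fin d → ℝ) (c : ℝ) :
    momentum (mkState a b c) = b := rfl
@[simp] theorem energy_mkState (a : ℝ) (b : Fin d → ℝ) (c : ℝ) : energy (mkState a b c) = c := rfl

@[simp] theorem mkState_eta (u : State d) : mkState (density u) (momentum u) (energy u) = u := by
  ext (i | i | i) <;> rfl

@[simp] theorem mkState_inl (a : ℝ) (b : Fin d → ℝ) (c : ℝ) (i : Unit) :
    mkState a b c (Sum.inl i) = a := rfl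
@[simp] theorem mkState_inr_inl (a : ℝ) (b : Fin d → ℝ) (c : ℝ) (i : Fin d) :
    mkState a b c (Sum.inr (Sum.inl i)) = b i := rfl
@[simp] theorem mkState_inr_inr (a : ℝ) (b : Fin d → ℝ) (c : ℝ) (i : Unit) :
    mkState a b c (Sum.inr (Sum.inr i)) = c := rfl

theorem state_ext {u w : State d} (h1 : density u = density w) (h2 : momentum u = momentum w)
    (h3 : energy u = energy w) : u = w := by
  rw [← mkState_eta u, ← mkState_eta w, h1, h2, h3]

theorem momentum_apply (u : State d) (i : Fin d) : momentum u i = u (Sum.inr (Sum.inl i)) := rfl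

@[simp] theorem density_add (u w : State d) : density (u + w) = density u + density w := rfl
@[simp] theorem momentum_add (u w : State d) : momentum (u + w) = momentum u + momentum w := rfl
@[simp] theorem energy_add (u w : State d) : energy (u + w) = energy u + energy w := rfl
@[simp] theorem density_smul (a : ℝ) (u : State d) : density (a • u) = a * density u := rfl
@[simp] theorem momentum_smul (a : ℝ) (u : State d) : momentum (a • u) = a • momentum u := rfl
@[simp] theorem energy_smul (a : ℝ) (u : State d) : energy (a • u) = a * energy u := rfl

theorem dotProduct_state (u w : State d) :
    u ⬝ᵥ w = density u * density w + momentum u ⬝ᵥ momentum w + energy u * energy w := by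
  simp [dotProduct, Fintype.sum_sum_type, density, momentum, energy, add_assoc]

/-- The velocity as a function of the entropy variables. -/
def velE (v : State d) : Fin d → ℝ := fun i => momentum v i / (-energy v)

/-- The density as a function of the entropy variables. -/
def rhoE (γ s0 : ℝ) (v : State d) : ℝ :=
  Real.exp ((Real.log ((γ - 1) / (-energy v)) - γ + density v
    + (momentum v ⬝ᵥ momentum v) / (2 * (-energy v)) - s0) / (γ - 1))

/-- The conservation variables as an explicit function of the entropy variables. -/
def consE (γ s0 : ℝ) (v : State d) : State d :=
  mkState (rhoE γ s0 v) (rhoE γ s0 v • velE v)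
    (rhoE γ s0 v * (velE v ⬝ᵥ velE v) / 2 + rhoE γ s0 v / (-energy v))

theorem rhoE_pos (γ s0 : ℝ) (v : State d) : 0 < rhoE γ s0 v := Real.exp_pos _

@[simp] theorem density_consE (γ s0 : ℝ) (v : State d) : density (consE γ s0 v) = rhoE γ s0 v := rfl

@[simp] theorem velocity_consE (γ s0 : ℝ) (v : State d) : velocity (consE γ s0 v) = velE v := by
  ext i
  have := (rhoE_pos γ s0 v).ne'
  change rhoE γ s0 v * velE v i / rhoE γ s0 v = _
  field_simp

@[simp] theorem pressure_consE (γ s0 : ℝ) (v : State d) :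
    pressure γ (consE γ s0 v) = (γ - 1) * (rhoE γ s0 v / (-energy v)) := by
  rw [pressure, velocity_consE, density_consE, consE, energy_mkState]
  ring

theorem velE_dot_velE (v : State d) :
    velE v ⬝ᵥ velE v = (momentum v ⬝ᵥ momentum v) / (energy v) ^ 2 := by
  simp only [velE, dotProduct, Finset.sum_div]
  refine Finset.sum_congr rfl fun i _ => ?_
  rw [div_mul_div_comm]
  ring

theorem consE_mem {γ : ℝ} (hγ : 1 < γ) (s0 : ℝ) {v : State d} (hv : energy v < 0) :
    consE γ s0 v ∈ physicalU d γ := by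
  refine ⟨rhoE_pos _ _ _, ?_⟩
  rw [pressure_consE]
  exact mul_pos (by linarith) (div_pos (rhoE_pos _ _ _) (by linarith))

theorem log_rhoE (γ s0 : ℝ) (v : State d) : Real.log (rhoE γ s0 v) =
    (Real.log ((γ - 1) / (-energy v)) - γ + density v
    + (momentum v ⬝ᵥ momentum v) / (2 * (-energy v)) - s0) / (γ - 1) := Real.log_exp _

theorem thermoEntropy_eq {γ : ℝ} (s0 : ℝ) {u : State d} (hu : u ∈ physicalU d γ) :
    thermoEntropy γ s0 u = Real.log (pressure γ u) - γ * Real.log (density u) - s0 := by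
  rw [thermoEntropy, Real.log_div hu.2.ne' (Real.rpow_pos_of_pos hu.1 _).ne',
    Real.log_rpow hu.1]

/-- The exponent in `rhoE` is made for this identity: with `-energy v = (γ-1)ρ/p`, the first entropy
variable is `-s + γ - |m|²/(2(-energy v))`, where `m` is its momentum part. This is solved for `s`,
and then for `log ρ`. -/
theorem thermoEntropy_consE {γ : ℝ} (hγ : 1 < γ) (s0 : ℝ) {v : State d} (hv : energy v < 0) :
    thermoEntropy γ s0 (consE γ s0 v)
      = γ - density v - (momentum v ⬝ᵥ momentum v) / (2 * (-energy v)) := by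
  have hg : γ - 1 ≠ 0 := by linarith
  have hρ := rhoE_pos γ s0 v
  have hθ : 0 < (γ - 1) / (-energy v) := div_pos (by linarith) (by linarith)
  rw [thermoEntropy_eq s0 (consE_mem hγ s0 hv), pressure_consE, density_consE,
    show (γ - 1) * (rhoE γ s0 v / (-energy v)) = (γ - 1) / (-energy v) * rhoE γ s0 v by ring,
    Real.log_mul hθ.ne' hρ.ne', log_rhoE]
  field_simp
  ring

theorem entropyVars_consE {γ : ℝ} (hγ : 1 < γ) (s0 : ℝ) {v : State d} (hv : energy v < 0) :
    entropyVars γ s0 (consE γ s0 v) = v := by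
  have hg : γ - 1 ≠ 0 := by linarith
  have hρ := (rhoE_pos γ s0 v).ne'
  have hv' := hv.ne
  unfold entropyVars
  rw [thermoEntropy_consE hγ s0 hv, pressure_consE, velocity_consE, density_consE]
  refine state_ext ?_ ?_ ?_
  · rw [density_smul, density_mkState, consE, energy_mkState, velE_dot_velE]
    field_simp
    ring
  · ext i
    simp only [momentum_smul, momentum_mkState, Pi.smul_apply, smul_eq_mul, velE]
    field_simp
  · simp only [energy_smul, energy_mkState]
    field_simp

theorem energy_entropyVars (γ s0 : ℝ) (u : State d) :
    energy (entropyVars γ s0 u) = (γ - 1) * (-density u / pressure γ u) := rfl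

theorem energy_entropyVars_neg {γ : ℝ} (hγ : 1 < γ) (s0 : ℝ) {u : State d}
    (hu : u ∈ physicalU d γ) : energy (entropyVars γ s0 u) < 0 := by
  rw [energy_entropyVars]
  refine mul_neg_of_pos_of_neg (by linarith) (div_neg_of_neg_of_pos (by linarith [hu.1]) hu.2)

theorem velE_entropyVars {γ : ℝ} (hγ : 1 < γ) (s0 : ℝ) {u : State d}
    (hu : u ∈ physicalU d γ) : velE (entropyVars γ s0 u) = velocity u := by
  have hg : γ - 1 ≠ 0 := by linarith
  have h1 := hu.1.ne'
  have h2 := hu.2.ne'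
  ext i
  rw [velE, energy_entropyVars]
  change (γ - 1) * (density u * velocity u i / pressure γ u) / _ = _
  field_simp

theorem energy_eq {γ : ℝ} (hγ : 1 < γ) (u : State d) :
    energy u = density u * (velocity u ⬝ᵥ velocity u) / 2 + pressure γ u / (γ - 1) := by
  have hg : γ - 1 ≠ 0 := by linarith
  rw [pressure]
  field_simp
  ring

theorem rhoE_entropyVars {γ : ℝ} (hγ : 1 < γ) (s0 : ℝ) {u : State d}
    (hu : u ∈ physicalU d γ) : rhoE γ s0 (entropyVars γ s0 u) = density u := by
  have hg : γ - 1 ≠ 0 := by linarith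
  have h1 := hu.1.ne'
  have h2 := hu.2.ne'
  have hm : (momentum (entropyVars γ s0 u) ⬝ᵥ momentum (entropyVars γ s0 u))
      = (velocity u ⬝ᵥ velocity u) * energy (entropyVars γ s0 u) ^ 2 := by
    rw [← velE_entropyVars hγ s0 hu, velE_dot_velE]
    have := (energy_entropyVars_neg hγ s0 hu).ne
    field_simp
  rw [← Real.exp_log hu.1, rhoE, hm, energy_entropyVars]
  congr 1
  have hθ : (γ - 1) / (-((γ - 1) * (-density u / pressure γ u)))
      = pressure γ u / density u := by field_simp
  have hd : density (entropyVars γ s0 u) = (γ - 1) * (-thermoEntropy γ s0 u / (γ - 1)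
      + (γ + 1) / (γ - 1) - energy u / pressure γ u) := rfl
  rw [hθ, Real.log_div h2 h1, hd, thermoEntropy_eq s0 hu, energy_eq hγ u]
  field_simp
  ring

theorem consE_entropyVars {γ : ℝ} (hγ : 1 < γ) (s0 : ℝ) {u : State d}
    (hu : u ∈ physicalU d γ) : consE γ s0 (entropyVars γ s0 u) = u := by
  have hg : γ - 1 ≠ 0 := by linarith
  have h1 := hu.1.ne'
  have h2 := hu.2.ne'
  rw [consE, rhoE_entropyVars hγ s0 hu, velE_entropyVars hγ s0 hu, energy_entropyVars]
  refine state_ext rfl ?_ ?_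
  · ext i
    rw [momentum_mkState, momentum_apply, Pi.smul_apply, smul_eq_mul, velocity]
    field_simp
  · rw [energy_mkState, energy_eq hγ u]
    field_simp

/-- The explicit inverse `consE` needs only a negative last component, so the physical set is an
open half-space. Convexity keeps straight paths physical, and openness allows `consVars` to be
replaced by `consE` near each point. -/
theorem mem_physicalV_iff {γ : ℝ} (hγ : 1 < γ) {s0 : ℝ} {v : State d} :
    v ∈ physicalV d γ s0 ↔ energy v < 0 := by
  constructor
  · rintro ⟨u, hu, rfl⟩
    exact energy_entropyVars_neg hγ s0 hu
  · intro hv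
    exact ⟨_, consE_mem hγ s0 hv, entropyVars_consE hγ s0 hv⟩

/-- The chosen preimage lies in `X_u`, where `consE` is a left inverse of `entropyVars`, so the
choice is forced. -/
theorem consVars_eq {γ : ℝ} (hγ : 1 < γ) (s0 : ℝ) {v : State d} (hv : energy v < 0) :
    consVars γ s0 v = consE γ s0 v := by
  have hmem : v ∈ entropyVars γ s0 '' physicalU d γ := (mem_physicalV_iff hγ).2 hv
  have h1 : consVars γ s0 v ∈ physicalU d γ := invFunOn_mem hmem
  have h2 : entropyVars γ s0 (consVars γ s0 v) = v := invFunOn_eq hmem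
  rw [← consE_entropyVars hγ s0 h1, h2]

theorem continuous_energy : Continuous (energy : State d → ℝ) := continuous_apply _

theorem isOpen_energy_neg : IsOpen {v : State d | energy v < 0} :=
  isOpen_lt continuous_energy continuous_const

theorem consVars_eventuallyEq {γ : ℝ} (hγ : 1 < γ) (s0 : ℝ) {v : State d} (hv : energy v < 0) :
    consVars γ s0 =ᶠ[nhds v] consE γ s0 := by
  filter_upwards [isOpen_energy_neg.mem_nhds hv] with w hw using consVars_eq hγ s0 hw

theorem hasFDerivAt_neg_energy_inv {v : State d} (hv : energy v < 0) :
    HasFDerivAt (fun v : State d => (-energy v)⁻¹) ((energy v ^ 2)⁻¹ •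
      ContinuousLinearMap.proj (R := ℝ) (φ := fun _ : Comp d => ℝ) (Sum.inr (Sum.inr ()))) v := by
  have h2 : HasFDerivAt (fun v : State d => energy v) (ContinuousLinearMap.proj (R := ℝ)
    (φ := fun _ : Comp d => ℝ) (Sum.inr (Sum.inr ()))) v := hasFDerivAt_apply _ _
  refine ((hasDerivAt_inv (by simpa using hv.ne)).comp_hasFDerivAt v h2.fun_neg).congr_fderiv ?_
  simp

/-- The velocity is differentiable in the entropy variables. -/
theorem hasFDerivAt_velE {v : State d} (hv : energy v < 0) (l : Fin d) :
    HasFDerivAt (fun v => velE v l)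
      ((-energy v)⁻¹ • (ContinuousLinearMap.proj (R := ℝ) (φ := fun _ : Comp d => ℝ)
          (Sum.inr (Sum.inl l))
        + velE v l • ContinuousLinearMap.proj (R := ℝ) (φ := fun _ : Comp d => ℝ)
          (Sum.inr (Sum.inr ())))) v := by
  have h1 : HasFDerivAt (fun v : State d => momentum v l) (ContinuousLinearMap.proj (R := ℝ)
    (φ := fun _ : Comp d => ℝ) (Sum.inr (Sum.inl l))) v := hasFDerivAt_apply _ _
  have h3 := h1.fun_mul (hasFDerivAt_neg_energy_inv hv)
  simp only [velE, div_eq_mul_inv]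
  refine h3.congr_fderiv ?_
  ext w
  have := hv.ne
  simp
  field_simp
  ring

/-- `dρ = ρ/(γ-1) (dv₁ + V·dv_m + (|V|²/2 - 1/v₃) dv₃)`. -/
theorem hasFDerivAt_rhoE {γ : ℝ} (hγ : 1 < γ) (s0 : ℝ) {v : State d} (hv : energy v < 0) :
    HasFDerivAt (fun v => (γ - 1) * rhoE γ s0 v)
      (∑ i, consE γ s0 v i • ContinuousLinearMap.proj (R := ℝ) (φ := fun _ : Comp d => ℝ) i) v := by
  have hg : γ - 1 ≠ 0 := by linarith
  have h0 : HasFDerivAt (fun v : State d => density v) (ContinuousLinearMap.proj (R := ℝ)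
    (φ := fun _ : Comp d => ℝ) (Sum.inl ())) v := hasFDerivAt_apply _ _
  have h1 : ∀ l, HasFDerivAt (fun v : State d => momentum v l) (ContinuousLinearMap.proj (R := ℝ)
    (φ := fun _ : Comp d => ℝ) (Sum.inr (Sum.inl l))) v := fun l => hasFDerivAt_apply _ _
  have hm : HasFDerivAt (fun v : State d => momentum v ⬝ᵥ momentum v)
      (∑ l, (2 * momentum v l) • ContinuousLinearMap.proj (R := ℝ)
    (φ := fun _ : Comp d => ℝ) (Sum.inr (Sum.inl l))) v := by
    simp only [dotProduct]
    refine HasFDerivAt.fun_sum fun l _ => ((h1 l).fun_mul (h1 l)).congr_fderiv ?_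
    rw [← add_smul]; ring_nf
  have hinv := hasFDerivAt_neg_energy_inv hv
  have hlog := (hinv.const_mul (γ - 1)).log (by
    have : (γ - 1) * (-energy v)⁻¹ > 0 := mul_pos (by linarith) (inv_pos.2 (by linarith))
    exact this.ne')
  have h3 := ((((hlog.sub_const γ).fun_add h0).fun_add
    ((hm.fun_mul hinv).const_mul (1 / 2))).sub_const s0).const_mul (γ - 1)⁻¹
  -- The factor `γ - 1` cancels the denominator of the exponent.
  have h4 := (h3.exp).const_mul (γ - 1)
  have hfun : (fun v : State d => (γ - 1) * rhoE γ s0 v) = fun v => (γ - 1) * Real.exp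
      ((γ - 1)⁻¹ * (Real.log ((γ - 1) * (-energy v)⁻¹) - γ + density v
        + 1 / 2 * (momentum v ⬝ᵥ momentum v * (-energy v)⁻¹) - s0)) := by
    funext w
    rw [rhoE, div_eq_mul_inv _ (γ - 1), mul_comm _ (γ - 1)⁻¹, div_eq_mul_inv (γ - 1)]
    congr 5
    rw [div_eq_mul_inv, mul_inv]; ring
  have hρ : Real.exp ((γ - 1)⁻¹ * (Real.log ((γ - 1) * (-energy v)⁻¹) - γ + density v
        + 1 / 2 * (momentum v ⬝ᵥ momentum v * (-energy v)⁻¹) - s0)) = rhoE γ s0 v := by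
    have := congrFun hfun v
    exact (mul_left_cancel₀ hg this).symm
  rw [hfun]
  refine h4.congr_fderiv ?_
  have hv' := hv.ne
  ext w
  rw [hρ]
  simp only [smul_apply, add_apply,
    sum_apply, ContinuousLinearMap.proj_apply,
    smul_eq_mul, Fintype.sum_sum_type, Finset.univ_unique, Finset.sum_singleton,
    PUnit.default_eq_unit]
  have e1 : consE γ s0 v (Sum.inl ()) = rhoE γ s0 v := rfl
  have e2 : ∀ l, consE γ s0 v (Sum.inr (Sum.inl l)) = rhoE γ s0 v * velE v l := fun _ => rfl
  have e3 : consE γ s0 v (Sum.inr (Sum.inr ())) =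
    rhoE γ s0 v * (velE v ⬝ᵥ velE v) / 2 + rhoE γ s0 v / (-energy v) := rfl
  rw [e1, e3, velE_dot_velE]
  simp only [e2, velE]
  have e4 : ∑ x, rhoE γ s0 v * (momentum v x / -energy v) * w (Sum.inr (Sum.inl x))
      = rhoE γ s0 v * ((-energy v)⁻¹ * (1 / 2)) *
        ∑ x, 2 * momentum v x * w (Sum.inr (Sum.inl x)) := by
    rw [Finset.mul_sum]
    exact Finset.sum_congr rfl fun x _ => by ring
  rw [e4]
  field_simp
  ring

end Euler

/-! ### Potential flux and the gradient of the entropy -/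

section Potential

variable {d : ℕ}

theorem contDiffAt_velE {v : State d} (hv : energy v < 0) (l : Fin d) :
    ContDiffAt ℝ ∞ (fun v => velE v l) v := by
  have h1 : ContDiffAt ℝ ∞ (fun v : State d => momentum v l) v := contDiffAt_apply _ _ _ _
  have h2 : ContDiffAt ℝ ∞ (fun v : State d => energy v) v := contDiffAt_apply _ _ _ _
  exact h1.div h2.neg (by simpa using hv.ne)

theorem contDiffAt_rhoE {γ : ℝ} (hγ : 1 < γ) (s0 : ℝ) {v : State d} (hv : energy v < 0) :
    ContDiffAt ℝ ∞ (rhoE γ s0) v := by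
  have h0 : ContDiffAt ℝ ∞ (fun v : State d => density v) v := contDiffAt_apply _ _ _ _
  have h1 : ∀ l, ContDiffAt ℝ ∞ (fun v : State d => momentum v l) v :=
    fun l => contDiffAt_apply _ _ _ _
  have h2 : ContDiffAt ℝ ∞ (fun v : State d => energy v) v := contDiffAt_apply _ _ _ _
  have hm : ContDiffAt ℝ ∞ (fun v : State d => momentum v ⬝ᵥ momentum v) v := by
    simp only [dotProduct]
    exact ContDiffAt.sum fun l _ => (h1 l).mul (h1 l)
  have hv' := hv.ne
  have hlog : ContDiffAt ℝ ∞ (fun v : State d => Real.log ((γ - 1) / (-energy v))) v := by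
    refine (contDiffAt_const.div h2.neg (by simpa using hv.ne)).log ?_
    exact (div_pos (by linarith) (by linarith) : (0 : ℝ) < (γ - 1) / (-energy v)).ne'
  unfold rhoE
  exact ((((((hlog.sub contDiffAt_const).add h0).add (hm.div (contDiffAt_const.mul h2.neg)
    (by simpa using hv.ne))).sub contDiffAt_const).div_const _).exp)

theorem contDiffAt_consE {γ : ℝ} (hγ : 1 < γ) (s0 : ℝ) {v : State d} (hv : energy v < 0) :
    ContDiffAt ℝ ∞ (consE γ s0) v := by
  have h2 : ContDiffAt ℝ ∞ (fun v : State d => energy v) v := contDiffAt_apply _ _ _ _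
  have hρ := contDiffAt_rhoE hγ s0 hv
  rw [contDiffAt_pi]
  rintro (i | i | i)
  · exact hρ
  · exact hρ.mul (contDiffAt_velE hv i)
  · have hV : ContDiffAt ℝ ∞ (fun v : State d => velE v ⬝ᵥ velE v) v := by
      simp only [dotProduct]
      exact ContDiffAt.sum fun l _ => (contDiffAt_velE hv l).mul (contDiffAt_velE hv l)
    exact ((hρ.mul hV).div_const 2).add (hρ.div h2.neg (by simpa using hv.ne))

/-- Legendre duality: `(γ-1)ρ`, whose gradient in `v` is `u`, is the potential conjugate to `H`.
Differentiating the identity yields `dH = vᵗ du`. -/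
theorem dotProduct_consE {γ : ℝ} (hγ : 1 < γ) (s0 : ℝ) {v : State d} (hv : energy v < 0) :
    v ⬝ᵥ consE γ s0 v = entropyH γ s0 (consE γ s0 v) + (γ - 1) * rhoE γ s0 v := by
  rw [entropyH, thermoEntropy_consE hγ s0 hv, density_consE, dotProduct_state, consE]
  have hv' := hv.ne
  have h : momentum v ⬝ᵥ (rhoE γ s0 v • velE v)
      = rhoE γ s0 v * ((momentum v ⬝ᵥ momentum v) / (-energy v)) := by
    simp only [dotProduct, Pi.smul_apply, smul_eq_mul, velE, Finset.mul_sum, Finset.sum_div]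
    exact Finset.sum_congr rfl fun i _ => by ring
  rw [density_mkState, momentum_mkState, energy_mkState, h, velE_dot_velE]
  field_simp
  ring

/-- The potential flux `ψ_n = vᵗ F_n - 𝓕_n` as a function of the entropy variables. -/
def potentialFlux (γ s0 : ℝ) (n : Fin d → ℝ) (v : State d) : ℝ :=
  (γ - 1) * rhoE γ s0 v * (velE v ⬝ᵥ n)

theorem fluxN_eq (γ : ℝ) (n : Fin d → ℝ) (u : State d) :
    fluxN γ n u = mkState (density u * (velocity u ⬝ᵥ n))
      ((density u * (velocity u ⬝ᵥ n)) • velocity u + pressure γ u • n)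
      ((energy u + pressure γ u) * (velocity u ⬝ᵥ n)) := by
  refine state_ext ?_ ?_ ?_
  · rw [density_mkState]
    simp only [fluxN, density, Matrix.mulVec, dotProduct, flux, Matrix.of_apply, mkState,
      Sum.elim_inl, Finset.mul_sum]
    exact Finset.sum_congr rfl fun i _ => by ring
  · ext l
    rw [momentum_mkState]
    simp only [fluxN, momentum, Matrix.mulVec, dotProduct, flux, Matrix.of_apply, mkState,
      Sum.elim_inl, Sum.elim_inr, Finset.mul_sum, Finset.sum_mul, Pi.add_apply, Pi.smul_apply,
      smul_eq_mul, add_mul, ite_mul, zero_mul, Finset.sum_add_distrib, Finset.sum_ite_eq,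
      Finset.mem_univ, if_true]
    congr 1
    exact Finset.sum_congr rfl fun i _ => by ring
  · rw [energy_mkState]
    simp only [fluxN, energy, Matrix.mulVec, dotProduct, flux, Matrix.of_apply, mkState,
      Sum.elim_inr, Finset.mul_sum]
    exact Finset.sum_congr rfl fun i _ => by ring

/-- Transport of `u` by `V_n` plus the pressure part. The two summands match the two terms of the
product rule for `(γ-1)ρ · V_n`. -/
theorem fluxN_consE (γ s0 : ℝ) (n : Fin d → ℝ) (v : State d) :
    fluxN γ n (consE γ s0 v) = (velE v ⬝ᵥ n) • consE γ s0 v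
      + ((γ - 1) * (rhoE γ s0 v / (-energy v))) • mkState 0 n (velE v ⬝ᵥ n) := by
  rw [fluxN_eq, density_consE, velocity_consE, pressure_consE]
  refine state_ext ?_ ?_ ?_
  · simp only [density_mkState, density_add, density_smul, density_consE]; ring
  · simp only [momentum_mkState, momentum_add, momentum_smul]
    rw [consE, momentum_mkState, smul_smul, mul_comm]
  · simp only [energy_mkState, energy_add, energy_smul]; ring

/-- The pressure part is orthogonal to `v`, because the momentum part of `v` is `-energy v` times
the velocity. The transport part is `V_n` times `dotProduct_consE`. -/
theorem dotProduct_fluxN_consE {γ : ℝ} (hγ : 1 < γ) (s0 : ℝ) (n : Fin d → ℝ) {v : State d}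
    (hv : energy v < 0) : v ⬝ᵥ fluxN γ n (consE γ s0 v)
      = entropyFluxN γ s0 n (consE γ s0 v) + potentialFlux γ s0 n v := by
  have h : momentum v ⬝ᵥ n = -energy v * (velE v ⬝ᵥ n) := by
    have := hv.ne
    simp only [velE, dotProduct, Finset.mul_sum]
    exact Finset.sum_congr rfl fun i _ => by field_simp
  rw [fluxN_consE, dotProduct_add, dotProduct_smul, dotProduct_smul, dotProduct_consE hγ s0 hv,
    entropyFluxN, velocity_consE, smul_dotProduct, potentialFlux, dotProduct_state]
  simp only [density_mkState, momentum_mkState, energy_mkState, h, smul_eq_mul]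
  ring

theorem hasFDerivAt_velE_dot (n : Fin d → ℝ) {v : State d} (hv : energy v < 0) :
    HasFDerivAt (fun v => velE v ⬝ᵥ n) ((-energy v)⁻¹ • ∑ i, mkState 0 n (velE v ⬝ᵥ n) i •
      ContinuousLinearMap.proj (R := ℝ) (φ := fun _ : Comp d => ℝ) i) v := by
  simp only [dotProduct]
  refine (HasFDerivAt.fun_sum fun l _ => (hasFDerivAt_velE hv l).mul_const (n l)).congr_fderiv ?_
  ext w
  simp [mkState, Fintype.sum_sum_type, Finset.sum_mul, Finset.mul_sum]
  rw [← Finset.sum_neg_distrib, ← Finset.sum_neg_distrib, ← Finset.sum_add_distrib]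
  exact Finset.sum_congr rfl fun i _ => by ring

/-- Product rule, compared with `fluxN_consE`. Both the conversion of the volume term into a
divergence and the face identity rest on this gradient structure. -/
theorem hasFDerivAt_potentialFlux {γ : ℝ} (hγ : 1 < γ) (s0 : ℝ) (n : Fin d → ℝ) {v : State d}
    (hv : energy v < 0) : HasFDerivAt (potentialFlux γ s0 n)
      (∑ i, fluxN γ n (consE γ s0 v) i •
        ContinuousLinearMap.proj (R := ℝ) (φ := fun _ : Comp d => ℝ) i) v := by
  refine ((hasFDerivAt_rhoE hγ s0 hv).fun_mul (hasFDerivAt_velE_dot n hv)).congr_fderiv ?_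
  ext w
  rw [fluxN_consE]
  simp only [Finset.mul_sum, add_apply, smul_apply, sum_apply, ContinuousLinearMap.proj_apply,
    Pi.add_apply, Pi.smul_apply, smul_eq_mul, ← Finset.sum_add_distrib]
  exact Finset.sum_congr rfl fun i _ => by ring

theorem contDiffAt_potentialFlux {γ : ℝ} (hγ : 1 < γ) (s0 : ℝ) (n : Fin d → ℝ) {v : State d}
    (hv : energy v < 0) : ContDiffAt ℝ ∞ (potentialFlux γ s0 n) v := by
  have hV : ContDiffAt ℝ ∞ (fun v : State d => velE v ⬝ᵥ n) v := by
    simp only [dotProduct]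
    exact ContDiffAt.sum fun l _ => (contDiffAt_velE hv l).mul contDiffAt_const
  exact (contDiffAt_const.mul (contDiffAt_rhoE hγ s0 hv)).mul hV

theorem differentiableAt_consE {γ : ℝ} (hγ : 1 < γ) (s0 : ℝ) {v : State d} (hv : energy v < 0) :
    DifferentiableAt ℝ (consE γ s0) v :=
  (contDiffAt_consE hγ s0 hv).differentiableAt (by simp)

/-- The entropy variables are the gradient of the generalized entropy: `dH = vᵗ du`. -/
theorem hasFDerivAt_entropyH_consE {γ : ℝ} (hγ : 1 < γ) (s0 : ℝ) {v : State d}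
    (hv : energy v < 0) : HasFDerivAt (fun v => entropyH γ s0 (consE γ s0 v))
      (∑ i, v i • (ContinuousLinearMap.proj (R := ℝ) (φ := fun _ : Comp d => ℝ) i).comp
        (fderiv ℝ (consE γ s0) v)) v := by
  have hc := (differentiableAt_consE hγ s0 hv).hasFDerivAt
  have h1 : HasFDerivAt (fun v : State d => v ⬝ᵥ consE γ s0 v)
      (∑ i, (v i • (ContinuousLinearMap.proj (R := ℝ) (φ := fun _ : Comp d => ℝ) i).comp
        (fderiv ℝ (consE γ s0) v)
        + consE γ s0 v i • ContinuousLinearMap.proj (R := ℝ) (φ := fun _ : Comp d => ℝ) i)) v := by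
    simp only [dotProduct]
    exact HasFDerivAt.fun_sum fun i _ => (hasFDerivAt_apply i v).fun_mul
      (hasFDerivAt_pi'.1 hc i)
  refine ((h1.fun_sub (hasFDerivAt_rhoE hγ s0 hv)).congr_fderiv ?_).congr_of_eventuallyEq ?_
  -- The terms `u · dv` cancel against the derivative of `(γ-1)ρ`, leaving `v · du`.
  · rw [Finset.sum_add_distrib, add_sub_cancel_right]
  · filter_upwards [isOpen_energy_neg.mem_nhds hv] with w hw
    rw [dotProduct_consE hγ s0 hw]
    ring

end Potential

/-! ### Absolute values of matrices -/

section MatAbs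

variable {ι : Type} [Fintype ι] [DecidableEq ι]

theorem IsDiagonalization.conj {A Q : Matrix ι ι ℝ} {Pl : Matrix ι ι ℝ × (ι → ℝ)}
    (hQ : IsUnit Q.det) (h : IsDiagonalization A Pl) :
    IsDiagonalization (Q⁻¹ * A * Q) (Q⁻¹ * Pl.1, Pl.2) := by
  obtain ⟨h1, h2⟩ := h
  refine ⟨?_, ?_⟩
  · simpa only [Matrix.det_mul] using (Matrix.isUnit_nonsing_inv_det Q hQ).mul h1
  · rw [h2, Matrix.mul_inv_rev, Matrix.nonsing_inv_nonsing_inv Q hQ]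
    simp only [Matrix.mul_assoc]

/-- Conjugation carries diagonalizations to diagonalizations in both directions, so it also respects
the default value `0` at matrices that have none. -/
theorem matAbs_conj (A : Matrix ι ι ℝ) {Q : Matrix ι ι ℝ} (hQ : IsUnit Q.det) :
    matAbs (Q⁻¹ * A * Q) = Q⁻¹ * matAbs A * Q := by
  by_cases h : ∃ Pl, IsDiagonalization A Pl
  · obtain ⟨Pl, hPl⟩ := h
    rw [matAbs_eq hPl, matAbs_eq (hPl.conj hQ), Matrix.mul_inv_rev,
      Matrix.nonsing_inv_nonsing_inv Q hQ]
    simp only [Matrix.mul_assoc]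
  · have h' : ¬ ∃ Pl, IsDiagonalization (Q⁻¹ * A * Q) Pl := by
      rintro ⟨Pl, hPl⟩
      have := hPl.conj (Matrix.isUnit_nonsing_inv_det Q hQ)
      rw [Matrix.nonsing_inv_nonsing_inv Q hQ] at this
      refine h ⟨(Q * Pl.1, Pl.2), ?_⟩
      convert this using 1
      calc A = (Q * Q⁻¹) * A * (Q * Q⁻¹) := by rw [Matrix.mul_nonsing_inv Q hQ]; simp
        _ = _ := by simp only [Matrix.mul_assoc]
    simp only [matAbs]
    rw [dif_neg h, dif_neg h']
    simp

theorem exists_isDiagonalization_of_isHermitian {B : Matrix ι ι ℝ} (hB : B.IsHermitian) :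
    ∃ Pl, IsDiagonalization B Pl := by
  have hU := hB.eigenvectorUnitary.2
  rw [Matrix.mem_unitaryGroup_iff] at hU
  have hdet : IsUnit (hB.eigenvectorUnitary : Matrix ι ι ℝ).det :=
    Matrix.isUnit_det_of_right_inverse hU
  refine ⟨(hB.eigenvectorUnitary, hB.eigenvalues), hdet, ?_⟩
  have h := hB.spectral_theorem
  rw [Matrix.inv_eq_right_inv hU]
  exact h

/-- `|V + s|` interpolated by a polynomial in `s` at the nodes `s = 0, a, -a`. -/
def absPoly (V a : ℝ) (S : Matrix ι ι ℝ) : Matrix ι ι ℝ :=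
  |V| • (1 : Matrix ι ι ℝ) + ((|V + a| - |V - a|) / (2 * a)) • S
    + ((|V + a| + |V - a| - 2 * |V|) / (2 * a ^ 2)) • (S * S)

/-- The cubic equation confines `s` to the nodes `0, a, -a`, where the quadratic interpolates `|V +
s|`. If `a = 0` then `s = 0`, and the divisions by zero do no harm. -/
theorem abs_add_eq_of_pow_three {V a s : ℝ} (h : s * s * s = a ^ 2 * s) :
    |V + s| = |V| + (|V + a| - |V - a|) / (2 * a) * s
      + (|V + a| + |V - a| - 2 * |V|) / (2 * a ^ 2) * (s * s) := by
  have h' : s * ((s - a) * (s + a)) = 0 := by linear_combination h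
  rcases mul_eq_zero.1 h' with h0 | h0
  · simp [h0]
  by_cases ha : a = 0
  · subst ha
    have : s = 0 := by simpa using h0
    simp [this]
  rcases mul_eq_zero.1 h0 with h1 | h1
  · rw [sub_eq_zero.1 h1]; field_simp; ring
  · rw [eq_neg_of_add_eq_zero_left h1, ← sub_eq_add_neg]; field_simp; ring

/-- Every eigenvalue of `S` obeys the same cubic equation, so the scalar interpolation applies in an
eigenbasis. The gain is a formula free of eigenvectors, which need not depend continuously on the
matrix. -/
theorem matAbs_smul_one_add {S : Matrix ι ι ℝ} (hS : S.IsHermitian) {V a : ℝ}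
    (h3 : S * S * S = a ^ 2 • S) : matAbs (V • (1 : Matrix ι ι ℝ) + S) = absPoly V a S := by
  obtain ⟨⟨P, l⟩, hP, hSP⟩ := exists_isDiagonalization_of_isHermitian hS
  simp only at hP hSP
  have hPP := Matrix.mul_nonsing_inv P hP
  have hPP' := Matrix.nonsing_inv_mul P hP
  have hsq : S * S = P * Matrix.diagonal (fun i => l i * l i) * P⁻¹ := by
    conv_lhs => rw [hSP]
    calc P * Matrix.diagonal l * P⁻¹ * (P * Matrix.diagonal l * P⁻¹)
        = P * Matrix.diagonal l * (P⁻¹ * P) * Matrix.diagonal l * P⁻¹ := by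
          simp only [Matrix.mul_assoc]
      _ = P * (Matrix.diagonal l * Matrix.diagonal l) * P⁻¹ := by
          rw [hPP']; simp [Matrix.mul_assoc]
      _ = _ := by rw [Matrix.diagonal_mul_diagonal]
  have hl : ∀ i, l i * l i * l i = a ^ 2 * l i := by
    have h4 : P⁻¹ * (S * S * S) * P = P⁻¹ * (a ^ 2 • S) * P := by rw [h3]
    rw [hsq] at h4
    conv at h4 => lhs; rw [hSP]
    conv at h4 => rhs; rw [hSP]
    have e1 : P⁻¹ * (P * Matrix.diagonal (fun i => l i * l i) * P⁻¹
        * (P * Matrix.diagonal l * P⁻¹)) * P = (P⁻¹ * P) * Matrix.diagonal (fun i => l i * l i)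
          * (P⁻¹ * P) * Matrix.diagonal l * (P⁻¹ * P) := by simp only [Matrix.mul_assoc]
    have e2 : P⁻¹ * (a ^ 2 • (P * Matrix.diagonal l * P⁻¹)) * P
        = a ^ 2 • ((P⁻¹ * P) * Matrix.diagonal l * (P⁻¹ * P)) := by
      simp only [Matrix.mul_assoc, Matrix.mul_smul, Matrix.smul_mul]
    rw [e1, e2, hPP'] at h4
    simp only [one_mul, mul_one, Matrix.diagonal_mul_diagonal] at h4
    intro i
    simpa using congrFun (congrFun h4 i) i
  have hone : ∀ c : ℝ, c • (1 : Matrix ι ι ℝ) = P * Matrix.diagonal (fun _ => c) * P⁻¹ := by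
    intro c
    rw [← Matrix.smul_one_eq_diagonal]
    simp [hPP]
  have hdiag : IsDiagonalization (V • (1 : Matrix ι ι ℝ) + S) (P, fun i => V + l i) := by
    refine ⟨hP, ?_⟩
    conv_lhs => rw [hSP, hone]
    rw [← add_mul, ← mul_add, Matrix.diagonal_add]
  rw [matAbs_eq hdiag, absPoly, hsq, hone]
  conv_rhs => rw [hSP]
  have hsm : ∀ (c : ℝ) (e : ι → ℝ), c • (P * Matrix.diagonal e * P⁻¹)
      = P * Matrix.diagonal (c • e) * P⁻¹ := fun c e => by
    rw [Matrix.diagonal_smul, Matrix.mul_smul, Matrix.smul_mul]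
  rw [hsm, hsm, ← add_mul, ← add_mul, ← mul_add, ← mul_add, Matrix.diagonal_add,
    Matrix.diagonal_add]
  congr 3
  ext i : 1
  simp only [Pi.smul_apply, smul_eq_mul]
  exact abs_add_eq_of_pow_three (hl i)

end MatAbs

/-! ### Jacobian matrices -/

section Jac

variable {d : ℕ}

theorem jacobian_mulVec (f : State d → State d) (w x : State d) :
    jacobian f w *ᵥ x = fderiv ℝ f w x := by
  have : jacobian f w = LinearMap.toMatrix' (fderiv ℝ f w : State d →ₗ[ℝ] State d) := by
    ext i j
    simp [jacobian, LinearMap.toMatrix'_apply]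
  rw [this, LinearMap.toMatrix'_mulVec]
  rfl

theorem jacobian_comp {f g : State d → State d} {w : State d} (hf : DifferentiableAt ℝ f (g w))
    (hg : DifferentiableAt ℝ g w) :
    jacobian (f ∘ g) w = jacobian f (g w) * jacobian g w := by
  refine Matrix.ext_of_mulVec_single fun i => ?_
  rw [← Matrix.mulVec_mulVec, jacobian_mulVec, jacobian_mulVec, jacobian_mulVec,
    fderiv_comp w hf hg]
  rfl

theorem jacobian_congr {f g : State d → State d} {w : State d} (h : f =ᶠ[nhds w] g) :
    jacobian f w = jacobian g w := by
  simp only [jacobian, h.fderiv_eq]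

theorem contDiffAt_velocity {u : State d} (hu : density u ≠ 0) (l : Fin d) :
    ContDiffAt ℝ ∞ (fun u => velocity u l) u := by
  have h0 : ContDiffAt ℝ ∞ (fun v : State d => density v) u := contDiffAt_apply _ _ _ _
  have h1 : ContDiffAt ℝ ∞ (fun v : State d => v (Sum.inr (Sum.inl l))) u :=
    contDiffAt_apply _ _ _ _
  exact h1.div h0 hu

theorem contDiffAt_pressure (γ : ℝ) {u : State d} (hu : density u ≠ 0) :
    ContDiffAt ℝ ∞ (pressure γ) u := by
  have h0 : ContDiffAt ℝ ∞ (fun v : State d => density v) u := contDiffAt_apply _ _ _ _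
  have h2 : ContDiffAt ℝ ∞ (fun v : State d => energy v) u := contDiffAt_apply _ _ _ _
  have h3 : ContDiffAt ℝ ∞ (fun v : State d => velocity v ⬝ᵥ velocity v) u := by
    simp only [dotProduct]
    exact ContDiffAt.sum fun l _ => (contDiffAt_velocity hu l).mul (contDiffAt_velocity hu l)
  exact contDiffAt_const.mul (h2.sub ((h0.mul h3).div_const 2))

theorem contDiffAt_entropyVars {γ : ℝ} (s0 : ℝ) {u : State d} (hu : u ∈ physicalU d γ) :
    ContDiffAt ℝ ∞ (entropyVars γ s0) u := by
  have h0 : ContDiffAt ℝ ∞ (fun v : State d => density v) u := contDiffAt_apply _ _ _ _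
  have h2 : ContDiffAt ℝ ∞ (fun v : State d => energy v) u := contDiffAt_apply _ _ _ _
  have hp := contDiffAt_pressure γ hu.1.ne'
  have hs : ContDiffAt ℝ ∞ (thermoEntropy γ s0) u := by
    refine ((hp.div (h0.rpow_const_of_ne (p := γ) hu.1.ne')
      (Real.rpow_pos_of_pos hu.1 _).ne').log ?_).sub contDiffAt_const
    exact (div_pos hu.2 (Real.rpow_pos_of_pos hu.1 _)).ne'
  rw [contDiffAt_pi]
  rintro (i | i | i)
  · exact contDiffAt_const.mul
      (((hs.neg.div_const (γ - 1)).add contDiffAt_const).sub (h2.div hp hu.2.ne'))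
  · exact contDiffAt_const.mul ((h0.mul (contDiffAt_velocity hu.1.ne' i)).div hp hu.2.ne')
  · exact contDiffAt_const.mul (h0.neg.div hp hu.2.ne')

theorem metric_eq {γ : ℝ} (hγ : 1 < γ) (s0 : ℝ) {v : State d} (hv : energy v < 0) :
    metric γ s0 v = jacobian (consE γ s0) v :=
  jacobian_congr (consVars_eventuallyEq hγ s0 hv)

/-- Differentiating `entropyVars ∘ consE = id` near `v` exhibits a left inverse of the metric. -/
theorem isUnit_det_metric {γ : ℝ} (hγ : 1 < γ) (s0 : ℝ) {v : State d} (hv : energy v < 0) :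
    IsUnit (metric γ s0 v).det := by
  have h1 : jacobian (entropyVars γ s0 ∘ consE γ s0) v = 1 := by
    have : entropyVars γ s0 ∘ consE γ s0 =ᶠ[nhds v] id := by
      filter_upwards [isOpen_energy_neg.mem_nhds hv] with w hw using entropyVars_consE hγ s0 hw
    rw [jacobian_congr this]
    refine Matrix.ext_of_mulVec_single fun i => ?_
    rw [jacobian_mulVec, fderiv_id, Matrix.one_mulVec]
    rfl
  rw [jacobian_comp ((contDiffAt_entropyVars s0 (consE_mem hγ s0 hv)).differentiableAt (by simp))
    (differentiableAt_consE hγ s0 hv), ← metric_eq hγ s0 hv] at h1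
  exact Matrix.isUnit_det_of_left_inverse h1

/-- `Ã₀⁻¹ Ã_n = Ã₀⁻¹ A_n Ã₀` is a conjugate of `A_n`, and `matAbs` commutes with conjugation. -/
theorem genAbs_eq {γ : ℝ} (hγ : 1 < γ) (s0 : ℝ) {v : State d} (hv : energy v < 0)
    (n : Fin d → ℝ) : genAbs γ s0 n v = matAbs (jacN γ s0 n v) * metric γ s0 v := by
  have h := isUnit_det_metric hγ s0 hv
  rw [genAbs, symJacN, ← Matrix.mul_assoc, matAbs_conj _ h, ← Matrix.mul_assoc,
    ← Matrix.mul_assoc, Matrix.mul_nonsing_inv _ h, one_mul]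

end Jac

/-! ### Diagonalization of the Euler Jacobian -/

section Diagonalization

variable {d : ℕ}

/-- The speed of sound. -/
def soundSpeed (γ : ℝ) (u : State d) : ℝ := Real.sqrt (γ * pressure γ u / density u)

theorem soundSpeed_pos {γ : ℝ} (hγ : 1 < γ) {u : State d} (hu : u ∈ physicalU d γ) :
    0 < soundSpeed γ u :=
  Real.sqrt_pos.2 (div_pos (mul_pos (by linarith) hu.2) hu.1)

theorem soundSpeed_sq {γ : ℝ} (hγ : 1 < γ) {u : State d} (hu : u ∈ physicalU d γ) :
    soundSpeed γ u ^ 2 = γ * pressure γ u / density u :=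
  Real.sq_sqrt (div_pos (mul_pos (by linarith) hu.2) hu.1).le

/-- The differential of the conservation variables with respect to density, velocity and
pressure. -/
def primToCons (γ : ℝ) (u w : State d) : State d :=
  mkState (density w) (density w • velocity u + density u • momentum w)
    (density w * (velocity u ⬝ᵥ velocity u) / 2 + density u * (velocity u ⬝ᵥ momentum w)
      + energy w / (γ - 1))

/-- The change of variables that symmetrizes the Jacobian of the Euler flux. -/
def symmetrizer (γ : ℝ) (u : State d) : State d →ₗ[ℝ] State d where
  -- In terms of increments of density and pressure, `energy w = dp/(ρc)` and `density w = dρ -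
  -- dp/c²`. With this scaling the coupling of pressure and velocity is symmetric, and `density w`
  -- is merely transported.
  toFun w := primToCons γ u (mkState (density w + density u / soundSpeed γ u * energy w)
    (momentum w) (density u * soundSpeed γ u * energy w))
  map_add' w z := by
    refine state_ext ?_ ?_ ?_
    · simp [primToCons]; ring
    · ext l; simp [primToCons]; ring
    · simp [primToCons]; ring
  map_smul' r w := by
    refine state_ext ?_ ?_ ?_
    · simp [primToCons]; ring
    · ext l; simp [primToCons]; ring
    · simp [primToCons]; ring

/-- The acoustic part of the symmetrized Jacobian of the Euler flux. -/
def acoustic (c : ℝ) (n : Fin d → ℝ) : State d →ₗ[ℝ] State d where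
  toFun w := mkState 0 ((c * energy w) • n) (c * (momentum w ⬝ᵥ n))
  map_add' w z := by
    refine state_ext ?_ ?_ ?_
    · simp
    · ext l; simp; ring
    · simp; ring
  map_smul' r w := by
    refine state_ext ?_ ?_ ?_
    · simp
    · ext l; simp; ring
    · simp; ring

theorem acoustic_isHermitian (c : ℝ) (n : Fin d → ℝ) :
    (LinearMap.toMatrix' (acoustic c n)).IsHermitian := by
  have h : ∀ x y, x ⬝ᵥ acoustic c n y = y ⬝ᵥ acoustic c n x := by
    intro x y
    simp only [acoustic, LinearMap.coe_mk, AddHom.coe_mk, dotProduct_state, density_mkState,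
      momentum_mkState, energy_mkState, dotProduct_smul, smul_eq_mul]
    ring
  ext i j
  have := h (Pi.single i 1) (Pi.single j 1)
  simp only [single_dotProduct, one_mul] at this
  rw [Matrix.conjTranspose_apply, LinearMap.toMatrix'_apply, LinearMap.toMatrix'_apply, this]
  rfl

/-- The acoustic part exchanges the normal momentum with the energy slot, so its square acts on its
range as `c²|n|²`: the acoustic speeds are `0` and `±c|n|`. -/
theorem acoustic_pow_three (c : ℝ) (n : Fin d → ℝ) :
    LinearMap.toMatrix' (acoustic c n) * LinearMap.toMatrix' (acoustic c n)
      * LinearMap.toMatrix' (acoustic c n)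
      = (c * Real.sqrt (n ⬝ᵥ n)) ^ 2 • LinearMap.toMatrix' (acoustic c n) := by
  have hn : 0 ≤ n ⬝ᵥ n := by
    simp only [dotProduct]
    exact Finset.sum_nonneg fun i _ => mul_self_nonneg _
  rw [mul_pow, Real.sq_sqrt hn, ← LinearMap.toMatrix'_comp, ← LinearMap.toMatrix'_comp,
    ← map_smul]
  congr 1
  refine LinearMap.ext fun w => state_ext ?_ ?_ ?_
  · simp [acoustic]
  · ext l; simp [acoustic]; ring
  · simp [acoustic]; ring

theorem symmetrizer_isUnit {γ : ℝ} (hγ : 1 < γ) {u : State d} (hu : u ∈ physicalU d γ) :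
    IsUnit (LinearMap.toMatrix' (symmetrizer γ u)).det := by
  rw [← Matrix.isUnit_iff_isUnit_det, ← Matrix.mulVec_injective_iff_isUnit]
  have hc := (soundSpeed_pos hγ hu).ne'
  have hρ := hu.1.ne'
  have hg : γ - 1 ≠ 0 := by linarith
  have h0 : ∀ w, symmetrizer γ u w = 0 → w = 0 := by
    intro w hw
    have h1 := congrArg density hw
    have h2 := congrArg momentum hw
    have h3 := congrArg energy hw
    change density w + density u / soundSpeed γ u * energy w = 0 at h1
    change (density w + density u / soundSpeed γ u * energy w) • velocity u
      + density u • momentum w = 0 at h2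
    change (density w + density u / soundSpeed γ u * energy w) * _ / 2
      + density u * (velocity u ⬝ᵥ momentum w) + _ / _ = 0 at h3
    rw [h1, zero_smul, zero_add, smul_eq_zero] at h2
    have h2' := h2.resolve_left hρ
    rw [h1, h2', dotProduct_zero, mul_zero, zero_mul, zero_div, zero_add, zero_add,
      energy_mkState] at h3
    have h3' : energy w = 0 := by
      simpa [hρ, hc, hg] using h3
    rw [h3', mul_zero, add_zero] at h1
    exact state_ext h1 h2' h3'
  intro x y hxy
  simp only [LinearMap.toMatrix'_mulVec] at hxy
  exact sub_eq_zero.1 (h0 _ (by rw [map_sub, hxy, sub_self]))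

theorem hasDerivAt_velocity {z : ℝ → State d} {z' : State d} {t : ℝ} (hz : HasDerivAt z z' t)
    (hρ : density (z t) ≠ 0) (l : Fin d) : HasDerivAt (fun τ => velocity (z τ) l)
      ((momentum z' l - density z' * velocity (z t) l) / density (z t)) t := by
  have h0 : HasDerivAt (fun τ => density (z τ)) (density z') t := hasDerivAt_pi.1 hz _
  have h1 : HasDerivAt (fun τ => momentum (z τ) l) (momentum z' l) t := hasDerivAt_pi.1 hz _
  refine (h1.fun_div h0 hρ).congr_deriv ?_
  rw [velocity, momentum_apply]
  field_simp
  rw [momentum_apply]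
  ring

theorem hasDerivAt_dotProduct {ι : Type} [Fintype ι] {x y : ℝ → ι → ℝ} {x' y' : ι → ℝ} {t : ℝ}
    (hx : HasDerivAt x x' t) (hy : HasDerivAt y y' t) :
    HasDerivAt (fun τ => x τ ⬝ᵥ y τ) (x' ⬝ᵥ y t + x t ⬝ᵥ y') t := by
  simp only [dotProduct, ← Finset.sum_add_distrib]
  exact HasDerivAt.fun_sum fun i _ => (hasDerivAt_pi.1 hx i).fun_mul (hasDerivAt_pi.1 hy i)

/-- Along a curve with tangent `primToCons γ u w`, the flux changes in the direction given by the
quasilinear form of the Euler equations. -/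
theorem hasDerivAt_fluxN {γ : ℝ} (hγ : 1 < γ) (n : Fin d → ℝ) {z : ℝ → State d} {w : State d}
    {t : ℝ} (hz : HasDerivAt z (primToCons γ (z t) w) t) (hρ : density (z t) ≠ 0) :
    HasDerivAt (fun τ => fluxN γ n (z τ)) (primToCons γ (z t) (mkState
      ((velocity (z t) ⬝ᵥ n) * density w + density (z t) * (momentum w ⬝ᵥ n))
      ((velocity (z t) ⬝ᵥ n) • momentum w + (energy w / density (z t)) • n)
      ((velocity (z t) ⬝ᵥ n) * energy w + γ * pressure γ (z t) * (momentum w ⬝ᵥ n)))) t := by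
  have hg : γ - 1 ≠ 0 := by linarith
  have h0 : HasDerivAt (fun τ => density (z τ)) (density w) t :=
    hasDerivAt_pi.1 hz (Sum.inl ())
  have h2 : HasDerivAt (fun τ => energy (z τ)) (energy (primToCons γ (z t) w)) t :=
    hasDerivAt_pi.1 hz (Sum.inr (Sum.inr ()))
  -- The tangent `primToCons` is built so that density, velocity and pressure change at the rates
  -- `density w`, `momentum w` and `energy w`.
  have hV : HasDerivAt (fun τ => velocity (z τ)) (momentum w) t := by
    rw [hasDerivAt_pi]
    intro l
    refine (hasDerivAt_velocity hz hρ l).congr_deriv ?_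
    simp [primToCons]
    field_simp
  have hVV := hasDerivAt_dotProduct hV hV
  have hVn := hasDerivAt_dotProduct hV (hasDerivAt_const t n)
  have hp : HasDerivAt (fun τ => pressure γ (z τ)) (energy w) t := by
    refine ((h2.fun_sub ((h0.fun_mul hVV).div_const 2)).const_mul (γ - 1)).congr_deriv ?_
    simp only [primToCons, energy_mkState]
    rw [dotProduct_comm (momentum w)]
    field_simp
    ring
  simp only [dotProduct_zero, add_zero] at hVn
  simp only [fluxN_eq]
  rw [hasDerivAt_pi]
  have hm := h0.fun_mul hVn
  rintro (i | i | i)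
  · refine hm.congr_deriv ?_
    simp [primToCons]
    ring
  · refine ((hm.fun_mul (hasDerivAt_pi.1 hV i)).fun_add (hp.mul_const (n i))).congr_deriv ?_
    simp [primToCons]
    field_simp
    ring
  · refine ((h2.fun_add hp).fun_mul hVn).congr_deriv ?_
    rw [energy_eq hγ (z t)]
    simp [primToCons]
    field_simp
    ring

theorem contDiffAt_fluxN (γ : ℝ) (n : Fin d → ℝ) {u : State d} (hu : density u ≠ 0) :
    ContDiffAt ℝ ∞ (fluxN γ n) u := by
  have h0 : ContDiffAt ℝ ∞ (fun v : State d => density v) u := contDiffAt_apply _ _ _ _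
  have h2 : ContDiffAt ℝ ∞ (fun v : State d => energy v) u := contDiffAt_apply _ _ _ _
  have hV := fun l => contDiffAt_velocity hu l
  have hp := contDiffAt_pressure γ hu
  have hVn : ContDiffAt ℝ ∞ (fun v : State d => velocity v ⬝ᵥ n) u := by
    simp only [dotProduct]
    exact ContDiffAt.sum fun l _ => (hV l).mul contDiffAt_const
  have : fluxN γ n = _ := funext (fluxN_eq γ n)
  rw [this, contDiffAt_pi]
  rintro (i | i | i)
  · exact h0.mul hVn
  · exact ((h0.mul hVn).mul (hV i)).add (hp.mul contDiffAt_const)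
  · exact (h2.add hp).mul hVn

/-- Applied to `w`, both sides are the derivative at `0` of the flux along the line through `u` in
direction `symmetrizer γ u w`: by the chain rule on the left, by the quasilinear form on the right.
The identity `ρc² = γp` matches the pressure rows. -/
theorem jacobian_fluxN_mul {γ : ℝ} (hγ : 1 < γ) (n : Fin d → ℝ) {u : State d}
    (hu : u ∈ physicalU d γ) :
    jacobian (fluxN γ n) u * LinearMap.toMatrix' (symmetrizer γ u)
      = LinearMap.toMatrix' (symmetrizer γ u) * ((velocity u ⬝ᵥ n) • (1 : Matrix _ _ ℝ)
        + LinearMap.toMatrix' (acoustic (soundSpeed γ u) n)) := by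
  have hρ := hu.1.ne'
  have hc := (soundSpeed_pos hγ hu).ne'
  have hcc := soundSpeed_sq hγ hu
  have hdiff : DifferentiableAt ℝ (fluxN γ n) u :=
    (contDiffAt_fluxN γ n hρ).differentiableAt (by simp)
  refine Matrix.ext_of_mulVec_single fun i => ?_
  generalize (Pi.single i (1 : ℝ) : State d) = w
  rw [← Matrix.mulVec_mulVec, ← Matrix.mulVec_mulVec, jacobian_mulVec, Matrix.add_mulVec,
    Matrix.smul_mulVec, Matrix.one_mulVec]
  simp only [LinearMap.toMatrix'_mulVec]
  have hz : HasDerivAt (fun τ : ℝ => u + τ • symmetrizer γ u w) (symmetrizer γ u w) 0 := by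
    simpa using ((hasDerivAt_id (0 : ℝ)).smul_const (symmetrizer γ u w)).const_add u
  have hz0 : u + (0 : ℝ) • symmetrizer γ u w = u := by simp
  have h1 := (hdiff.hasFDerivAt.congr_fderiv rfl).comp_hasDerivAt_of_eq (0 : ℝ) hz hz0.symm
  have h2 := hasDerivAt_fluxN hγ n (z := fun τ : ℝ => u + τ • symmetrizer γ u w) (t := 0)
    (w := mkState (density w + density u / soundSpeed γ u * energy w)
    (momentum w) (density u * soundSpeed γ u * energy w))
    (by rw [hz0]; exact hz) (by rw [hz0]; exact hρ)
  rw [hz0] at h2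
  refine (h1.unique h2).trans ?_
  change _ = primToCons γ u _
  congr 1
  have hcc' : soundSpeed γ u ^ 2 * density u = γ * pressure γ u := by rw [hcc]; field_simp
  refine state_ext ?_ ?_ ?_
  · simp [acoustic]
    field_simp
    ring
  · ext l
    simp [acoustic]
    left
    field_simp
  · simp [acoustic]
    rw [← hcc']
    ring

/-- The absolute value of the Jacobian of the Euler flux. -/
theorem matAbs_jacobian_fluxN {γ : ℝ} (hγ : 1 < γ) (n : Fin d → ℝ) {u : State d}
    (hu : u ∈ physicalU d γ) :
    matAbs (jacobian (fluxN γ n) u) = LinearMap.toMatrix' (symmetrizer γ u)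
      * absPoly (velocity u ⬝ᵥ n) (soundSpeed γ u * Real.sqrt (n ⬝ᵥ n))
        (LinearMap.toMatrix' (acoustic (soundSpeed γ u) n))
      * (LinearMap.toMatrix' (symmetrizer γ u))⁻¹ := by
  have hT := symmetrizer_isUnit hγ hu
  have hT' := Matrix.isUnit_nonsing_inv_det _ hT
  have h := jacobian_fluxN_mul hγ n hu
  have h' : jacobian (fluxN γ n) u = LinearMap.toMatrix' (symmetrizer γ u)
      * ((velocity u ⬝ᵥ n) • (1 : Matrix _ _ ℝ)
        + LinearMap.toMatrix' (acoustic (soundSpeed γ u) n))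
      * (LinearMap.toMatrix' (symmetrizer γ u))⁻¹ := by
    rw [← h, Matrix.mul_assoc, Matrix.mul_nonsing_inv _ hT, mul_one]
  have h3 := matAbs_conj ((velocity u ⬝ᵥ n) • (1 : Matrix _ _ ℝ)
        + LinearMap.toMatrix' (acoustic (soundSpeed γ u) n)) hT'
  rw [Matrix.nonsing_inv_nonsing_inv _ hT] at h3
  rw [h', h3, matAbs_smul_one_add (acoustic_isHermitian _ _) (acoustic_pow_three _ _)]

end Diagonalization

/-! ### The stabilization matrices -/

section Stabilization

variable {d : ℕ} {X : Type*} [TopologicalSpace X]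

theorem continuous_metric {γ : ℝ} (hγ : 1 < γ) (s0 : ℝ) {f : X → State d} (hf : Continuous f)
    (hneg : ∀ x, energy (f x) < 0) : Continuous fun x => metric γ s0 (f x) := by
  have h : ∀ x, metric γ s0 (f x) = jacobian (consE γ s0) (f x) := fun x => metric_eq hγ s0 (hneg x)
  simp only [h]
  refine continuous_matrix fun i j => ?_
  have hc : Continuous fun x => fderiv ℝ (consE γ s0) (f x) := by
    rw [continuous_iff_continuousAt]
    intro x
    have : ContinuousAt (fderiv ℝ (consE γ s0)) (f x) :=
      ((contDiffAt_consE hγ s0 (hneg x)).fderiv_right (m := 0) (by simp)).continuousAt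
    exact this.comp hf.continuousAt
  exact (continuous_apply i).comp (hc.clm_apply continuous_const)

theorem continuous_consE {γ : ℝ} (hγ : 1 < γ) (s0 : ℝ) {f : X → State d} (hf : Continuous f)
    (hneg : ∀ x, energy (f x) < 0) : Continuous fun x => consE γ s0 (f x) :=
  continuous_iff_continuousAt.2 fun x =>
    (contDiffAt_consE hγ s0 (hneg x)).continuousAt.comp hf.continuousAt

theorem continuous_density {u : X → State d} (hu : Continuous u) :
    Continuous fun x => density (u x) := (continuous_apply _).comp hu

theorem continuous_velocity {u : X → State d} (hu : Continuous u)
    (hρ : ∀ x, density (u x) ≠ 0) : Continuous fun x => velocity (u x) :=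
  continuous_pi fun l => continuous_iff_continuousAt.2 fun x =>
    (contDiffAt_velocity (hρ x) l).continuousAt.comp hu.continuousAt

theorem continuous_pressure (γ : ℝ) {u : X → State d} (hu : Continuous u)
    (hρ : ∀ x, density (u x) ≠ 0) : Continuous fun x => pressure γ (u x) :=
  continuous_iff_continuousAt.2 fun x =>
    (contDiffAt_pressure γ (hρ x)).continuousAt.comp hu.continuousAt

theorem continuous_mkState {a c : X → ℝ} {b : X → Fin d → ℝ} (ha : Continuous a)
    (hb : Continuous b) (hc : Continuous c) : Continuous fun x => mkState (a x) (b x) (c x) := by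
  refine continuous_pi ?_
  rintro (i | i | i)
  · exact ha
  · exact (continuous_apply i).comp hb
  · exact hc

theorem continuous_soundSpeed (γ : ℝ) {u : X → State d} (hu : Continuous u)
    (hρ : ∀ x, density (u x) ≠ 0) : Continuous fun x => soundSpeed γ (u x) :=
  ((continuous_const.mul (continuous_pressure γ hu hρ)).div (continuous_density hu) hρ).sqrt

theorem continuous_symmetrizer {γ : ℝ} (hγ : 1 < γ) {u : X → State d} (hu : Continuous u)
    (hmem : ∀ x, u x ∈ physicalU d γ) :
    Continuous fun x => LinearMap.toMatrix' (symmetrizer γ (u x)) := by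
  refine continuous_matrix fun i j => ?_
  simp only [LinearMap.toMatrix'_apply]
  refine (continuous_apply i).comp ?_
  have hρ := fun x => (hmem x).1.ne'
  have h1 := continuous_velocity hu hρ
  have h2 := continuous_density hu
  have h3 := continuous_soundSpeed γ hu hρ
  have h4 := h2.div h3 fun x => (soundSpeed_pos hγ (hmem x)).ne'
  simp only [symmetrizer, LinearMap.coe_mk, AddHom.coe_mk, primToCons, density_mkState,
    momentum_mkState, energy_mkState]
  have h5 := (continuous_const (y := density (Pi.single j 1 : State d))).add
    (h4.mul (continuous_const (y := energy (Pi.single j 1 : State d))))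
  refine continuous_mkState h5 ((h5.smul h1).add (h2.smul continuous_const)) ?_
  exact (((h5.mul (h1.dotProduct h1)).div_const 2).add
    (h2.mul (h1.dotProduct continuous_const))).add (((h2.mul h3).mul continuous_const).div_const _)

theorem continuous_matrix_inv {ι : Type} [Fintype ι] [DecidableEq ι] {A : X → Matrix ι ι ℝ}
    (hA : Continuous A) (hdet : ∀ x, IsUnit (A x).det) : Continuous fun x => (A x)⁻¹ := by
  simp only [Matrix.inv_def, Ring.inverse_eq_inv']
  exact (hA.matrix_det.inv₀ fun x => (hdet x).ne_zero).smul hA.matrix_adjugate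

theorem continuous_acoustic {c : X → ℝ} {n : X → Fin d → ℝ} (hc : Continuous c)
    (hn : Continuous n) : Continuous fun x => LinearMap.toMatrix' (acoustic (c x) (n x)) := by
  refine continuous_matrix fun i j => ?_
  simp only [LinearMap.toMatrix'_apply]
  refine (continuous_apply i).comp ?_
  simp only [acoustic, LinearMap.coe_mk, AddHom.coe_mk]
  exact continuous_mkState continuous_const ((hc.mul continuous_const).smul hn)
    (hc.mul (continuous_const.dotProduct hn))

theorem jacN_eq {γ : ℝ} (hγ : 1 < γ) (s0 : ℝ) {v : State d} (hv : energy v < 0)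
    (n : Fin d → ℝ) : jacN γ s0 n v = jacobian (fluxN γ n) (consE γ s0 v) := by
  rw [jacN, consVars_eq hγ s0 hv]

/-- The explicit factorization of the Jacobian gives continuity jointly in the state and the
direction `n`. -/
theorem continuous_jacN {γ : ℝ} (hγ : 1 < γ) (s0 : ℝ) {f : X → State d} {n : X → Fin d → ℝ}
    (hf : Continuous f) (hn : Continuous n) (hneg : ∀ x, energy (f x) < 0) :
    Continuous fun x => jacN γ s0 (n x) (f x) := by
  have hmem := fun x => consE_mem hγ s0 (hneg x)
  have hu := continuous_consE hγ s0 hf hneg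
  have h : ∀ x, jacN γ s0 (n x) (f x)
      = LinearMap.toMatrix' (symmetrizer γ (consE γ s0 (f x)))
      * ((velocity (consE γ s0 (f x)) ⬝ᵥ n x) • (1 : Matrix _ _ ℝ)
        + LinearMap.toMatrix' (acoustic (soundSpeed γ (consE γ s0 (f x))) (n x)))
      * (LinearMap.toMatrix' (symmetrizer γ (consE γ s0 (f x))))⁻¹ := fun x => by
    rw [jacN_eq hγ s0 (hneg x), ← jacobian_fluxN_mul hγ _ (hmem x), Matrix.mul_assoc,
      Matrix.mul_nonsing_inv _ (symmetrizer_isUnit hγ (hmem x)), mul_one]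
  simp only [h]
  have hT := continuous_symmetrizer hγ hu hmem
  have hρ := fun x => (hmem x).1.ne'
  exact (hT.matrix_mul ((((continuous_velocity hu hρ).dotProduct hn).smul continuous_const).add
    (continuous_acoustic (continuous_soundSpeed γ hu hρ) hn))).matrix_mul
    (continuous_matrix_inv hT fun x => symmetrizer_isUnit hγ (hmem x))

theorem continuous_symJacN {γ : ℝ} (hγ : 1 < γ) (s0 : ℝ) {f : X → State d} {n : X → Fin d → ℝ}
    (hf : Continuous f) (hn : Continuous n) (hneg : ∀ x, energy (f x) < 0) :
    Continuous fun x => symJacN γ s0 (n x) (f x) :=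
  (continuous_jacN hγ s0 hf hn hneg).matrix_mul (continuous_metric hγ s0 hf hneg)

theorem dotProduct_self_pos {ι : Type} [Fintype ι] {n : ι → ℝ} (hn : n ≠ 0) : 0 < n ⬝ᵥ n := by
  have h : 0 ≤ n ⬝ᵥ n := by
    simp only [dotProduct]
    exact Finset.sum_nonneg fun i _ => mul_self_nonneg _
  exact lt_of_le_of_ne h fun h' => hn (dotProduct_self_eq_zero.1 h'.symm)

theorem continuous_absPoly {ι : Type} [Fintype ι] [DecidableEq ι] {V a : X → ℝ}
    {S : X → Matrix ι ι ℝ} (hV : Continuous V) (ha : Continuous a) (hS : Continuous S)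
    (ha0 : ∀ x, a x ≠ 0) : Continuous fun x => absPoly (V x) (a x) (S x) := by
  unfold absPoly
  have h1 := (hV.add ha).abs
  have h2 := (hV.sub ha).abs
  have h0 : Continuous fun x => |V x| • (1 : Matrix ι ι ℝ) := hV.abs.smul continuous_const
  have h3 : Continuous fun x => (|V x + a x| - |V x - a x|) / (2 * a x) :=
    (h1.sub h2).div (continuous_const.mul ha) fun x => mul_ne_zero two_ne_zero (ha0 x)
  have h4 : Continuous fun x => (|V x + a x| + |V x - a x| - 2 * |V x|) / (2 * a x ^ 2) :=
    ((h1.add h2).sub (continuous_const.mul hV.abs)).div (continuous_const.mul (ha.pow 2))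
      fun x => mul_ne_zero two_ne_zero (pow_ne_zero 2 (ha0 x))
  exact (h0.add (h3.smul hS)).add (h4.smul (hS.matrix_mul hS))

/-- The condition `n ≠ 0` keeps the interpolation nodes `0, ±c|n|` distinct, hence the divided
differences in `absPoly` continuous. -/
theorem continuous_genAbs {γ : ℝ} (hγ : 1 < γ) (s0 : ℝ) {f : X → State d} {n : X → Fin d → ℝ}
    (hf : Continuous f) (hn : Continuous n) (hneg : ∀ x, energy (f x) < 0)
    (hn0 : ∀ x, n x ≠ 0) : Continuous fun x => genAbs γ s0 (n x) (f x) := by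
  have hmem := fun x => consE_mem hγ s0 (hneg x)
  have hu := continuous_consE hγ s0 hf hneg
  have hT := continuous_symmetrizer hγ hu hmem
  have hρ := fun x => (hmem x).1.ne'
  have hc := continuous_soundSpeed γ hu hρ
  simp only [fun x => genAbs_eq hγ s0 (hneg x) (n x), fun x => jacN_eq hγ s0 (hneg x) (n x),
    fun x => matAbs_jacobian_fluxN hγ (n x) (hmem x)]
  refine ((hT.matrix_mul (continuous_absPoly ((continuous_velocity hu hρ).dotProduct hn)
    (hc.mul (hn.dotProduct hn).sqrt) (continuous_acoustic hc hn) fun x => ?_)).matrix_mul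
    (continuous_matrix_inv hT fun x => symmetrizer_isUnit hγ (hmem x))).matrix_mul
    (continuous_metric hγ s0 hf hneg)
  exact (mul_pos (soundSpeed_pos hγ (hmem x)) (Real.sqrt_pos.2 (dotProduct_self_pos (hn0 x)))).ne'

theorem fluxN_zero (γ : ℝ) : fluxN γ (0 : Fin d → ℝ) = fun _ => 0 := by
  funext u; simp [fluxN]

theorem matAbs_zero {ι : Type} [Fintype ι] [DecidableEq ι] : matAbs (0 : Matrix ι ι ℝ) = 0 := by
  have h : IsDiagonalization (0 : Matrix ι ι ℝ) (1, fun _ => 0) := by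
    refine ⟨by simp, by simp⟩
  rw [matAbs_eq h]
  simp

theorem genAbs_zero (γ s0 : ℝ) (v : State d) : genAbs γ s0 (0 : Fin d → ℝ) v = 0 := by
  have h : jacN γ s0 (0 : Fin d → ℝ) v = 0 := by
    ext i j
    simp [jacN, jacobian, fluxN_zero]
  rw [genAbs, symJacN, h, zero_mul, mul_zero, matAbs_zero, mul_zero]

/-- For a fixed direction, `n = 0` is harmless because the flux then vanishes identically. -/
theorem continuous_genAbs_const {γ : ℝ} (hγ : 1 < γ) (s0 : ℝ) {f : X → State d} (n : Fin d → ℝ)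
    (hf : Continuous f) (hneg : ∀ x, energy (f x) < 0) :
    Continuous fun x => genAbs γ s0 n (f x) := by
  by_cases hn : n = 0
  · simp only [hn, genAbs_zero]
    exact continuous_const
  · exact continuous_genAbs hγ s0 hf continuous_const hneg fun _ => hn

/-- The quadratic form of a weighted mean of matrices is the weighted mean of the quadratic
forms. -/
theorem dotProduct_integral_mulVec {ι : Type} [Fintype ι] {A : ℝ → Matrix ι ι ℝ}
    (hA : ContinuousOn A (Icc 0 1)) (x : ι → ℝ) :
    x ⬝ᵥ (Matrix.of fun i j => ∫ θ in (0 : ℝ)..1, (1 - θ) * A θ i j) *ᵥ x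
      = ∫ θ in (0 : ℝ)..1, (1 - θ) * (x ⬝ᵥ A θ *ᵥ x) := by
  have hA' : ∀ i j, ContinuousOn (fun θ => A θ i j) (Icc 0 1) := fun i j =>
    ((continuous_apply_apply i j).comp_continuousOn hA :)
  have hint : ∀ i j, IntervalIntegrable (fun θ => x i * ((1 - θ) * A θ i j * x j)) volume 0 1 := by
    intro i j
    refine ContinuousOn.intervalIntegrable ?_
    rw [uIcc_of_le zero_le_one]
    exact continuousOn_const.mul (((continuousOn_const.sub continuousOn_id).mul (hA' i j)).mul
      continuousOn_const)
  have h1 : ∀ θ, (1 - θ) * (x ⬝ᵥ A θ *ᵥ x) = ∑ i, ∑ j, x i * ((1 - θ) * A θ i j * x j) := by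
    intro θ
    simp only [dotProduct, Matrix.mulVec, Finset.mul_sum]
    exact Finset.sum_congr rfl fun i _ => Finset.sum_congr rfl fun j _ => by ring
  simp only [h1]
  have hsum : ∀ i, IntervalIntegrable (fun θ => ∑ j, x i * ((1 - θ) * A θ i j * x j))
      volume 0 1 := fun i => by
    simpa only [Finset.sum_fn] using IntervalIntegrable.sum Finset.univ fun j _ => hint i j
  rw [intervalIntegral.integral_finsetSum fun i _ => hsum i]
  simp only [dotProduct, Matrix.mulVec, Matrix.of_apply, Finset.mul_sum]
  refine Finset.sum_congr rfl fun i _ => ?_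
  rw [intervalIntegral.integral_finsetSum fun j _ => hint i j]
  refine Finset.sum_congr rfl fun j _ => ?_
  rw [intervalIntegral.integral_const_mul, intervalIntegral.integral_mul_const]

theorem jacPlus_eq {γ : ℝ} (hγ : 1 < γ) (s0 : ℝ) {v : State d} (hv : energy v < 0)
    (n : Fin d → ℝ) : jacPlus γ s0 n v
      = (1 / 2 : ℝ) • (symJacN γ s0 n v + genAbs γ s0 n v) := by
  rw [jacPlus, genAbs_eq hγ s0 hv, symJacN, ← add_mul, Matrix.smul_mul]

theorem jacMinus_eq {γ : ℝ} (hγ : 1 < γ) (s0 : ℝ) {v : State d} (hv : energy v < 0)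
    (n : Fin d → ℝ) : jacMinus γ s0 n v
      = (1 / 2 : ℝ) • (symJacN γ s0 n v - genAbs γ s0 n v) := by
  rw [jacMinus, genAbs_eq hγ s0 hv, symJacN, ← sub_mul, Matrix.smul_mul]

section Path

variable {γ s0 : ℝ} {path : ℝ → State d → State d → State d}

theorem continuousOn_genAbs_path (hpath : IsPath γ s0 path) (hγ : 1 < γ) {v w : State d}
    (hv : v ∈ physicalV d γ s0) (hw : w ∈ physicalV d γ s0) (n : Fin d → ℝ) :
    ContinuousOn (fun θ => genAbs γ s0 n (path θ v w)) (Icc 0 1) := by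
  rw [continuousOn_iff_continuous_domRestrict]
  exact continuous_genAbs_const hγ s0 n
    (continuousOn_iff_continuous_domRestrict.1 (hpath.smooth v hv w hw).continuousOn)
    fun θ => (mem_physicalV_iff hγ).1 (hpath.mem v hv w hw θ θ.2)

theorem continuousOn_symJacN_path (hpath : IsPath γ s0 path) (hγ : 1 < γ) {v w : State d}
    (hv : v ∈ physicalV d γ s0) (hw : w ∈ physicalV d γ s0) (n : Fin d → ℝ) :
    ContinuousOn (fun θ => symJacN γ s0 n (path θ v w)) (Icc 0 1) := by
  rw [continuousOn_iff_continuous_domRestrict]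
  exact continuous_symJacN hγ s0
    (continuousOn_iff_continuous_domRestrict.1 (hpath.smooth v hv w hw).continuousOn)
    continuous_const fun θ => (mem_physicalV_iff hγ).1 (hpath.mem v hv w hw θ θ.2)

/-- Write `G, S` for `|Ã_n|_{Ã₀}, Ã_n` on the path from `v` to `v̂`, and `G', S'` on the path from
`v̂` to `v`. Then `½[(G'+G) - (S'-S)] = ½(S+G) - ½(S'-G')`, which is `A⁺` on the first path minus
`A⁻` on the second. -/
theorem dotProduct_sigmaMV_sub_bigSigma (hpath : IsPath γ s0 path) (hγ : 1 < γ) {v vhat : State d}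
    (hv : v ∈ physicalV d γ s0) (hvhat : vhat ∈ physicalV d γ s0) (n : Fin d → ℝ) :
    1 / 2 * ((v - vhat) ⬝ᵥ ((sigmaMV γ s0 path vhat v n - bigSigma γ s0 path vhat v n)
      *ᵥ (v - vhat))) = ∫ θ in (0 : ℝ)..1, (1 - θ) * ((v - vhat) ⬝ᵥ
        ((jacPlus γ s0 n (path θ v vhat) - jacMinus γ s0 n (path θ vhat v)) *ᵥ (v - vhat))) := by
  set x := v - vhat
  have g1 := continuousOn_genAbs_path hpath hγ hv hvhat n
  have g2 := continuousOn_genAbs_path hpath hγ hvhat hv n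
  have s1 := continuousOn_symJacN_path hpath hγ hv hvhat n
  have s2 := continuousOn_symJacN_path hpath hγ hvhat hv n
  have e1 := dotProduct_integral_mulVec (g2.add g1) x
  have e2 := dotProduct_integral_mulVec (s2.sub s1) x
  have hc : ∀ {A : ℝ → Matrix (Comp d) (Comp d) ℝ}, ContinuousOn A (Icc 0 1) →
      IntervalIntegrable (fun θ => (1 - θ) * (x ⬝ᵥ A θ *ᵥ x)) volume 0 1 := by
    intro A hA
    refine ContinuousOn.intervalIntegrable ?_
    rw [uIcc_of_le zero_le_one]
    refine (continuousOn_const.sub continuousOn_id).mul ?_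
    exact (Continuous.dotProduct continuous_const
      (Continuous.matrix_mulVec continuous_id continuous_const)).comp_continuousOn hA
  rw [Matrix.sub_mulVec, dotProduct_sub, sigmaMV, bigSigma]
  refine (congrArg₂ (fun a b => 1 / 2 * (a - b)) e1 e2).trans ?_
  rw [← intervalIntegral.integral_sub (hc (g2.add g1)) (hc (s2.sub s1)),
    ← intervalIntegral.integral_const_mul]
  refine intervalIntegral.integral_congr fun θ hθ => ?_
  rw [uIcc_of_le zero_le_one] at hθ
  rw [jacPlus_eq hγ s0 ((mem_physicalV_iff hγ).1 (hpath.mem v hv vhat hvhat θ hθ)),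
    jacMinus_eq hγ s0 ((mem_physicalV_iff hγ).1 (hpath.mem vhat hvhat v hv θ hθ))]
  simp only [Pi.add_apply, Pi.sub_apply, Matrix.sub_mulVec, Matrix.add_mulVec,
    Matrix.smul_mulVec, dotProduct_sub,
    dotProduct_add, dotProduct_smul, smul_eq_mul]
  ring

end Path

/-! ### The face identity along straight paths -/

theorem hasDerivAt_fluxN_consE {γ : ℝ} (hγ : 1 < γ) (s0 : ℝ) (n : Fin d → ℝ) {z : ℝ → State d}
    {x : State d} {θ : ℝ} (hz : HasDerivAt z x θ) (hneg : energy (z θ) < 0) :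
    HasDerivAt (fun θ => fluxN γ n (consE γ s0 (z θ))) (symJacN γ s0 n (z θ) *ᵥ x) θ := by
  have h1 := (differentiableAt_consE hγ s0 hneg).hasFDerivAt
  have h2 := ((contDiffAt_fluxN γ n (consE_mem hγ s0 hneg).1.ne').differentiableAt
    (by simp)).hasFDerivAt
  refine (h2.comp_hasDerivAt θ (h1.comp_hasDerivAt θ hz)).congr_deriv ?_
  rw [symJacN, ← Matrix.mulVec_mulVec, metric_eq hγ s0 hneg, jacN_eq hγ s0 hneg, jacobian_mulVec,
    jacobian_mulVec]

theorem hasDerivAt_potentialFlux {γ : ℝ} (hγ : 1 < γ) (s0 : ℝ) (n : Fin d → ℝ) {z : ℝ → State d}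
    {x : State d} {θ : ℝ} (hz : HasDerivAt z x θ) (hneg : energy (z θ) < 0) :
    HasDerivAt (fun θ => potentialFlux γ s0 n (z θ)) (x ⬝ᵥ fluxN γ n (consE γ s0 (z θ))) θ := by
  refine ((hasFDerivAt_potentialFlux hγ s0 n hneg).comp_hasDerivAt θ hz).congr_deriv ?_
  simp [dotProduct, mul_comm, -Fintype.sum_sum_type]

theorem energy_segment_neg {v w : State d} (hv : energy v < 0) (hw : energy w < 0) {θ : ℝ}
    (hθ : θ ∈ Icc (0 : ℝ) 1) : energy ((1 - θ) • v + θ • w) < 0 := by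
  rw [energy_add, energy_smul, energy_smul]
  rcases eq_or_lt_of_le hθ.1 with h | h
  · rw [← h]; simpa using hv
  · nlinarith [hθ.2, mul_pos h (neg_pos.2 hw)]

/-- The quadratic form of `Σ` along straight paths. -/
theorem dotProduct_bigSigma_mulVec {γ s0 : ℝ} {path : ℝ → State d → State d → State d}
    (hpath : IsPath γ s0 path) (hγ : 1 < γ)
    (hstraight : ∀ v₁ ∈ physicalV d γ s0, ∀ v₂ ∈ physicalV d γ s0, ∀ θ ∈ Icc (0 : ℝ) 1,
      path θ v₁ v₂ = (1 - θ) • v₁ + θ • v₂) {v vhat : State d}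
    (hv : v ∈ physicalV d γ s0) (hvhat : vhat ∈ physicalV d γ s0) (n : Fin d → ℝ) :
    (v - vhat) ⬝ᵥ (bigSigma γ s0 path vhat v n *ᵥ (v - vhat))
      = 2 * (potentialFlux γ s0 n v - potentialFlux γ s0 n vhat)
        - (v - vhat) ⬝ᵥ (fluxN γ n (consE γ s0 vhat) + fluxN γ n (consE γ s0 v)) := by
  set x := v - vhat
  have hv' := (mem_physicalV_iff hγ).1 hv
  have hvhat' := (mem_physicalV_iff hγ).1 hvhat
  have s1 := continuousOn_symJacN_path hpath hγ hv hvhat n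
  have s2 := continuousOn_symJacN_path hpath hγ hvhat hv n
  refine (dotProduct_integral_mulVec (s2.sub s1) x).trans ?_
  have hL1 : ∀ θ : ℝ, HasDerivAt (fun θ : ℝ => (1 - θ) • vhat + θ • v) x θ := fun θ => by
    refine ((((hasDerivAt_id θ).const_sub 1).smul_const vhat).fun_add
      ((hasDerivAt_id θ).smul_const v)).congr_deriv ?_
    simp [x]; abel
  have hL2 : ∀ θ : ℝ, HasDerivAt (fun θ : ℝ => (1 - θ) • v + θ • vhat) (-x) θ := fun θ => by
    refine ((((hasDerivAt_id θ).const_sub 1).smul_const v).fun_add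
      ((hasDerivAt_id θ).smul_const vhat)).congr_deriv ?_
    simp [x]; abel
  -- An antiderivative found by integration by parts. On the reversed segment the velocity is `-x`,
  -- so the fluxes produced by `1 - θ` cancel exactly against the derivative of the difference of
  -- potentials.
  have hderiv : ∀ θ ∈ uIcc (0 : ℝ) 1, HasDerivAt (fun θ : ℝ =>
      (1 - θ) * (x ⬝ᵥ fluxN γ n (consE γ s0 ((1 - θ) • vhat + θ • v))
        + x ⬝ᵥ fluxN γ n (consE γ s0 ((1 - θ) • v + θ • vhat)))
      + (potentialFlux γ s0 n ((1 - θ) • vhat + θ • v)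
        - potentialFlux γ s0 n ((1 - θ) • v + θ • vhat)))
      ((1 - θ) * (x ⬝ᵥ (symJacN γ s0 n (path θ vhat v) - symJacN γ s0 n (path θ v vhat)) *ᵥ x))
      θ := by
    intro θ hθ
    rw [uIcc_of_le zero_le_one] at hθ
    have n1 := energy_segment_neg hvhat' hv' hθ
    have n2 := energy_segment_neg hv' hvhat' hθ
    have f1 := hasDerivAt_dotProduct (hasDerivAt_const θ x)
      (hasDerivAt_fluxN_consE hγ s0 n (hL1 θ) n1)
    have f2 := hasDerivAt_dotProduct (hasDerivAt_const θ x)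
      (hasDerivAt_fluxN_consE hγ s0 n (hL2 θ) n2)
    have p1 := hasDerivAt_potentialFlux hγ s0 n (hL1 θ) n1
    have p2 := hasDerivAt_potentialFlux hγ s0 n (hL2 θ) n2
    refine ((((hasDerivAt_id θ).const_sub 1).fun_mul (f1.fun_add f2)).fun_add
      (p1.fun_sub p2)).congr_deriv ?_
    rw [hstraight vhat hvhat v hv θ hθ, hstraight v hv vhat hvhat θ hθ, Matrix.sub_mulVec,
      Matrix.mulVec_neg, neg_dotProduct, dotProduct_sub, dotProduct_neg]
    simp only [id, zero_dotProduct, zero_add]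
    ring
  have hint : IntervalIntegrable (fun θ => (1 - θ) * (x ⬝ᵥ (symJacN γ s0 n (path θ vhat v)
      - symJacN γ s0 n (path θ v vhat)) *ᵥ x)) volume 0 1 := by
    refine ContinuousOn.intervalIntegrable ?_
    rw [uIcc_of_le zero_le_one]
    refine (continuousOn_const.sub continuousOn_id).mul ?_
    exact (Continuous.dotProduct continuous_const
      (Continuous.matrix_mulVec continuous_id continuous_const)).comp_continuousOn (s2.sub s1)
  refine (intervalIntegral.integral_eq_sub_of_hasDerivAt hderiv hint).trans ?_
  simp only [sub_self, zero_mul, zero_smul, one_smul, zero_add, sub_zero, add_zero, one_mul,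
    dotProduct_add]
  ring

/-- The pointwise entropy balance on a face. -/
theorem numFlux_entropy_balance {γ s0 : ℝ} {path : ℝ → State d → State d → State d}
    (hpath : IsPath γ s0 path) (hγ : 1 < γ)
    (hstraight : ∀ v₁ ∈ physicalV d γ s0, ∀ v₂ ∈ physicalV d γ s0, ∀ θ ∈ Icc (0 : ℝ) 1,
      path θ v₁ v₂ = (1 - θ) • v₁ + θ • v₂) {v vhat : State d}
    (hv : v ∈ physicalV d γ s0) (hvhat : vhat ∈ physicalV d γ s0) (n : Fin d → ℝ) :
    numFlux γ s0 (sigmaMV γ s0 path) vhat v n ⬝ᵥ (v - vhat)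
      - (potentialFlux γ s0 n v - potentialFlux γ s0 n vhat)
      = 1 / 2 * ((v - vhat) ⬝ᵥ ((sigmaMV γ s0 path vhat v n - bigSigma γ s0 path vhat v n)
      *ᵥ (v - vhat))) := by
  have h := dotProduct_bigSigma_mulVec hpath hγ hstraight hv hvhat n
  rw [numFlux]
  generalize v - vhat = x at h ⊢
  rw [consVars_eq hγ s0 ((mem_physicalV_iff hγ).1 hv),
    consVars_eq hγ s0 ((mem_physicalV_iff hγ).1 hvhat), Matrix.sub_mulVec, dotProduct_sub, h,
    add_dotProduct, smul_dotProduct, smul_dotProduct,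
    dotProduct_comm (fluxN γ n (consE γ s0 vhat) + fluxN γ n (consE γ s0 v)),
    dotProduct_comm (sigmaMV γ s0 path vhat v n *ᵥ x)]
  simp only [smul_eq_mul]
  ring

end Stabilization

/-! ### The divergence theorem on a polytope -/

theorem volume_setOf_dotProduct_eq {n : ℕ} {a : Fin n → ℝ} {b : ℝ} (h : ∃ y, a ⬝ᵥ y ≠ b) :
    volume {y : Fin n → ℝ | a ⬝ᵥ y = b} = 0 := by
  let s : AffineSubspace ℝ (Fin n → ℝ) :=
    { carrier := {y | a ⬝ᵥ y = b}
      smul_vsub_vadd_mem' := by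
        intro r x y z hx hy hz
        simp only [mem_ofPred_eq] at hx hy hz ⊢
        rw [vsub_eq_sub, vadd_eq_add, dotProduct_add, dotProduct_smul, dotProduct_sub, hx, hy, hz]
        simp }
  refine Measure.addHaar_affineSubspace volume s fun hs => ?_
  obtain ⟨y, hy⟩ := h
  have : y ∈ s := by rw [hs]; trivial
  exact hy this

theorem dotProduct_insertNth {n : ℕ} (N : Fin (n + 1) → ℝ) (l : Fin (n + 1)) (t : ℝ)
    (y : Fin n → ℝ) : N ⬝ᵥ (l.insertNth t y : Fin (n + 1) → ℝ) = N l * t + l.removeNth N ⬝ᵥ y := by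
  rw [dotProduct, Fin.sum_univ_succAbove _ l]
  simp [dotProduct, Fin.removeNth]

theorem continuous_insertNth {n : ℕ} (l : Fin (n + 1)) :
    Continuous fun p : ℝ × (Fin n → ℝ) => (l.insertNth p.1 p.2 : Fin (n + 1) → ℝ) := by
  refine continuous_pi fun i => ?_
  refine l.succAboveCases ?_ (fun j => ?_) i
  · simpa using continuous_fst
  · simpa using! (continuous_apply j).comp continuous_snd

namespace Polytope

section Basic

variable {n : ℕ} (P : Polytope n)

theorem isClosed_carrier : IsClosed P.carrier := by
  simp only [carrier, ofPred_forall]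
  exact isClosed_iInter fun j => isClosed_le (continuous_const.dotProduct continuous_id)
    continuous_const

theorem isCompact_carrier : IsCompact P.carrier :=
  Metric.isCompact_of_isClosed_isBounded P.isClosed_carrier P.bounded

theorem convex_carrier : Convex ℝ P.carrier := by
  intro x hx y hy a b ha hb hab j
  rw [dotProduct_add, dotProduct_smul, dotProduct_smul, smul_eq_mul, smul_eq_mul]
  calc a * (P.N j ⬝ᵥ x) + b * (P.N j ⬝ᵥ y) ≤ a * P.c j + b * P.c j :=
        add_le_add (mul_le_mul_of_nonneg_left (hx j) ha) (mul_le_mul_of_nonneg_left (hy j) hb)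
    _ = P.c j := by rw [← add_mul, hab, one_mul]

theorem mem_interior_carrier {x : Fin n → ℝ} (hx : ∀ j, P.N j ⬝ᵥ x < P.c j) :
    x ∈ interior P.carrier := by
  have ho : IsOpen {x : Fin n → ℝ | ∀ j, P.N j ⬝ᵥ x < P.c j} := by
    simp only [ofPred_forall]
    exact isOpen_iInter_of_finite fun j => isOpen_lt (continuous_const.dotProduct continuous_id)
      continuous_const
  exact interior_maximal (fun y hy j => (hy j).le) ho hx

theorem interior_carrier_nonempty : (interior P.carrier).Nonempty :=
  P.solid.imp fun _ hx => P.mem_interior_carrier hx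

theorem uniqueDiffOn_carrier : UniqueDiffOn ℝ P.carrier :=
  uniqueDiffOn_convex P.convex_carrier P.interior_carrier_nonempty

theorem measurableSet_carrier : MeasurableSet P.carrier := P.isClosed_carrier.measurableSet

theorem interior_carrier_ae_eq : (interior P.carrier : Set (Fin n → ℝ)) =ᵐ[volume] P.carrier :=
  interior_ae_eq_of_null_frontier (P.convex_carrier.addHaar_frontier volume)

theorem isCompact_facet (j : P.Facet) : IsCompact (P.facet j) :=
  P.isCompact_carrier.inter_right (isClosed_eq (continuous_const.dotProduct continuous_id)
    continuous_const)

end Basic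

section Divergence

variable {n : ℕ} (P : Polytope (n + 1)) (l : Fin (n + 1))

/-- The hyperplane of the facet `j` as a graph over the coordinate hyperplane `x_l = 0`. -/
def height (j : P.Facet) (y : Fin n → ℝ) : ℝ := (P.c j - l.removeNth (P.N j) ⬝ᵥ y) / P.N j l

theorem height_eq_iff {j : P.Facet} (hj : P.N j l ≠ 0) {t : ℝ} {y : Fin n → ℝ} :
    P.height l j y = t ↔ P.N j ⬝ᵥ (l.insertNth t y : Fin (n + 1) → ℝ) = P.c j := by
  rw [height, dotProduct_insertNth, div_eq_iff hj]
  constructor <;> intro h <;> linarith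

theorem continuous_height (j : P.Facet) : Continuous (P.height l j) :=
  (continuous_const.sub (continuous_const.dotProduct continuous_id)).div_const _

theorem continuous_insertNth_height (j : P.Facet) :
    Continuous fun y => (l.insertNth (P.height l j y) y : Fin (n + 1) → ℝ) :=
  (continuous_insertNth l).comp ((P.continuous_height l j).prodMk continuous_id)

theorem insertNth_height_removeNth {j : P.Facet} (hj : P.N j l ≠ 0) {x : Fin (n + 1) → ℝ}
    (hx : P.N j ⬝ᵥ x = P.c j) : l.insertNth (P.height l j (l.removeNth x)) (l.removeNth x) = x := by
  have : P.height l j (l.removeNth x) = x l := by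
    rw [P.height_eq_iff l hj, Fin.insertNth_self_removeNth, hx]
  rw [this, Fin.insertNth_self_removeNth]

/-- A non-vertical hyperplane has a single point above each `y`, so it is enough to test that lift.
-/
theorem mem_image_facet_iff {j : P.Facet} (hj : P.N j l ≠ 0) {y : Fin n → ℝ} :
    y ∈ (fun x : Fin (n + 1) → ℝ => (l.removeNth x : Fin n → ℝ)) '' P.facet j ↔
      (l.insertNth (P.height l j y) y : Fin (n + 1) → ℝ) ∈ P.carrier := by
  constructor
  · rintro ⟨x, hx, rfl⟩
    simp only
    rw [P.insertNth_height_removeNth l hj hx.2]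
    exact hx.1
  · intro h
    refine ⟨_, ⟨h, (P.height_eq_iff l hj).1 rfl⟩, ?_⟩
    simp only
    rw [Fin.removeNth_insertNth]

/-- Two facets overlap in a null set. -/
theorem volume_facet_inter {i j : P.Facet} (hij : i ≠ j) (hj : P.N j l ≠ 0) :
    volume {y : Fin n → ℝ |
      P.N i ⬝ᵥ (l.insertNth (P.height l j y) y : Fin (n + 1) → ℝ) = P.c i} = 0 := by
  have h : ∀ y : Fin n → ℝ,
      P.N i ⬝ᵥ (l.insertNth (P.height l j y) y : Fin (n + 1) → ℝ) = P.c i ↔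
      (l.removeNth (P.N i) - (P.N i l / P.N j l) • l.removeNth (P.N j)) ⬝ᵥ y
        = P.c i - P.N i l / P.N j l * P.c j := by
    intro y
    rw [dotProduct_insertNth, height, sub_dotProduct, smul_dotProduct, smul_eq_mul]
    constructor <;> intro h
    · rw [← h]; ring
    · rw [eq_sub_iff_add_eq] at h; rw [← h]; ring
  simp only [h]
  refine volume_setOf_dotProduct_eq ?_
  -- Irredundancy provides a point of facet `j` strictly inside half-space `i`, so the affine
  -- condition on `y` is not satisfied everywhere.
  obtain ⟨x, hx1, hx2⟩ := P.facet_nonempty j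
  refine ⟨l.removeNth x, ?_⟩
  rw [Ne, ← h, P.insertNth_height_removeNth l hj hx1]
  exact (hx2 i hij).ne

/-- The end point of a slice of the polytope in direction `σ e_l` lies on exactly one facet. -/
theorem sum_facet_of_isExtreme [DecidableEq P.Facet] {y : Fin n → ℝ}
    (hy : ∀ i j, i ≠ j → P.N j l ≠ 0 →
      P.N i ⬝ᵥ (l.insertNth (P.height l j y) y : Fin (n + 1) → ℝ) ≠ P.c i)
    {σ : ℝ} {t0 : ℝ} (h0 : (l.insertNth t0 y : Fin (n + 1) → ℝ) ∈ P.carrier)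
    (hmax : ∀ t, (l.insertNth t y : Fin (n + 1) → ℝ) ∈ P.carrier → σ * t ≤ σ * t0)
    (hσ : σ ≠ 0) (f : (Fin (n + 1) → ℝ) → ℝ) :
    (∑ j, if 0 < σ * P.N j l then indicator
      ((fun x : Fin (n + 1) → ℝ => (l.removeNth x : Fin n → ℝ)) '' P.facet j)
      (fun y => f (l.insertNth (P.height l j y) y)) y else 0) = f (l.insertNth t0 y) := by
  -- If no facet facing in direction `σ e_l` were active, a small further step in that direction
  -- would stay in the polytope, against maximality of `σ * t0`.
  have hex : ∃ j, 0 < σ * P.N j l ∧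
      P.N j ⬝ᵥ (l.insertNth t0 y : Fin (n + 1) → ℝ) = P.c j := by
    by_contra! hcon
    have hev : ∀ᶠ r in nhdsWithin (0 : ℝ) (Ioi 0), ∀ j,
        P.N j ⬝ᵥ (l.insertNth (t0 + r * σ) y : Fin (n + 1) → ℝ) ≤ P.c j := by
      rw [Filter.eventually_all]
      intro j
      rcases lt_or_ge 0 (σ * P.N j l) with h | h
      · have hlt := lt_of_le_of_ne (h0 j) (hcon j h)
        have hc : Continuous fun r : ℝ =>
            P.N j ⬝ᵥ (l.insertNth (t0 + r * σ) y : Fin (n + 1) → ℝ) :=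
          continuous_const.dotProduct ((continuous_insertNth l).comp
            ((continuous_const.add (continuous_id.mul continuous_const)).prodMk continuous_const))
        have : ∀ᶠ r in nhds (0 : ℝ),
            P.N j ⬝ᵥ (l.insertNth (t0 + r * σ) y : Fin (n + 1) → ℝ) < P.c j :=
          (hc.tendsto' 0 _ (by simp)).eventually_lt_const hlt
        exact (this.filter_mono nhdsWithin_le_nhds).mono fun _ h => h.le
      · filter_upwards [self_mem_nhdsWithin] with r hr
        refine le_trans ?_ (h0 j)
        rw [dotProduct_insertNth, dotProduct_insertNth]
        nlinarith [mul_nonneg (le_of_lt (mem_Ioi.1 hr)) (neg_nonneg.2 h)]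
    obtain ⟨r, hr, hr0⟩ := (hev.and self_mem_nhdsWithin).exists
    have := hmax _ hr
    have h2 : 0 < σ * σ := mul_self_pos.2 hσ
    nlinarith [mul_pos (mem_Ioi.1 hr0) h2]
  obtain ⟨j, hj, hjt⟩ := hex
  have hj0 : P.N j l ≠ 0 := fun h => by simp [h] at hj
  have hjt' := (P.height_eq_iff l hj0).2 hjt
  rw [Finset.sum_eq_single j]
  · rw [if_pos hj, indicator_of_mem ((P.mem_image_facet_iff l hj0).2 (by rwa [hjt'])), hjt']
  -- Any other contributing facet would be reached at the same end point, which `hy` excludes.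
  · intro i _ hij
    split_ifs with hi
    · have hi0 : P.N i l ≠ 0 := fun h => by simp [h] at hi
      refine indicator_of_notMem (fun hmem => ?_) _
      rw [P.mem_image_facet_iff l hi0] at hmem
      have h1 := hmax _ hmem
      have h2 := h0 i
      have h3 : P.N i ⬝ᵥ (l.insertNth (P.height l i y) y : Fin (n + 1) → ℝ) = P.c i :=
        (P.height_eq_iff l hi0).1 rfl
      rw [← h3, dotProduct_insertNth, dotProduct_insertNth] at h2
      have h4 : P.height l i y = t0 := by
        rcases lt_or_gt_of_ne hσ with hs | hs
        · have : P.N i l < 0 := by by_contra! h; nlinarith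
          nlinarith
        · have : 0 < P.N i l := by by_contra! h; nlinarith
          nlinarith
      exact hy j i hij.symm hi0 (by rw [h4]; exact hjt)
    · rfl
  · simp

theorem slice_isCompact (y : Fin n → ℝ) :
    IsCompact {t : ℝ | (l.insertNth t y : Fin (n + 1) → ℝ) ∈ P.carrier} := by
  have hc : Continuous fun t : ℝ => (l.insertNth t y : Fin (n + 1) → ℝ) :=
    (continuous_insertNth l).comp (continuous_id.prodMk continuous_const)
  refine Metric.isCompact_of_isClosed_isBounded (P.isClosed_carrier.preimage hc) ?_
  refine (P.isCompact_carrier.image (continuous_apply l)).isBounded.subset ?_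
  intro t ht
  exact ⟨_, ht, by simp⟩

theorem slice_convex (y : Fin n → ℝ) :
    Convex ℝ {t : ℝ | (l.insertNth t y : Fin (n + 1) → ℝ) ∈ P.carrier} := by
  intro s hs t ht a b ha hb hab
  have := P.convex_carrier hs ht ha hb hab
  have h : (l.insertNth (a • s + b • t) y : Fin (n + 1) → ℝ)
      = a • (l.insertNth s y : Fin (n + 1) → ℝ) + b • (l.insertNth t y : Fin (n + 1) → ℝ) := ?_
  · rw [mem_ofPred_eq, h]
    exact this
  ext i
  refine l.succAboveCases ?_ (fun j => ?_) i
  · simp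
  · simp [← add_mul, hab]

/-- The fundamental theorem of calculus on a slice of the polytope. -/
theorem integral_slice [DecidableEq P.Facet] {f : (Fin (n + 1) → ℝ) → ℝ}
    {f' : (Fin (n + 1) → ℝ) → (Fin (n + 1) → ℝ) →L[ℝ] ℝ}
    (hf : ∀ x ∈ P.carrier, HasFDerivAt f (f' x) x)
    (hf' : ContinuousOn (fun x => f' x (Pi.single l 1)) P.carrier) {y : Fin n → ℝ}
    (hy : ∀ i j, i ≠ j → P.N j l ≠ 0 →
      P.N i ⬝ᵥ (l.insertNth (P.height l j y) y : Fin (n + 1) → ℝ) ≠ P.c i) :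
    ∫ t, P.carrier.indicator (fun x => f' x (Pi.single l 1)) (l.insertNth t y)
      = ∑ j, Real.sign (P.N j l) * indicator
        ((fun x : Fin (n + 1) → ℝ => (l.removeNth x : Fin n → ℝ)) '' P.facet j)
        (fun y => f (l.insertNth (P.height l j y) y)) y := by
  set S := {t : ℝ | (l.insertNth t y : Fin (n + 1) → ℝ) ∈ P.carrier} with hS
  have hcont : Continuous fun t : ℝ => (l.insertNth t y : Fin (n + 1) → ℝ) :=
    (continuous_insertNth l).comp (continuous_id.prodMk continuous_const)
  have hcomp : IsCompact S := P.slice_isCompact l y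
  rcases S.eq_empty_or_nonempty with hempty | hne
  · have h1 : ∀ t, (l.insertNth t y : Fin (n + 1) → ℝ) ∉ P.carrier := fun t ht => by
      have : t ∈ S := ht
      rw [hempty] at this
      exact this
    simp only [indicator_of_notMem (h1 _), integral_zero]
    refine (Finset.sum_eq_zero fun j _ => ?_).symm
    by_cases hj : P.N j l = 0
    · simp [hj]
    · rw [indicator_of_notMem fun hm => h1 _ ((P.mem_image_facet_iff l hj).1 hm), mul_zero]
  · obtain ⟨a, haS, ha⟩ := hcomp.exists_isLeast hne
    obtain ⟨b, hbS, hb⟩ := hcomp.exists_isGreatest hne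
    have hab : a ≤ b := ha hbS
    have hIcc : S = Icc a b := by
      refine Subset.antisymm (fun t ht => ⟨ha ht, hb ht⟩) ?_
      exact (P.slice_convex l y).ordConnected.out haS hbS
    have hderiv : ∀ t ∈ uIcc a b, HasDerivAt (fun t => f (l.insertNth t y))
        (f' (l.insertNth t y) (Pi.single l 1)) t := by
      intro t ht
      rw [uIcc_of_le hab, ← hIcc] at ht
      refine (hf _ ht).comp_hasDerivAt t ?_
      rw [hasDerivAt_pi]
      intro i
      refine l.succAboveCases ?_ (fun j => ?_) i
      · simpa using hasDerivAt_id' t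
      · simpa using hasDerivAt_const t _
    have hint : IntervalIntegrable (fun t => f' (l.insertNth t y) (Pi.single l 1)) volume a b := by
      refine ContinuousOn.intervalIntegrable ?_
      rw [uIcc_of_le hab, ← hIcc]
      exact hf'.comp hcont.continuousOn fun t ht => ht
    have hind : (fun t => P.carrier.indicator (fun x => f' x (Pi.single l 1)) (l.insertNth t y))
        = S.indicator fun t => f' (l.insertNth t y) (Pi.single l 1) := rfl
    -- The end point `b` is extreme for `σ = 1` and `a` for `σ = -1`. Each non-vertical facet enters
    -- just one of the two sums, selected by the sign of its normal component.
    rw [hind, integral_indicator hcomp.measurableSet, hIcc, integral_Icc_eq_integral_Ioc,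
      ← intervalIntegral.integral_of_le hab, intervalIntegral.integral_eq_sub_of_hasDerivAt hderiv
      hint, ← P.sum_facet_of_isExtreme l hy (σ := 1) hbS (fun t ht => by simpa using hb ht)
      one_ne_zero f, ← P.sum_facet_of_isExtreme l hy (σ := -1) haS
      (fun t ht => by simpa using ha ht) (by norm_num) f, ← Finset.sum_sub_distrib]
    refine Finset.sum_congr rfl fun j _ => ?_
    rcases lt_trichotomy (P.N j l) 0 with h | h | h
    · rw [if_neg (by linarith), if_pos (by linarith), Real.sign_of_neg h]; ring
    · simp [h]
    · rw [if_pos (by linarith), if_neg (by linarith), Real.sign_of_pos h]; ring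

/-- The divergence theorem on a polytope, for the vector field `f e_l`: facets are parametrized
over the coordinate hyperplane `x_l = 0`. -/
theorem integral_partial_deriv {f : (Fin (n + 1) → ℝ) → ℝ}
    {f' : (Fin (n + 1) → ℝ) → (Fin (n + 1) → ℝ) →L[ℝ] ℝ}
    (hf : ∀ x ∈ P.carrier, HasFDerivAt f (f' x) x)
    (hf' : ContinuousOn (fun x => f' x (Pi.single l 1)) P.carrier) :
    ∫ x in P.carrier, f' x (Pi.single l 1)
      = ∑ j, Real.sign (P.N j l) * ∫ y in
        (fun x : Fin (n + 1) → ℝ => (l.removeNth x : Fin n → ℝ)) '' P.facet j,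
        f (l.insertNth (P.height l j y) y) := by
  classical
  have hmp := (volume_preserving_piFinSuccAbove (fun _ : Fin (n + 1) => ℝ) l).symm
  have hint : Integrable (P.carrier.indicator fun x => f' x (Pi.single l 1)) := by
    rw [integrable_indicator_iff P.measurableSet_carrier]
    exact hf'.integrableOn_compact P.isCompact_carrier
  have hint' := (hmp.integrable_comp_emb (MeasurableEquiv.measurableEmbedding _)).2 hint
  rw [← integral_indicator P.measurableSet_carrier,
    ← hmp.integral_comp (MeasurableEquiv.measurableEmbedding _)]
  have hcont : ContinuousOn f P.carrier := fun x hx => (hf x hx).continuousAt.continuousWithinAt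
  have hm : ∀ j, IsCompact ((fun x : Fin (n + 1) → ℝ => (l.removeNth x : Fin n → ℝ)) '' P.facet j) :=
    fun j => (P.isCompact_facet j).image (continuous_pi fun i => continuous_apply _)
  -- Over almost every `y`, the lift to a non-vertical facet lies on no other facet hyperplane.
  -- Vertical facets do not contribute because `Real.sign 0 = 0`.
  have hgood : ∀ᵐ y : Fin n → ℝ, ∀ i j, i ≠ j → P.N j l ≠ 0 →
      P.N i ⬝ᵥ (l.insertNth (P.height l j y) y : Fin (n + 1) → ℝ) ≠ P.c i := by
    rw [ae_all_iff]; intro i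
    rw [ae_all_iff]; intro j
    by_cases hij : i = j
    · simp [hij]
    by_cases hj : P.N j l = 0
    · simp [hj]
    refine (measure_eq_zero_iff_ae_notMem.1 (P.volume_facet_inter l hij hj)).mono ?_
    intro y hy _ _
    exact hy
  refine (integral_prod_symm _ hint').trans ?_
  refine (integral_congr_ae (hgood.mono fun y hy => P.integral_slice l hf hf' hy)).trans ?_
  rw [integral_finsetSum]
  · refine Finset.sum_congr rfl fun j _ => ?_
    rw [integral_const_mul, integral_indicator (hm j).measurableSet]
  · intro j _
    by_cases hj : P.N j l = 0
    · simp [hj]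
    refine Integrable.const_mul ?_ _
    rw [integrable_indicator_iff (hm j).measurableSet]
    exact (hcont.comp (P.continuous_insertNth_height l j).continuousOn fun y hy =>
      (P.mem_image_facet_iff l hj).1 hy).integrableOn_compact (hm j)

end Divergence

end Polytope

/-! ### Determinants of bordered matrices -/

section Bordered

variable {n : ℕ}

/-- The square matrix with first column `w` and remaining columns `B`. -/
def bordered (w : Fin (n + 1) → ℝ) (B : Matrix (Fin (n + 1)) (Fin n) ℝ) :
    Matrix (Fin (n + 1)) (Fin (n + 1)) ℝ :=
  Matrix.of fun i => Fin.cons (w i) (B i)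

theorem det_of_first_column {A : Matrix (Fin (n + 1)) (Fin (n + 1)) ℝ}
    (h : ∀ i : Fin n, A i.succ 0 = 0) : A.det = A 0 0 * (A.submatrix Fin.succ Fin.succ).det := by
  rw [Matrix.det_succ_column_zero, Fin.sum_univ_succ]
  simp [h]

/-- Since `z` is orthogonal to the columns of `B`, the product of the transpose of the first matrix
with the second is block triangular. The relations between minors, Gram determinants and normals all
follow by choosing the borders. -/
theorem det_bordered_mul (w z : Fin (n + 1) → ℝ) (B C : Matrix (Fin (n + 1)) (Fin n) ℝ)
    (h : z ᵥ* B = 0) :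
    (bordered w B).det * (bordered z C).det = (w ⬝ᵥ z) * (Bᵀ * C).det := by
  rw [← Matrix.det_transpose (bordered w B), ← Matrix.det_mul, det_of_first_column]
  · rfl
  · intro i
    have := congrFun h i
    simp only [Matrix.vecMul, dotProduct, Pi.zero_apply] at this
    simp only [Matrix.mul_apply, Matrix.transpose_apply, bordered, Matrix.of_apply, Fin.cons_succ,
      Fin.cons_zero]
    rw [← this]
    exact Finset.sum_congr rfl fun k _ => mul_comm _ _

theorem mul_bordered (J : Matrix (Fin (n + 1)) (Fin (n + 1)) ℝ) (w : Fin (n + 1) → ℝ)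
    (B : Matrix (Fin (n + 1)) (Fin n) ℝ) :
    J * bordered w B = bordered (J *ᵥ w) (J * B) := by
  ext i j
  refine Fin.cases ?_ (fun k => ?_) j
  · simp [Matrix.mul_apply, bordered, Matrix.mulVec, dotProduct]
  · simp [Matrix.mul_apply, bordered]

theorem det_bordered_single (l : Fin (n + 1)) (B : Matrix (Fin (n + 1)) (Fin n) ℝ) :
    (bordered (Pi.single l 1) B).det = (-1) ^ (l : ℕ) * (B.submatrix l.succAbove id).det := by
  rw [Matrix.det_succ_column_zero, Finset.sum_eq_single l]
  · simp only [bordered, Matrix.of_apply, Fin.cons_zero, Pi.single_eq_same, mul_one]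
    rfl
  · intro i _ hi
    simp [bordered, hi]
  · simp

variable {N : Fin (n + 1) → ℝ} {B : Matrix (Fin (n + 1)) (Fin n) ℝ}

theorem det_bordered_sq (hN : N ⬝ᵥ N = 1) (hB : N ᵥ* B = 0) :
    (bordered N B).det ^ 2 = (Bᵀ * B).det := by
  rw [sq, det_bordered_mul N N B B hB, hN, one_mul]

/-- The minors of `B` are the components of the normal vector of its range. -/
theorem abs_det_minor (hN : N ⬝ᵥ N = 1) (hB : N ᵥ* B = 0) (h0 : (bordered N B).det ≠ 0)
    (l : Fin (n + 1)) :
    |(B.submatrix l.succAbove id).det| = |N l| * |(bordered N B).det| := by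
  -- The border `e_l` gives `det[e_l B] · det[N B] = N_l · det[N B]²`, and one factor cancels.
  have h := det_bordered_mul (Pi.single l 1) N B B hB
  rw [← det_bordered_sq hN hB, single_dotProduct, one_mul, sq, ← mul_assoc] at h
  have h2 := mul_right_cancel₀ h0 h
  rw [det_bordered_single] at h2
  rw [← abs_mul, ← h2, abs_mul, abs_pow, abs_neg, abs_one, one_pow, one_mul]

/-- The Gram determinant of `J B` in terms of the normal vector `N` of the range of `B`. -/
theorem det_gram_mul (hN : N ⬝ᵥ N = 1) (hB : N ᵥ* B = 0)
    {J : Matrix (Fin (n + 1)) (Fin (n + 1)) ℝ} (hJ : IsUnit J.det)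
    (h0 : ((J * B)ᵀ * (J * B)).det ≠ 0) :
    ((J * B)ᵀ * (J * B)).det = (((J⁻¹)ᵀ *ᵥ N) ⬝ᵥ ((J⁻¹)ᵀ *ᵥ N)) *
      (J.det * (bordered N B).det) ^ 2 := by
  set w := (J⁻¹)ᵀ *ᵥ N with hw
  have hwv : w = N ᵥ* J⁻¹ := Matrix.mulVec_transpose _ _
  have hwC : w ᵥ* (J * B) = 0 := by
    rw [hwv, Matrix.vecMul_vecMul, ← Matrix.mul_assoc, Matrix.nonsing_inv_mul _ hJ,
      Matrix.one_mul, hB]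
  -- The conormal `w` is orthogonal to the range of `J B` and satisfies `(J N)·w = 1`. Bordering `J
  -- B` by `w` and by `J N` gives two relations; eliminating `det[w, J B]` leaves one Gram
  -- determinant to cancel.
  have h1 := det_bordered_mul w w (J * B) (J * B) hwC
  have h2 := det_bordered_mul (J *ᵥ N) w (J * B) (J * B) hwC
  have h3 : (J *ᵥ N) ⬝ᵥ w = 1 := by
    rw [dotProduct_comm, hwv, Matrix.dotProduct_mulVec, Matrix.vecMul_vecMul,
      Matrix.nonsing_inv_mul _ hJ, Matrix.vecMul_one, hN]
  rw [← mul_bordered, Matrix.det_mul, h3, one_mul] at h2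
  have h4 : ((J * B)ᵀ * (J * B)).det * ((J * B)ᵀ * (J * B)).det
      = ((w ⬝ᵥ w) * (J.det * (bordered N B).det) ^ 2) * ((J * B)ᵀ * (J * B)).det := by
    conv_lhs => rw [← h2]
    linear_combination (J.det * (bordered N B).det) ^ 2 * h1
  exact mul_right_cancel₀ h0 h4

theorem det_bordered_ne_zero (hN : N ⬝ᵥ N = 1) (hB : N ᵥ* B = 0)
    {J : Matrix (Fin (n + 1)) (Fin (n + 1)) ℝ} (hJ : IsUnit J.det)
    (h0 : ((J * B)ᵀ * (J * B)).det ≠ 0) : (bordered N B).det ≠ 0 := fun h => by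
  rw [det_gram_mul hN hB hJ h0, h] at h0
  simp at h0

end Bordered

/-! ### Polynomial maps -/

section PolyMap

variable {a b : ℕ}

/-- Strict differentiability is proved because the local inverses of the element mappings come from
the inverse function theorem. -/
theorem hasStrictFDerivAt_eval (q : MvPolynomial (Fin a) ℝ) (x : Fin a → ℝ) :
    HasStrictFDerivAt (fun x => MvPolynomial.eval x q)
      (∑ i, MvPolynomial.eval x (MvPolynomial.pderiv i q) •
        ContinuousLinearMap.proj (R := ℝ) (φ := fun _ : Fin a => ℝ) i) x := by
  induction q using MvPolynomial.induction_on with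
  | C r => simpa using hasStrictFDerivAt_const r x
  | add p q hp hq => simpa [add_smul, Finset.sum_add_distrib] using hp.fun_add hq
  | mul_X p j hp =>
    have h := hp.fun_mul (hasStrictFDerivAt_apply (𝕜 := ℝ) j x)
    simp only [map_mul, MvPolynomial.eval_X]
    refine h.congr_fderiv ?_
    ext w
    simp [Derivation.leibniz, MvPolynomial.pderiv_X, Pi.single_apply, Finset.mul_sum,
      Finset.sum_add_distrib, add_mul, apply_ite, mul_assoc]

theorem continuous_eval (q : MvPolynomial (Fin a) ℝ) :
    Continuous fun x : Fin a → ℝ => MvPolynomial.eval x q :=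
  MvPolynomial.continuous_eval q

theorem hasStrictFDerivAt_polyMap (q : Fin b → MvPolynomial (Fin a) ℝ) (x : Fin a → ℝ) :
    HasStrictFDerivAt (polyMap q) (LinearMap.toContinuousLinearMap (polyJac q x).mulVecLin) x := by
  rw [hasStrictFDerivAt_pi']
  intro i
  refine (hasStrictFDerivAt_eval (q i) x).congr_fderiv ?_
  ext w
  simp [polyJac, Matrix.mulVec, dotProduct]

theorem continuous_polyMap (q : Fin b → MvPolynomial (Fin a) ℝ) : Continuous (polyMap q) :=
  continuous_pi fun i => MvPolynomial.continuous_eval (q i)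

theorem continuous_polyJac (q : Fin b → MvPolynomial (Fin a) ℝ) : Continuous (polyJac q) :=
  continuous_matrix fun _ _ => MvPolynomial.continuous_eval _

/-- The Piola identity: the rows of the cofactor matrix are divergence free. -/
theorem piola {n : ℕ} (hn : n + 1 ≤ 3) (q : Fin (n + 1) → MvPolynomial (Fin (n + 1)) ℝ)
    (l : Fin (n + 1)) : ∑ m, MvPolynomial.pderiv m
      ((Matrix.of fun i j => MvPolynomial.pderiv j (q i)).adjugate m l) = 0 := by
  have hcomm : ∀ i j (p : MvPolynomial (Fin (n + 1)) ℝ), MvPolynomial.pderiv i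
      (MvPolynomial.pderiv j p) = MvPolynomial.pderiv j (MvPolynomial.pderiv i p) := by
    intro i j p
    let D (k : Fin (n + 1)) : Derivation ℝ (MvPolynomial (Fin (n + 1)) ℝ)
      (MvPolynomial (Fin (n + 1)) ℝ) := MvPolynomial.pderiv k
    -- A commutator of derivations is a derivation, so it suffices that it kills the variables.
    have h : ⁅D i, D j⁆ = 0 := by
      refine MvPolynomial.derivation_ext fun k => ?_
      simp only [D, Derivation.commutator_apply, MvPolynomial.pderiv_X, Derivation.zero_apply]
      simp only [Pi.single_apply]
      split_ifs <;> simp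
    have := congrArg (fun D => D p) h
    simpa [D, Derivation.commutator_apply, sub_eq_zero] using this
  -- The dimension bound leaves three explicit adjugates. After expansion, terms cancel by the
  -- symmetry of second derivatives.
  obtain rfl | rfl | rfl : n = 0 ∨ n = 1 ∨ n = 2 := by omega
  · rw [Fin.eq_zero l]
    simp [Matrix.adjugate_fin_one]
  · rw [Matrix.adjugate_fin_two]
    fin_cases l <;> simp [Fin.sum_univ_succ, hcomm 1 0]
  · rw [Matrix.adjugate_fin_three]
    fin_cases l <;> simp [Fin.sum_univ_succ, Derivation.leibniz, hcomm 1 0, hcomm 2 0, hcomm 2 1]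
      <;> ring

end PolyMap

/-! ### Local coordinates on the elements of a mesh -/

/-- The continuous linear map of a matrix. -/
abbrev matCLM {a b : ℕ} (A : Matrix (Fin b) (Fin a) ℝ) : (Fin a → ℝ) →L[ℝ] (Fin b → ℝ) :=
  LinearMap.toContinuousLinearMap A.mulVecLin

theorem matCLM_apply {a b : ℕ} (A : Matrix (Fin b) (Fin a) ℝ) (x : Fin a → ℝ) :
    matCLM A x = A *ᵥ x := rfl

theorem det_matCLM {a : ℕ} (A : Matrix (Fin a) (Fin a) ℝ) : (matCLM A).det = A.det := by
  rw [ContinuousLinearMap.det, LinearMap.coe_toContinuousLinearMap]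
  exact LinearMap.det_toLin' A

/-- The continuous linear equivalence of an invertible matrix. -/
def matEquiv {a : ℕ} (A : Matrix (Fin a) (Fin a) ℝ) (hA : IsUnit A.det) :
    (Fin a → ℝ) ≃L[ℝ] (Fin a → ℝ) :=
  ContinuousLinearEquiv.equivOfInverse (matCLM A) (matCLM A⁻¹)
    (fun x => by simp [Matrix.nonsing_inv_mul _ hA])
    (fun x => by simp [Matrix.mul_nonsing_inv _ hA])

namespace Mesh

variable {n p : ℕ} {Ω : Set (Fin (n + 1) → ℝ)} (M : Mesh n p Ω)

/-- The local coordinates of a point of the closed element `K`. -/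
def localCoord (K : M.Elem) (x : Fin (n + 1) → ℝ) : Fin (n + 1) → ℝ :=
  invFunOn (polyMap (M.psi K)) M.Kref.carrier x

theorem localCoord_psi (K : M.Elem) {ξ : Fin (n + 1) → ℝ} (hξ : ξ ∈ M.Kref.carrier) :
    M.localCoord K (polyMap (M.psi K) ξ) = ξ :=
  (M.psi_injOn K).leftInvOn_invFunOn hξ

theorem localCoord_mem {K : M.Elem} {x : Fin (n + 1) → ℝ} (hx : x ∈ M.closedElem K) :
    M.localCoord K x ∈ M.Kref.carrier := invFunOn_mem hx

theorem psi_localCoord {K : M.Elem} {x : Fin (n + 1) → ℝ} (hx : x ∈ M.closedElem K) :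
    polyMap (M.psi K) (M.localCoord K x) = x := invFunOn_eq hx

theorem localCoord_mem_facet {K : M.Elem} {j : M.Kref.Facet} {x : Fin (n + 1) → ℝ}
    (hx : x ∈ M.side K j) : M.localCoord K x ∈ M.Kref.facet j := by
  obtain ⟨ξ, hξ, rfl⟩ := hx
  rwa [M.localCoord_psi K hξ.1]

theorem side_subset (K : M.Elem) (j : M.Kref.Facet) : M.side K j ⊆ M.closedElem K :=
  image_mono fun _ h => h.1

theorem isUnit_det_psi (K : M.Elem) {ξ : Fin (n + 1) → ℝ} (hξ : ξ ∈ M.Kref.carrier) :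
    IsUnit (polyJac (M.psi K) ξ).det := (M.psi_nonsingular K ξ hξ).isUnit

/-- A continuous injection of a compact space into a Hausdorff space is a closed embedding, so its
inverse is continuous. -/
theorem continuousOn_localCoord (K : M.Elem) : ContinuousOn (M.localCoord K) (M.closedElem K) := by
  rw [continuousOn_iff_continuous_domRestrict]
  have : CompactSpace M.Kref.carrier := isCompact_iff_compactSpace.1 M.Kref.isCompact_carrier
  let e : M.Kref.carrier → (Fin (n + 1) → ℝ) := fun ξ => polyMap (M.psi K) ξ
  have he : Topology.IsClosedEmbedding e := by
    refine Continuous.isClosedEmbedding ((continuous_polyMap _).comp continuous_subtype_val) ?_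
    intro x y hxy
    exact Subtype.ext (M.psi_injOn K x.2 y.2 hxy)
  have : Continuous fun x : M.closedElem K =>
      (⟨M.localCoord K x, M.localCoord_mem x.2⟩ : M.Kref.carrier) := by
    rw [he.isEmbedding.continuous_iff]
    refine continuous_subtype_val.congr fun x => ?_
    exact (M.psi_localCoord x.2).symm
  exact continuous_subtype_val.comp this

theorem hasStrictFDerivAt_psi (K : M.Elem) {ξ : Fin (n + 1) → ℝ} (hξ : ξ ∈ M.Kref.carrier) :
    HasStrictFDerivAt (polyMap (M.psi K))
      (matEquiv _ (M.isUnit_det_psi K hξ) : (Fin (n + 1) → ℝ) →L[ℝ] (Fin (n + 1) → ℝ)) ξ :=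
  hasStrictFDerivAt_polyMap (M.psi K) ξ

/-- Continuity of the local coordinates makes them agree, near `x` within the closed element, with
the local inverse of the inverse function theorem. The derivative within the closed element is
needed because faces lie on its boundary. -/
theorem hasFDerivWithinAt_localCoord (K : M.Elem) {x : Fin (n + 1) → ℝ}
    (hx : x ∈ M.closedElem K) : HasFDerivWithinAt (M.localCoord K)
      (matCLM (polyJac (M.psi K) (M.localCoord K x))⁻¹) (M.closedElem K) x := by
  have hξ := M.localCoord_mem hx
  have hpsi := M.psi_localCoord hx
  have hs := M.hasStrictFDerivAt_psi K hξ
  have hinv := hs.to_localInverse.hasFDerivAt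
  rw [hpsi] at hinv
  refine (hinv.hasFDerivWithinAt (s := M.closedElem K)).congr_of_eventuallyEq ?_ ?_
  · have h1 := hs.eventually_left_inverse
    have h2 := (M.continuousOn_localCoord K x hx).eventually h1
    filter_upwards [h2, self_mem_nhdsWithin] with y hy hyK
    rw [M.psi_localCoord hyK] at hy
    exact hy.symm
  · have h3 := hs.localInverse_apply_image
    rw [hpsi] at h3
    exact h3.symm

theorem closedElem_mem_nhds {K : M.Elem} {x : Fin (n + 1) → ℝ} (hx : x ∈ M.elem K) :
    M.closedElem K ∈ nhds x := by
  obtain ⟨ξ, hξ, rfl⟩ := hx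
  rw [← (M.hasStrictFDerivAt_psi K (interior_subset hξ)).map_nhds_eq_of_equiv]
  exact Filter.image_mem_map (mem_interior_iff_mem_nhds.1 hξ)

theorem hasFDerivAt_localCoord (K : M.Elem) {x : Fin (n + 1) → ℝ}
    (hx : x ∈ M.elem K) : HasFDerivAt (M.localCoord K)
      (matCLM (polyJac (M.psi K) (M.localCoord K x))⁻¹) x :=
  (M.hasFDerivWithinAt_localCoord K (image_mono interior_subset hx)).hasFDerivAt
    (M.closedElem_mem_nhds hx)

/-- The derivative of the local coordinates along a face. -/
def faceJac (K : M.Elem) (F : M.Face) (s : Fin n → ℝ) : Matrix (Fin (n + 1)) (Fin n) ℝ :=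
  (polyJac (M.psi K) (M.localCoord K (polyMap (M.phi F) s)))⁻¹ * polyJac (M.phi F) s

section Face

variable {K : M.Elem} {j : M.Kref.Facet} {F : M.Face} (hF : M.face F ⊆ M.side K j)
  {s : Fin n → ℝ} (hs : s ∈ M.Fref.carrier)

include hF hs

theorem phi_mem_side : polyMap (M.phi F) s ∈ M.side K j := hF (mem_image_of_mem _ hs)

theorem phi_mem_closedElem : polyMap (M.phi F) s ∈ M.closedElem K :=
  M.side_subset K j (M.phi_mem_side hF hs)

theorem hasFDerivWithinAt_localCoord_phi :
    HasFDerivWithinAt (fun s => M.localCoord K (polyMap (M.phi F) s)) (matCLM (M.faceJac K F s))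
      M.Fref.carrier s := by
  have h1 := M.hasFDerivWithinAt_localCoord K (M.phi_mem_closedElem hF hs)
  have h2 := (hasStrictFDerivAt_polyMap (M.phi F) s).hasFDerivAt.hasFDerivWithinAt
    (s := M.Fref.carrier)
  refine (h1.comp s h2 fun t ht => M.phi_mem_closedElem hF ht).congr_fderiv ?_
  ext w : 1
  simp [faceJac, matCLM_apply]

/-- Along the face the local coordinates satisfy `N_j · ξ = c_j`. The derivative of this constant
vanishes, even at boundary points of the reference face, where derivatives within the convex solid
set are still unique. -/
theorem vecMul_faceJac : M.Kref.N j ᵥ* M.faceJac K F s = 0 := by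
  have h1 := M.hasFDerivWithinAt_localCoord_phi hF hs
  have h2 : HasFDerivWithinAt (fun s => M.Kref.N j ⬝ᵥ M.localCoord K (polyMap (M.phi F) s))
      ((∑ i, M.Kref.N j i • ContinuousLinearMap.proj (R := ℝ) (φ := fun _ : Fin (n + 1) => ℝ) i).comp
        (matCLM (M.faceJac K F s))) M.Fref.carrier s := by
    have h3 : HasFDerivAt (fun x : Fin (n + 1) → ℝ => M.Kref.N j ⬝ᵥ x)
        (∑ i, M.Kref.N j i • ContinuousLinearMap.proj (R := ℝ) (φ := fun _ : Fin (n + 1) => ℝ) i)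
        (M.localCoord K (polyMap (M.phi F) s)) := by
      simp only [dotProduct]
      exact HasFDerivAt.fun_sum fun i _ => (hasFDerivAt_apply i _).const_mul _
    exact HasFDerivAt.comp_hasFDerivWithinAt (g := fun x => M.Kref.N j ⬝ᵥ x) s h3 h1
  have h4 : HasFDerivWithinAt (fun s => M.Kref.N j ⬝ᵥ M.localCoord K (polyMap (M.phi F) s))
      (0 : (Fin n → ℝ) →L[ℝ] ℝ) M.Fref.carrier s := by
    refine (hasFDerivWithinAt_const (M.Kref.c j) s M.Fref.carrier).congr (fun t ht => ?_) ?_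
    · exact (M.localCoord_mem_facet (M.phi_mem_side hF ht)).2
    · exact (M.localCoord_mem_facet (M.phi_mem_side hF hs)).2
  have h5 := (M.Fref.uniqueDiffOn_carrier s hs).eq h2 h4
  ext i
  have h6 := congrArg (fun L : (Fin n → ℝ) →L[ℝ] ℝ => L (Pi.single i 1)) h5
  simpa [matCLM_apply, Matrix.vecMul, dotProduct] using h6

theorem psi_mul_faceJac : polyJac (M.psi K) (M.localCoord K (polyMap (M.phi F) s))
    * M.faceJac K F s = polyJac (M.phi F) s := by
  rw [faceJac, ← Matrix.mul_assoc, Matrix.mul_nonsing_inv _ (M.isUnit_det_psi K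
    (M.localCoord_mem (M.phi_mem_closedElem hF hs))), Matrix.one_mul]

theorem faceDet_ne_zero : (bordered (M.Kref.N j) (M.faceJac K F s)).det ≠ 0 := by
  refine det_bordered_ne_zero (M.Kref.unit j) (M.vecMul_faceJac hF hs) (M.isUnit_det_psi K
    (M.localCoord_mem (M.phi_mem_closedElem hF hs))) ?_
  rw [M.psi_mul_faceJac hF hs]
  exact M.phi_nonsingular F s hs

theorem conormal_ne_zero : M.conormal K j (polyMap (M.phi F) s) ≠ 0 := by
  intro h
  have h1 := congrArg (fun z => (polyJac (M.psi K) (M.localCoord K (polyMap (M.phi F) s)))ᵀ *ᵥ z) h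
  simp only [conormal, Matrix.mulVec_zero, Matrix.mulVec_mulVec] at h1
  change ((polyJac (M.psi K) (M.localCoord K (polyMap (M.phi F) s)))ᵀ *
    ((polyJac (M.psi K) (M.localCoord K (polyMap (M.phi F) s)))⁻¹)ᵀ) *ᵥ _ = 0 at h1
  rw [← Matrix.transpose_mul, Matrix.nonsing_inv_mul _ (M.isUnit_det_psi K
    (M.localCoord_mem (M.phi_mem_closedElem hF hs))), Matrix.transpose_one, Matrix.one_mulVec] at h1
  have h2 := M.Kref.unit j
  rw [h1] at h2
  simp at h2

/-- The oriented surface element in local coordinates. -/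
theorem normal_dotProduct_mul_surfElem (g : Fin (n + 1) → ℝ) :
    (M.normal K j (polyMap (M.phi F) s) ⬝ᵥ g) * M.surfElem F s
      = |(polyJac (M.psi K) (M.localCoord K (polyMap (M.phi F) s))).det|
        * (M.conormal K j (polyMap (M.phi F) s) ⬝ᵥ g)
        * |(bordered (M.Kref.N j) (M.faceJac K F s)).det| := by
  have hJ := M.isUnit_det_psi K (M.localCoord_mem (M.phi_mem_closedElem hF hs))
  have h0 : ((polyJac (M.psi K) (M.localCoord K (polyMap (M.phi F) s)) * M.faceJac K F s)ᵀ
      * (polyJac (M.psi K) (M.localCoord K (polyMap (M.phi F) s)) * M.faceJac K F s)).det ≠ 0 := by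
    rw [M.psi_mul_faceJac hF hs]
    exact M.phi_nonsingular F s hs
  -- This makes the surface element the length of the conormal times the two determinants; the
  -- length then cancels the normalization in `normal`.
  have h := det_gram_mul (M.Kref.unit j) (M.vecMul_faceJac hF hs) hJ h0
  rw [M.psi_mul_faceJac hF hs] at h
  change _ = (M.conormal K j (polyMap (M.phi F) s) ⬝ᵥ M.conormal K j (polyMap (M.phi F) s))
    * _ at h
  have hq := dotProduct_self_pos (M.conormal_ne_zero hF hs)
  have hq' := (Real.sqrt_pos.2 hq).ne'
  rw [surfElem, h, Real.sqrt_mul hq.le, Real.sqrt_sq_eq_abs, abs_mul, normal, smul_dotProduct,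
    smul_eq_mul]
  field_simp

end Face

open Classical in
/-- The change of variables from a facet of the reference element to the faces that cover the
corresponding side of `K`. -/
theorem integral_facet (K : M.Elem) (j : M.Kref.Facet) (l : Fin (n + 1))
    (hj : M.Kref.N j l ≠ 0) {h : (Fin (n + 1) → ℝ) → ℝ} (hh : ContinuousOn h M.Kref.carrier) :
    ∫ y in (fun x : Fin (n + 1) → ℝ => (l.removeNth x : Fin n → ℝ)) '' M.Kref.facet j,
        h (l.insertNth (M.Kref.height l j y) y)
      = ∑ F, if M.face F ⊆ M.side K j then |M.Kref.N j l| * ∫ s in M.Fref.carrier,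
          h (M.localCoord K (polyMap (M.phi F) s))
            * |(bordered (M.Kref.N j) (M.faceJac K F s)).det| else 0 := by
  set proj := fun x : Fin (n + 1) → ℝ => (l.removeNth x : Fin n → ℝ) with hproj
  have hprojc : Continuous proj := continuous_pi fun i => continuous_apply _
  let T : M.Face → (Fin n → ℝ) → (Fin n → ℝ) := fun F s =>
    proj (M.localCoord K (polyMap (M.phi F) s))
  let I := {F : M.Face // M.face F ⊆ M.side K j}
  have hderiv : ∀ F : I, ∀ s ∈ M.Fref.carrier, HasFDerivWithinAt (T F)
      (matCLM ((M.faceJac K F s).submatrix l.succAbove id)) M.Fref.carrier s := by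
    intro F s hs
    have h1 := M.hasFDerivWithinAt_localCoord_phi F.2 hs
    rw [hasFDerivWithinAt_pi'] at h1 ⊢
    intro i
    exact h1 (l.succAbove i)
  have hprojinj : InjOn proj (M.Kref.facet j) := by
    intro x hx y hy hxy
    rw [← M.Kref.insertNth_height_removeNth l hj hx.2,
      ← M.Kref.insertNth_height_removeNth l hj hy.2]
    exact congrArg (fun z => (l.insertNth (M.Kref.height l j z) z : Fin (n + 1) → ℝ)) hxy
  -- The projection is injective on the facet, so equal projections come from one and the same
  -- physical point.
  have hTeq : ∀ F G : I, ∀ s ∈ M.Fref.carrier, ∀ t ∈ M.Fref.carrier, T F s = T G t →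
      polyMap (M.phi F) s = polyMap (M.phi G) t := by
    intro F G s hs t ht hst
    have h1 := hprojinj (M.localCoord_mem_facet (M.phi_mem_side F.2 hs))
      (M.localCoord_mem_facet (M.phi_mem_side G.2 ht)) hst
    rw [← M.psi_localCoord (M.phi_mem_closedElem F.2 hs),
      ← M.psi_localCoord (M.phi_mem_closedElem G.2 ht), h1]
  have hTinj : ∀ F : I, InjOn (T F) M.Fref.carrier := fun F s hs t ht hst =>
    M.phi_injOn F hs ht (hTeq F F s hs t ht hst)
  have hcover : proj '' M.Kref.facet j = ⋃ F : I, T F '' M.Fref.carrier := by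
    ext y
    simp only [mem_iUnion]
    constructor
    · rintro ⟨ξ, hξ, rfl⟩
      have h1 := M.side_cover K j (mem_image_of_mem _ hξ)
      simp only [mem_iUnion] at h1
      obtain ⟨F, hF, s, hs, hsx⟩ := h1
      refine ⟨⟨F, hF⟩, s, hs, ?_⟩
      simp only [T]
      rw [hsx, M.localCoord_psi K hξ.1]
    · rintro ⟨F, s, hs, rfl⟩
      exact mem_image_of_mem _ (M.localCoord_mem_facet (M.phi_mem_side F.2 hs))
  have hTcont : ∀ F : I, ContinuousOn (T F) M.Fref.carrier := fun F s hs =>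
    (hderiv F s hs).continuousWithinAt
  have hmeas : ∀ F : I, NullMeasurableSet (T F '' M.Fref.carrier) volume := fun F =>
    (M.Fref.isCompact_carrier.image_of_continuousOn (hTcont F)).measurableSet.nullMeasurableSet
  have hfr : frontier M.Fref.carrier ⊆ M.Fref.carrier := M.Fref.isClosed_carrier.frontier_subset
  -- The frontier of a convex set is null, and differentiable maps between spaces of equal dimension
  -- preserve null sets.
  have hnull : ∀ F : I, volume (T F '' frontier M.Fref.carrier) = 0 := by
    intro F
    refine addHaar_image_eq_zero_of_differentiableOn_of_addHaar_eq_zero volume ?_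
      (M.Fref.convex_carrier.addHaar_frontier volume)
    exact fun s hs => ((hderiv F s (hfr hs)).mono hfr).differentiableWithinAt
  -- Open faces are disjoint, so two images can overlap only where one of the points comes from the
  -- frontier of the reference face.
  have hdisj : Pairwise (AEDisjoint volume on fun F : I => T F '' M.Fref.carrier) := by
    intro F G hFG
    refine measure_mono_null ?_ (measure_union_null (hnull F) (hnull G))
    rintro y ⟨⟨s, hs, rfl⟩, t, ht, hst⟩
    by_cases hs' : s ∈ interior M.Fref.carrier
    · by_cases ht' : t ∈ interior M.Fref.carrier
      · exfalso
        refine disjoint_left.1 (M.face_disjoint F G fun h => hFG (Subtype.ext h))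
          (mem_image_of_mem _ hs') ?_
        rw [← hTeq G F t ht s hs hst]
        exact mem_image_of_mem _ ht'
      · right
        exact ⟨t, ⟨subset_closure ht, ht'⟩, hst⟩
    · left
      exact ⟨s, ⟨subset_closure hs, hs'⟩, rfl⟩
  have hint : IntegrableOn (fun y => h (l.insertNth (M.Kref.height l j y) y))
      (⋃ F : I, T F '' M.Fref.carrier) volume := by
    rw [← hcover]
    exact (hh.comp (M.Kref.continuous_insertNth_height l j).continuousOn fun y hy =>
      (M.Kref.mem_image_facet_iff l hj).1 hy).integrableOn_compact
      ((M.Kref.isCompact_facet j).image hprojc)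
  rw [hcover, integral_iUnion_ae hmeas hdisj hint, tsum_fintype, ← Finset.sum_filter,
    Finset.sum_subtype (Finset.univ.filter fun F => M.face F ⊆ M.side K j)
      (p := fun F => M.face F ⊆ M.side K j) (by simp)]
  refine Finset.sum_congr rfl fun F _ => ?_
  rw [integral_image_eq_integral_abs_det_fderiv_smul volume M.Fref.measurableSet_carrier
    (hderiv F) (hTinj F), ← integral_const_mul]
  refine setIntegral_congr_fun M.Fref.measurableSet_carrier fun s hs => ?_
  simp only [smul_eq_mul]
  -- The Jacobian of the projected parametrization is the minor of `faceJac` with row `l` deleted.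
  rw [det_matCLM, abs_det_minor (M.Kref.unit j) (M.vecMul_faceJac F.2 hs)
    (M.faceDet_ne_zero F.2 hs), M.Kref.insertNth_height_removeNth l hj
      (M.localCoord_mem_facet (M.phi_mem_side F.2 hs)).2]
  ring

end Mesh

/-! ### The divergence theorem on curved elements -/

namespace Mesh

variable {n p : ℕ} {Ω : Set (Fin (n + 1) → ℝ)} (M : Mesh n p Ω)

/-- The cofactor matrix of an element mapping has polynomial entries. -/
theorem eval_adjugate (K : M.Elem) (ξ : Fin (n + 1) → ℝ) (m l : Fin (n + 1)) :
    MvPolynomial.eval ξ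
      ((Matrix.of fun i j => MvPolynomial.pderiv j (M.psi K i)).adjugate m l)
      = (polyJac (M.psi K) ξ).adjugate m l := by
  have h := RingHom.map_adjugate (MvPolynomial.eval ξ)
    (Matrix.of fun i j => MvPolynomial.pderiv j (M.psi K i))
  have h2 := congrFun (congrFun h m) l
  exact h2

/-- A nonvanishing continuous function on a convex set has constant sign. The absolute value in the
change of variables can thus be replaced by a constant factor, which keeps the integrand polynomial
in the cofactors. -/
theorem exists_sign_det (K : M.Elem) : ∃ σ : ℝ, ∀ ξ ∈ M.Kref.carrier,
    |(polyJac (M.psi K) ξ).det| = σ * (polyJac (M.psi K) ξ).det := by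
  have hc : ContinuousOn (fun ξ => (polyJac (M.psi K) ξ).det) M.Kref.carrier :=
    (continuous_polyJac (M.psi K)).matrix_det.continuousOn
  by_cases h : ∀ ξ ∈ M.Kref.carrier, 0 < (polyJac (M.psi K) ξ).det
  · exact ⟨1, fun ξ hξ => by rw [abs_of_pos (h ξ hξ), one_mul]⟩
  · push Not at h
    obtain ⟨a, ha, ha0⟩ := h
    refine ⟨-1, fun ξ hξ => ?_⟩
    have : (polyJac (M.psi K) ξ).det ≤ 0 := by
      by_contra! hpos
      obtain ⟨z, hz, hz0⟩ := M.Kref.convex_carrier.isPreconnected.intermediate_value ha hξ hc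
        ⟨ha0, hpos.le⟩
      exact M.psi_nonsingular K z hz hz0
    rw [abs_of_nonpos this]
    ring

theorem integral_elem (K : M.Elem) (φ : (Fin (n + 1) → ℝ) → ℝ) :
    ∫ x in M.elem K, φ x = ∫ ξ in M.Kref.carrier,
      |(polyJac (M.psi K) ξ).det| * φ (polyMap (M.psi K) ξ) := by
  rw [elem, integral_image_eq_integral_abs_det_fderiv_smul volume isOpen_interior.measurableSet
    (fun ξ _ => (hasStrictFDerivAt_polyMap (M.psi K) ξ).hasFDerivAt.hasFDerivWithinAt)
    ((M.psi_injOn K).mono interior_subset),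
    setIntegral_congr_set M.Kref.interior_carrier_ae_eq]
  simp only [smul_eq_mul, det_matCLM]

open Classical in
/-- The divergence theorem on a curved element. The vector field `g` is given in local
coordinates, and `φ` is its divergence. -/
theorem integral_divergence_elem (hn : n + 1 ≤ 3) (K : M.Elem)
    {g : Fin (n + 1) → (Fin (n + 1) → ℝ) → ℝ}
    {g' : Fin (n + 1) → (Fin (n + 1) → ℝ) → (Fin (n + 1) → ℝ) →L[ℝ] ℝ}
    (hg : ∀ l, ∀ ξ ∈ M.Kref.carrier, HasFDerivAt (g l) (g' l ξ) ξ)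
    (hg' : ∀ l m, ContinuousOn (fun ξ => g' l ξ (Pi.single m 1)) M.Kref.carrier)
    {φ : (Fin (n + 1) → ℝ) → ℝ}
    (hφ : ∀ ξ ∈ interior M.Kref.carrier, (polyJac (M.psi K) ξ).det * φ (polyMap (M.psi K) ξ)
      = ∑ m, ∑ l, (polyJac (M.psi K) ξ).adjugate m l * g' l ξ (Pi.single m 1)) :
    ∫ x in M.elem K, φ x = ∑ j, ∑ F, if M.face F ⊆ M.side K j then
      M.faceInt F (fun x => M.normal K j x ⬝ᵥ fun l => g l (M.localCoord K x)) else 0 := by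
  obtain ⟨σ, hσ⟩ := M.exists_sign_det K
  set A := (Matrix.of fun i j => MvPolynomial.pderiv j (M.psi K i)).adjugate with hA
  have hAe : ∀ ξ m l, MvPolynomial.eval ξ (A m l) = (polyJac (M.psi K) ξ).adjugate m l :=
    fun ξ m l => M.eval_adjugate K ξ m l
  -- The Piola transform `adj(Dψ) g`: its divergence on the reference element is `det(Dψ)` times the
  -- divergence of the physical field.
  let f : Fin (n + 1) → (Fin (n + 1) → ℝ) → ℝ := fun m ξ =>
    ∑ l, MvPolynomial.eval ξ (A m l) * g l ξ
  let f' : Fin (n + 1) → (Fin (n + 1) → ℝ) → (Fin (n + 1) → ℝ) →L[ℝ] ℝ := fun m ξ =>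
    ∑ l, (MvPolynomial.eval ξ (A m l) • g' l ξ
      + g l ξ • ∑ i, MvPolynomial.eval ξ (MvPolynomial.pderiv i (A m l)) •
        ContinuousLinearMap.proj (R := ℝ) (φ := fun _ : Fin (n + 1) => ℝ) i)
  have hf : ∀ m, ∀ ξ ∈ M.Kref.carrier, HasFDerivAt (f m) (f' m ξ) ξ := fun m ξ hξ =>
    HasFDerivAt.fun_sum fun l _ =>
      (hasStrictFDerivAt_eval (A m l) ξ).hasFDerivAt.fun_mul (hg l ξ hξ)
  have hgc : ∀ l, ContinuousOn (g l) M.Kref.carrier := fun l ξ hξ =>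
    (hg l ξ hξ).continuousAt.continuousWithinAt
  have hf'e : ∀ m ξ, f' m ξ (Pi.single m 1) = ∑ l, (MvPolynomial.eval ξ (A m l)
      * g' l ξ (Pi.single m 1) + g l ξ * MvPolynomial.eval ξ (MvPolynomial.pderiv m (A m l))) := by
    intro m ξ
    simp [f', Pi.single_apply]
  have hf'c : ∀ m, ContinuousOn (fun ξ => f' m ξ (Pi.single m 1)) M.Kref.carrier := by
    intro m
    simp only [hf'e]
    exact continuousOn_finsetSum _ fun l _ =>
      ((continuous_eval _).continuousOn.mul (hg' l m)).add
        ((hgc l).mul (continuous_eval _).continuousOn)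
  -- By the Piola identity, the terms in which the derivative falls on the cofactors drop out.
  have hdiv : ∀ ξ, ∑ m, f' m ξ (Pi.single m 1)
      = ∑ m, ∑ l, MvPolynomial.eval ξ (A m l) * g' l ξ (Pi.single m 1) := by
    intro ξ
    simp only [hf'e, Finset.sum_add_distrib, add_eq_left]
    rw [Finset.sum_comm]
    refine Finset.sum_eq_zero fun l _ => ?_
    rw [← Finset.mul_sum, ← map_sum, piola hn (M.psi K) l, map_zero, mul_zero]
  have h1 : ∫ x in M.elem K, φ x = σ * ∑ m, ∫ ξ in M.Kref.carrier, f' m ξ (Pi.single m 1) := by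
    rw [M.integral_elem K, ← integral_finsetSum _ fun m _ =>
      (hf'c m).integrableOn_compact M.Kref.isCompact_carrier, ← integral_const_mul,
      ← setIntegral_congr_set M.Kref.interior_carrier_ae_eq,
      ← setIntegral_congr_set M.Kref.interior_carrier_ae_eq]
    refine setIntegral_congr_fun isOpen_interior.measurableSet fun ξ hξ => ?_
    rw [hdiv, hσ ξ (interior_subset hξ), mul_assoc, hφ ξ hξ]
    simp only [hAe]
  have hfc : ∀ m, ContinuousOn (f m) M.Kref.carrier := fun m ξ hξ =>
    (hf m ξ hξ).continuousAt.continuousWithinAt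
  have hsum : ∀ m, ∫ ξ in M.Kref.carrier, f' m ξ (Pi.single m 1)
      = ∑ j, ∑ F, if M.face F ⊆ M.side K j then ∫ s in M.Fref.carrier, M.Kref.N j m *
          f m (M.localCoord K (polyMap (M.phi F) s))
            * |(bordered (M.Kref.N j) (M.faceJac K F s)).det| else 0 := by
    intro m
    rw [M.Kref.integral_partial_deriv m (hf m) (hf'c m)]
    refine Finset.sum_congr rfl fun j _ => ?_
    by_cases hj : M.Kref.N j m = 0
    · simp [hj]
    rw [M.integral_facet K j m hj (hfc m), Finset.mul_sum]
    refine Finset.sum_congr rfl fun F _ => ?_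
    split_ifs
    · rw [← mul_assoc, ← integral_const_mul]
      congr 1
      ext s
      have : Real.sign (M.Kref.N j m) * |M.Kref.N j m| = M.Kref.N j m := by
        rcases lt_or_gt_of_ne hj with h | h
        · rw [Real.sign_of_neg h, abs_of_neg h]; ring
        · rw [Real.sign_of_pos h, abs_of_pos h]; ring
      rw [this]
      ring
    · simp
  rw [h1]
  simp only [hsum]
  rw [Finset.sum_comm, Finset.mul_sum]
  refine Finset.sum_congr rfl fun j _ => ?_
  rw [Finset.sum_comm, Finset.mul_sum]
  refine Finset.sum_congr rfl fun F _ => ?_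
  split_ifs with hF
  · have hcoord : ContinuousOn (fun s => M.localCoord K (polyMap (M.phi F) s)) M.Fref.carrier :=
      fun s hs => (M.hasFDerivWithinAt_localCoord_phi hF hs).continuousWithinAt
    have hBc : ContinuousOn (fun s => |(bordered (M.Kref.N j) (M.faceJac K F s)).det|)
        M.Fref.carrier := by
      rw [continuousOn_iff_continuous_domRestrict] at hcoord ⊢
      have hJinv : Continuous fun s : M.Fref.carrier =>
          (polyJac (M.psi K) (M.localCoord K (polyMap (M.phi F) s)))⁻¹ :=
        continuous_matrix_inv ((continuous_polyJac (M.psi K)).comp hcoord) fun s =>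
          M.isUnit_det_psi K (M.localCoord_mem (M.phi_mem_closedElem hF s.2))
      have hB : Continuous fun s : M.Fref.carrier => M.faceJac K F s :=
        hJinv.matrix_mul ((continuous_polyJac (M.phi F)).comp continuous_subtype_val)
      refine (Continuous.matrix_det ?_).abs
      refine continuous_matrix fun i k => ?_
      refine Fin.cases ?_ (fun k' => ?_) k
      · exact continuous_const
      · exact hB.matrix_elem i k'
    have hint : ∀ m, IntegrableOn (fun s => M.Kref.N j m *
          f m (M.localCoord K (polyMap (M.phi F) s))
            * |(bordered (M.Kref.N j) (M.faceJac K F s)).det|) M.Fref.carrier := fun m =>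
      ((continuousOn_const.mul ((hfc m).comp hcoord fun s hs =>
        M.localCoord_mem (M.phi_mem_closedElem hF hs))).mul hBc).integrableOn_compact
        M.Fref.isCompact_carrier
    rw [← integral_finsetSum _ fun m _ => hint m, ← integral_const_mul, faceInt]
    refine setIntegral_congr_fun M.Fref.measurableSet_carrier fun s hs => ?_
    have hξ := M.localCoord_mem (M.phi_mem_closedElem hF hs)
    have hJ := M.isUnit_det_psi K hξ
    rw [M.normal_dotProduct_mul_surfElem hF hs, hσ _ hξ, ← Finset.sum_mul, mul_assoc, mul_assoc,
      ← mul_assoc (Matrix.det _)]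
    congr 2
    set J := polyJac (M.psi K) (M.localCoord K (polyMap (M.phi F) s)) with hJdef
    have hcon : M.conormal K j (polyMap (M.phi F) s) = (J⁻¹)ᵀ *ᵥ M.Kref.N j := rfl
    -- This turns the flux of the Piola transform through the reference facet into `det J` times the
    -- conormal component of `g`.
    have hadj : J.adjugate = J.det • J⁻¹ := by
      rw [Matrix.inv_def, smul_smul, Ring.mul_inverse_cancel _ hJ, one_smul]
    have hfm : ∀ m, f m (M.localCoord K (polyMap (M.phi F) s))
        = (J.adjugate *ᵥ fun l => g l (M.localCoord K (polyMap (M.phi F) s))) m := by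
      intro m
      simp only [f, hAe, Matrix.mulVec, dotProduct, J]
    have hdot : ∑ m, M.Kref.N j m * f m (M.localCoord K (polyMap (M.phi F) s))
        = M.Kref.N j ⬝ᵥ (J.adjugate *ᵥ fun l => g l (M.localCoord K (polyMap (M.phi F) s))) := by
      simp only [hfm]
      rfl
    rw [hdot, hcon, hadj, Matrix.smul_mulVec, dotProduct_smul, smul_eq_mul,
      Matrix.mulVec_transpose, Matrix.dotProduct_mulVec]
  · simp

end Mesh

/-! ### Opposite normals on interior faces -/

/-- The range of `C` is a hyperplane. Bordered determinants give `(ν'·ν)² = 1`, and then `ν' - ν` or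
`ν' + ν` has length zero. -/
theorem eq_neg_or_eq_of_vecMul_eq_zero {n : ℕ} {ν ν' : Fin (n + 1) → ℝ}
    {C : Matrix (Fin (n + 1)) (Fin n) ℝ} (hC : (Cᵀ * C).det ≠ 0) (h1 : ν ⬝ᵥ ν = 1)
    (h1' : ν' ⬝ᵥ ν' = 1) (h2 : ν ᵥ* C = 0) (h2' : ν' ᵥ* C = 0) : ν' = -ν ∨ ν' = ν := by
  have e1 := det_bordered_sq h1 h2
  have e2 := det_bordered_sq h1' h2'
  have e3 := det_bordered_mul ν' ν C C h2
  have e4 : (ν' ⬝ᵥ ν) ^ 2 * (Cᵀ * C).det ^ 2 = 1 * (Cᵀ * C).det ^ 2 := by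
    rw [← mul_pow, ← e3, mul_pow, e1, e2]; ring
  have e5 : (ν' ⬝ᵥ ν) ^ 2 = 1 := mul_right_cancel₀ (pow_ne_zero 2 hC) e4
  rcases mul_self_eq_one_iff.1 ((sq _).symm.trans e5) with h | h
  · right
    have : (ν' - ν) ⬝ᵥ (ν' - ν) = 0 := by
      rw [sub_dotProduct, dotProduct_sub, dotProduct_sub, h1, h1', dotProduct_comm ν ν', h]; ring
    exact sub_eq_zero.1 (dotProduct_self_eq_zero.1 this)
  · left
    have : (ν' + ν) ⬝ᵥ (ν' + ν) = 0 := by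
      rw [add_dotProduct, dotProduct_add, dotProduct_add, h1, h1', dotProduct_comm ν ν', h]; ring
    exact eq_neg_of_add_eq_zero_left (dotProduct_self_eq_zero.1 this)

theorem eventually_lt_of_hasDerivAt_neg {h : ℝ → ℝ} {h' : ℝ} (hd : HasDerivAt h h' 0)
    (hneg : h' < 0) : ∀ᶠ r in nhdsWithin (0 : ℝ) (Ioi 0), h r < h 0 := by
  have h1 := hd.tendsto_slope_zero_right.eventually_lt_const hneg
  filter_upwards [h1, self_mem_nhdsWithin] with r hr hr0
  rw [zero_add, smul_eq_mul] at hr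
  have hr0' : 0 < r := hr0
  by_contra! hcon
  exact absurd hr (not_lt.2 (mul_nonneg (inv_pos.2 hr0').le (sub_nonneg.2 hcon)))

namespace Mesh

variable {n p : ℕ} {Ω : Set (Fin (n + 1) → ℝ)} (M : Mesh n p Ω)

/-- Almost no point of a face lies on a further side of an adjacent element. -/
theorem ae_localCoord_lt {K : M.Elem} {j : M.Kref.Facet} {F : M.Face}
    (hF : M.face F ⊆ M.side K j) : ∀ᵐ s ∂volume.restrict M.Fref.carrier, ∀ i, i ≠ j →
      M.Kref.N i ⬝ᵥ M.localCoord K (polyMap (M.phi F) s) < M.Kref.c i := by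
  rw [ae_all_iff]
  intro i
  by_cases hij : i = j
  · simp [hij]
  obtain ⟨l, hl⟩ : ∃ l, M.Kref.N j l ≠ 0 := by
    by_contra! h
    have h1 := M.Kref.unit j
    rw [show M.Kref.N j = 0 from funext h] at h1
    simp at h1
  -- The projected parametrization `T` is injective on `Z` with nonvanishing Jacobian, and it maps
  -- `Z` into the null overlap of two facets. The change of variables formula then forces `Z` to be
  -- null.
  set Z := {s ∈ M.Fref.carrier |
    M.Kref.N i ⬝ᵥ M.localCoord K (polyMap (M.phi F) s) = M.Kref.c i} with hZ
  have hZsub : Z ⊆ M.Fref.carrier := sep_subset _ _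
  have hcoord : ContinuousOn (fun s => M.localCoord K (polyMap (M.phi F) s)) M.Fref.carrier :=
      fun s hs => (M.hasFDerivWithinAt_localCoord_phi hF hs).continuousWithinAt
  have hZm : MeasurableSet Z := by
    have : ContinuousOn (fun s => M.Kref.N i ⬝ᵥ M.localCoord K (polyMap (M.phi F) s))
      M.Fref.carrier := (continuous_const.dotProduct continuous_id).comp_continuousOn hcoord
    exact (this.preimage_isClosed_of_isClosed M.Fref.isClosed_carrier
      isClosed_singleton (t := {M.Kref.c i})).measurableSet
  let T : (Fin n → ℝ) → (Fin n → ℝ) := fun s =>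
    (l.removeNth (M.localCoord K (polyMap (M.phi F) s)) : Fin n → ℝ)
  have hderiv : ∀ s ∈ Z, HasFDerivWithinAt T
      (matCLM ((M.faceJac K F s).submatrix l.succAbove id)) Z s := by
    intro s hs
    have h1 := (M.hasFDerivWithinAt_localCoord_phi hF hs.1).mono hZsub
    rw [hasFDerivWithinAt_pi'] at h1 ⊢
    intro i
    exact h1 (l.succAbove i)
  have hTinj : InjOn T Z := by
    intro s hs t ht hst
    have h1 := M.Kref.insertNth_height_removeNth l hl
      (M.localCoord_mem_facet (M.phi_mem_side hF hs.1)).2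
    have h2 := M.Kref.insertNth_height_removeNth l hl
      (M.localCoord_mem_facet (M.phi_mem_side hF ht.1)).2
    have hst' : l.removeNth (M.localCoord K (polyMap (M.phi F) s))
      = l.removeNth (M.localCoord K (polyMap (M.phi F) t)) := hst
    rw [hst', h2] at h1
    refine M.phi_injOn F hs.1 ht.1 ?_
    rw [← M.psi_localCoord (M.phi_mem_closedElem hF hs.1),
      ← M.psi_localCoord (M.phi_mem_closedElem hF ht.1), h1]
  have himg : volume (T '' Z) = 0 := by
    refine measure_mono_null ?_ (M.Kref.volume_facet_inter l hij hl)
    rintro _ ⟨s, hs, rfl⟩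
    rw [mem_ofPred_eq]
    simp only [T]
    rw [M.Kref.insertNth_height_removeNth l hl
      (M.localCoord_mem_facet (M.phi_mem_side hF hs.1)).2]
    exact hs.2
  rw [← lintegral_abs_det_fderiv_eq_addHaar_image volume hZm hderiv hTinj,
    lintegral_eq_zero_iff' (aemeasurable_ofReal_abs_det_fderivWithin volume hZm hderiv)] at himg
  have hZ0 : volume Z = 0 := by
    rw [Filter.EventuallyEq, ae_restrict_iff' hZm] at himg
    refine measure_eq_zero_iff_ae_notMem.2 (himg.mono fun s hs hsZ => ?_)
    have h1 := hs hsZ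
    rw [det_matCLM, abs_det_minor (M.Kref.unit j) (M.vecMul_faceJac hF hsZ.1)
      (M.faceDet_ne_zero hF hsZ.1), Pi.zero_apply, ENNReal.ofReal_eq_zero] at h1
    exact absurd h1 (not_le.2 (mul_pos (abs_pos.2 hl) (abs_pos.2 (M.faceDet_ne_zero hF hsZ.1))))
  rw [ae_restrict_iff' M.Fref.measurableSet_carrier]
  refine (measure_eq_zero_iff_ae_notMem.1 hZ0).mono fun s hs hsF _ => ?_
  refine lt_of_le_of_ne (M.localCoord_mem (M.phi_mem_closedElem hF hsF) i) fun h => hs ⟨hsF, h⟩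

section Face

variable {K : M.Elem} {j : M.Kref.Facet} {F : M.Face} (hF : M.face F ⊆ M.side K j)
  {s : Fin n → ℝ} (hs : s ∈ M.Fref.carrier)

include hF hs

theorem normal_unit : M.normal K j (polyMap (M.phi F) s) ⬝ᵥ M.normal K j (polyMap (M.phi F) s)
    = 1 := by
  have hq := dotProduct_self_pos (M.conormal_ne_zero hF hs)
  rw [normal, smul_dotProduct, dotProduct_smul, smul_eq_mul, smul_eq_mul, ← mul_assoc,
    ← mul_inv, Real.mul_self_sqrt hq.le, inv_mul_cancel₀ hq.ne']

theorem vecMul_normal : M.normal K j (polyMap (M.phi F) s) ᵥ* polyJac (M.phi F) s = 0 := by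
  rw [normal, Matrix.smul_vecMul, conormal, Matrix.mulVec_transpose, Matrix.vecMul_vecMul]
  have := M.vecMul_faceJac hF hs
  rw [faceJac] at this
  change _ • M.Kref.N j ᵥ* ((polyJac (M.psi K) (M.localCoord K (polyMap (M.phi F) s)))⁻¹ * _) = 0
  rw [this, smul_zero]

/-- Points slightly behind a side lie in the element. -/
theorem eventually_sub_normal_mem (hlt : ∀ i, i ≠ j →
      M.Kref.N i ⬝ᵥ M.localCoord K (polyMap (M.phi F) s) < M.Kref.c i) :
    ∀ᶠ r in nhdsWithin (0 : ℝ) (Ioi 0),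
      polyMap (M.phi F) s - r • M.normal K j (polyMap (M.phi F) s) ∈ M.elem K := by
  set x := polyMap (M.phi F) s with hx
  set ν := M.normal K j x with hν
  have hxK := M.phi_mem_closedElem hF hs
  have hξ := M.localCoord_mem hxK
  have hpsi := M.psi_localCoord hxK
  have hst := M.hasStrictFDerivAt_psi K hξ
  have hinv := hst.to_localInverse.hasFDerivAt
  have hright := hst.eventually_right_inverse
  have happ := hst.localInverse_apply_image
  set G := hst.localInverse _ _ _ with hG
  change polyMap (M.psi K) (M.localCoord K x) = x at hpsi
  rw [hpsi] at hinv hright happ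
  have hline : HasDerivAt (fun r : ℝ => x - r • ν) (-ν) 0 := by
    simpa using ((hasDerivAt_id (0 : ℝ)).smul_const ν).const_sub x
  have hline0 : x - (0 : ℝ) • ν = x := by simp
  have hlinec : Filter.Tendsto (fun r : ℝ => x - r • ν) (nhdsWithin 0 (Ioi 0)) (nhds x) := by
    have := hline.continuousAt.tendsto
    rw [hline0] at this
    exact this.mono_left nhdsWithin_le_nhds
  have hGd : HasDerivAt (fun r : ℝ => G (x - r • ν))
      ((polyJac (M.psi K) (M.localCoord K x))⁻¹ *ᵥ (-ν)) 0 :=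
    hinv.comp_hasDerivAt_of_eq (0 : ℝ) hline hline0.symm
  have hNd := hasDerivAt_dotProduct (hasDerivAt_const (0 : ℝ) (M.Kref.N j)) hGd
  -- Moving against the normal decreases `N_j · ξ` at the rate of the length of the conormal. The
  -- constraints of the other facets are strict and persist by continuity.
  have hneg : M.Kref.N j ⬝ᵥ ((polyJac (M.psi K) (M.localCoord K x))⁻¹ *ᵥ (-ν)) < 0 := by
    rw [Matrix.dotProduct_mulVec, ← Matrix.mulVec_transpose, dotProduct_neg, neg_lt_zero]
    change 0 < M.conormal K j x ⬝ᵥ ν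
    have hq := dotProduct_self_pos (M.conormal_ne_zero hF hs)
    rw [hν, normal, dotProduct_smul, smul_eq_mul]
    exact mul_pos (inv_pos.2 (Real.sqrt_pos.2 hq)) hq
  rw [zero_dotProduct, zero_add] at hNd
  have hlt_j := eventually_lt_of_hasDerivAt_neg hNd hneg
  simp only [hline0, happ] at hlt_j
  have hfac : M.Kref.N j ⬝ᵥ M.localCoord K x = M.Kref.c j :=
    (M.localCoord_mem_facet (M.phi_mem_side hF hs)).2
  rw [hfac] at hlt_j
  have hGc : Filter.Tendsto (fun r : ℝ => G (x - r • ν)) (nhdsWithin 0 (Ioi 0))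
      (nhds (M.localCoord K x)) := by
    have := hGd.continuousAt.tendsto
    rw [hline0, happ] at this
    exact this.mono_left nhdsWithin_le_nhds
  have hlt_i : ∀ᶠ r in nhdsWithin (0 : ℝ) (Ioi 0), ∀ i, i ≠ j →
      M.Kref.N i ⬝ᵥ G (x - r • ν) < M.Kref.c i := by
    rw [Filter.eventually_all]
    intro i
    by_cases hij : i = j
    · simp [hij]
    have h1 : Filter.Tendsto (fun r : ℝ => M.Kref.N i ⬝ᵥ G (x - r • ν))
        (nhdsWithin 0 (Ioi 0)) (nhds (M.Kref.N i ⬝ᵥ M.localCoord K x)) :=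
      ((continuous_const.dotProduct continuous_id).tendsto (M.localCoord K x)).comp hGc
    exact (h1.eventually_lt_const (hlt i hij)).mono fun _ h _ => h
  filter_upwards [hlt_j, hlt_i, hlinec.eventually hright] with r h1 h2 h3
  rw [← h3]
  refine mem_image_of_mem _ (M.Kref.mem_interior_carrier fun i => ?_)
  by_cases hij : i = j
  · rw [hij]; exact h1
  · exact h2 i hij

end Face

/-- The outward normals of two adjacent elements are opposite. -/
theorem ae_normal_eq_neg {K K' : M.Elem} {j j' : M.Kref.Facet} {F : M.Face} (hK : K ≠ K')
    (hF : M.face F ⊆ M.side K j) (hF' : M.face F ⊆ M.side K' j') :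
    ∀ᵐ s ∂volume.restrict M.Fref.carrier,
      M.normal K' j' (polyMap (M.phi F) s) = -M.normal K j (polyMap (M.phi F) s) := by
  filter_upwards [M.ae_localCoord_lt hF, M.ae_localCoord_lt hF',
    ae_restrict_mem M.Fref.measurableSet_carrier] with s h1 h2 hs
  refine (eq_neg_or_eq_of_vecMul_eq_zero (M.phi_nonsingular F s hs) (M.normal_unit hF hs)
    (M.normal_unit hF' hs) (M.vecMul_normal hF hs) (M.vecMul_normal hF' hs)).resolve_right ?_
  -- With equal normals, a short step backwards from the face would enter both elements, which are
  -- disjoint.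
  intro heq
  have e1 := M.eventually_sub_normal_mem hF hs h1
  have e2 := M.eventually_sub_normal_mem hF' hs h2
  rw [heq] at e2
  obtain ⟨r, hr1, hr2⟩ := (e1.and e2).exists
  exact disjoint_left.1 (M.elem_disjoint K K' hK) hr1 hr2

/-- Contributions that are odd in the normal vector cancel on interior faces. -/
theorem skelInt_interior_eq_zero (G : M.Face → (Fin (n + 1) → ℝ) → (Fin (n + 1) → ℝ) → ℝ)
    (hG : ∀ F x ν, G F x (-ν) = -G F x ν) :
    M.skelInt M.boundaryFacesᶜ (fun _ F x ν => G F x ν) = 0 := by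
  classical
  unfold skelInt
  beta_reduce
  rw [Finset.sum_congr rfl fun K _ => Finset.sum_comm, Finset.sum_comm]
  refine Finset.sum_eq_zero fun F _ => ?_
  rw [← Fintype.sum_prod_type']
  by_cases hFb : F ∈ M.boundaryFacesᶜ
  · obtain ⟨K, j, K', j', hne, h⟩ := M.interior_face F hFb
    have hF : M.face F ⊆ M.side K j := (h K j).2 (Or.inl ⟨rfl, rfl⟩)
    have hF' : M.face F ⊆ M.side K' j' := (h K' j').2 (Or.inr ⟨rfl, rfl⟩)
    have hne' : (K, j) ≠ (K', j') := fun h => hne (Prod.ext_iff.1 h).1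
    -- Only two incidences contribute to an interior face.
    rw [← Finset.sum_subset (Finset.subset_univ {(K, j), (K', j')}), Finset.sum_pair hne',
      if_pos ⟨hFb, hF⟩, if_pos ⟨hFb, hF'⟩]
    · have : M.faceInt F (fun x => G F x (M.normal K' j' x))
          = -M.faceInt F (fun x => G F x (M.normal K j x)) := by
        rw [faceInt, faceInt, ← integral_neg]
        refine integral_congr_ae ?_
        filter_upwards [M.ae_normal_eq_neg hne hF hF'] with s hs
        rw [hs, hG]
        ring
      simp only
      rw [this, add_neg_cancel]
    · rintro ⟨L, m⟩ _ hL
      rw [if_neg]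
      rintro ⟨_, hLm⟩
      refine hL ?_
      rcases (h L m).1 hLm with ⟨rfl, rfl⟩ | ⟨rfl, rfl⟩ <;> simp
  · exact Finset.sum_eq_zero fun _ _ => if_neg fun h => hFb h.1

end Mesh

/-! ### Differentiation of the total entropy in time -/

/-- A finite-dimensional space of functions has an interpolation formula. -/
theorem exists_interpolation {S : Type*} (V : Submodule ℝ (S → ℝ)) [FiniteDimensional ℝ V] :
    ∃ (t : Finset S) (L : t → V), ∀ f ∈ V, ∀ x, f x = ∑ a : t, f a * (L a : S → ℝ) x := by
  let ev : S → V →ₗ[ℝ] ℝ := fun x => (LinearMap.proj x).comp V.subtype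
  -- In finite dimension the kernels of finitely many evaluations already have the same intersection
  -- as all of them, namely zero.
  obtain ⟨t, ht⟩ := Finset.exists_inf_le fun x => LinearMap.ker (ev x)
  classical
  let e : V →ₗ[ℝ] (t → ℝ) := LinearMap.pi fun a => ev a
  have he : LinearMap.ker e = ⊥ := by
    rw [eq_bot_iff]
    intro f hf
    rw [LinearMap.mem_ker] at hf
    have h1 : f ∈ t.inf fun x => LinearMap.ker (ev x) := by
      rw [Submodule.mem_finsetInf]
      intro a ha
      exact congrFun hf ⟨a, ha⟩
    refine (Submodule.mem_bot ℝ).2 (Subtype.ext (funext fun x => ?_))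
    exact ht x h1
  -- A left inverse of the evaluation map sends the unit vectors to the interpolation functions.
  obtain ⟨g, hg⟩ := e.exists_leftInverse_of_injective he
  refine ⟨t, fun a => g (Pi.single a 1), fun f hf x => ?_⟩
  have h1 : g (e ⟨f, hf⟩) = ⟨f, hf⟩ := LinearMap.congr_fun hg _
  have h2 : e ⟨f, hf⟩ = ∑ a : t, f a • Pi.single a (1 : ℝ) := by
    ext b
    simp [e, ev, Pi.single_apply]
  rw [h2, map_sum] at h1
  have h3 := congrFun (congrArg (Subtype.val : V → S → ℝ) h1) x
  refine h3.symm.trans ?_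
  simp

/-- A differentiable function is uniformly Lipschitz near the points of a compact set. -/
theorem exists_lipschitz_near_compact {E : Type*} [NormedAddCommGroup E] [NormedSpace ℝ E]
    [ProperSpace E] {h : E → ℝ} {U C : Set E} (hU : IsOpen U) (hh : ∀ x ∈ U, ContDiffAt ℝ ∞ h x)
    (hC : IsCompact C) (hCU : C ⊆ U) : ∃ δ > 0, ∃ B : ℝ, ∀ x ∈ C, ∀ y, ‖y - x‖ ≤ δ →
      y ∈ U ∧ ‖h y - h x‖ ≤ B * ‖y - x‖ := by
  -- A closed thickening inside `U` is compact, so the derivative is bounded on it, and it contains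
  -- the balls on which the mean value inequality is used.
  obtain ⟨δ, hδ, hsub⟩ := hC.exists_cthickening_subset_open hU hCU
  have hcont : ContinuousOn (fderiv ℝ h) (Metric.cthickening δ C) := fun x hx =>
    ((hh x (hsub hx)).fderiv_right (m := 0) (by simp)).continuousAt.continuousWithinAt
  obtain ⟨B, hB⟩ := hC.cthickening.exists_bound_of_continuousOn hcont
  refine ⟨δ, hδ, B, fun x hx y hy => ?_⟩
  have hball : Metric.closedBall x δ ⊆ Metric.cthickening δ C :=
    Metric.closedBall_subset_cthickening hx δ
  have hyb : y ∈ Metric.closedBall x δ := by rwa [mem_closedBall_iff_norm]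
  refine ⟨hsub (hball hyb), ?_⟩
  exact (convex_closedBall x δ).norm_image_sub_le_of_norm_fderiv_le
    (fun z hz => (hh z (hsub (hball hz))).differentiableAt (by simp))
    (fun z hz => hB z (hball hz)) (Metric.mem_closedBall_self hδ.le) hyb

/-- Differentiation under the integral sign, for functions in a finite-dimensional space whose
coefficients are differentiable at one time only. -/
theorem hasDerivAt_integral_comp {m : ℕ} {E : Type*} [NormedAddCommGroup E] [NormedSpace ℝ E]
    [FiniteDimensional ℝ E] {ι : Type*} [Fintype ι] {h : E → ℝ} {U : Set E} (hU : IsOpen U)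
    (hh : ∀ x ∈ U, ContDiffAt ℝ ∞ h x) {S : Set (Fin m → ℝ)} (hS : IsCompact S)
    {L : ι → (Fin m → ℝ) → ℝ} (hL : ∀ a, ContinuousOn (L a) S) {c : ι → ℝ → E} {c' : ι → E}
    {t : ℝ} (hc : ∀ a, HasDerivAt (c a) (c' a) t) {r : (Fin m → ℝ) → ℝ} (hr : ContinuousOn r S)
    (hmem : ∀ ξ ∈ S, ∑ a, L a ξ • c a t ∈ U) :
    (∀ᶠ τ in nhds t, ∀ ξ ∈ S, ∑ a, L a ξ • c a τ ∈ U) ∧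
    HasDerivAt (fun τ => ∫ ξ in S, r ξ * h (∑ a, L a ξ • c a τ))
      (∫ ξ in S, r ξ * fderiv ℝ h (∑ a, L a ξ • c a t) (∑ a, L a ξ • c' a)) t := by
  have : ProperSpace E := FiniteDimensional.proper ℝ E
  have hwc : ∀ τ, ContinuousOn (fun ξ => ∑ a, L a ξ • c a τ) S := fun τ =>
    continuousOn_finsetSum _ fun a _ => (hL a).smul continuousOn_const
  obtain ⟨δ, hδ, B, hB⟩ := exists_lipschitz_near_compact hU hh (hS.image_of_continuousOn (hwc t))
    (by rintro _ ⟨ξ, hξ, rfl⟩; exact hmem ξ hξ)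
  have hLb : ∀ a, ∃ b, ∀ ξ ∈ S, ‖L a ξ‖ ≤ b := fun a => hS.exists_bound_of_continuousOn (hL a)
  choose b hb using hLb
  obtain ⟨R, hR⟩ := hS.exists_bound_of_continuousOn hr
  -- Differentiability at `t` alone controls increments measured from `t`, not between two nearby
  -- times. Hence the dominated differentiation theorem is used in the version that compares with `F
  -- t` only.
  have hcb : ∀ a, ∃ k : ℝ, ∀ᶠ τ in nhds t, ‖c a τ - c a t‖ ≤ k * ‖τ - t‖ := fun a =>
    (hc a).differentiableAt.isBigO_sub.bound
  choose k hk using hcb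
  set A : ℝ := ∑ a, |b a| * |k a| with hA
  have hA0 : 0 ≤ A := Finset.sum_nonneg fun a _ => mul_nonneg (abs_nonneg _) (abs_nonneg _)
  have hdiff : ∀ᶠ τ in nhds t, ∀ ξ ∈ S,
      ‖∑ a, L a ξ • c a τ - ∑ a, L a ξ • c a t‖ ≤ A * ‖τ - t‖ := by
    filter_upwards [Filter.eventually_all.2 hk] with τ hτ ξ hξ
    rw [← Finset.sum_sub_distrib, hA, Finset.sum_mul]
    refine norm_sum_le_of_le _ fun a _ => ?_
    rw [← smul_sub, norm_smul, mul_assoc]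
    refine mul_le_mul ((hb a ξ hξ).trans (le_abs_self _)) ?_ (norm_nonneg _) (abs_nonneg _)
    exact (hτ a).trans (mul_le_mul_of_nonneg_right (le_abs_self _) (norm_nonneg _))
  have hsmall : ∀ᶠ τ in nhds t, A * ‖τ - t‖ ≤ δ := by
    have : Filter.Tendsto (fun τ : ℝ => A * ‖τ - t‖) (nhds t) (nhds 0) := by
      have : Continuous fun τ : ℝ => A * ‖τ - t‖ := by fun_prop
      simpa using this.tendsto t
    exact (this.eventually_lt_const hδ).mono fun _ h => h.le
  have hgood : ∀ᶠ τ in nhds t, ∀ ξ ∈ S, ∑ a, L a ξ • c a τ ∈ U ∧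
      ‖h (∑ a, L a ξ • c a τ) - h (∑ a, L a ξ • c a t)‖ ≤ |B| * (A * ‖τ - t‖) := by
    filter_upwards [hdiff, hsmall] with τ h1 h2 ξ hξ
    obtain ⟨h3, h4⟩ := hB _ (mem_image_of_mem _ hξ) _ ((h1 ξ hξ).trans h2)
    refine ⟨h3, h4.trans ?_⟩
    exact mul_le_mul (le_abs_self _) (h1 ξ hξ) (norm_nonneg _) (abs_nonneg _)
  have hFc : ∀ τ, (∀ ξ ∈ S, ∑ a, L a ξ • c a τ ∈ U) →
      ContinuousOn (fun ξ => r ξ * h (∑ a, L a ξ • c a τ)) S := fun τ hτ =>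
    hr.mul (ContinuousOn.comp (t := U) (fun x hx => (hh x hx).continuousAt.continuousWithinAt)
      (hwc τ) hτ)
  refine ⟨hgood.mono fun τ hτ ξ hξ => (hτ ξ hξ).1, ?_⟩
  let F' : (Fin m → ℝ) → ℝ →L[ℝ] ℝ := fun ξ => ContinuousLinearMap.toSpanSingleton ℝ
    (r ξ * fderiv ℝ h (∑ a, L a ξ • c a t) (∑ a, L a ξ • c' a))
  have hF'c : ContinuousOn F' S := by
    refine (ContinuousLinearMap.toSpanSingletonCLE (𝕜 := ℝ) (E := ℝ)).continuous.comp_continuousOn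
      (hr.mul (ContinuousOn.clm_apply ?_ ?_))
    · exact ContinuousOn.comp (t := U) (fun x hx =>
        ((hh x hx).fderiv_right (m := 0) (by simp)).continuousAt.continuousWithinAt) (hwc t) hmem
    · exact continuousOn_finsetSum _ fun a _ => (hL a).smul continuousOn_const
  obtain ⟨hint, hderiv⟩ := hasFDerivAt_integral_of_dominated_loc_of_lip' (𝕜 := ℝ)
    (μ := volume.restrict S) (F := fun τ ξ => r ξ * h (∑ a, L a ξ • c a τ)) (F' := F')
    (bound := fun _ => |R| * (|B| * A)) (x₀ := t) hgood
    (fun τ hτ => ((hFc τ fun ξ hξ => (hτ ξ hξ).1).aestronglyMeasurable hS.measurableSet))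
    ((hFc t hmem).integrableOn_compact hS)
    (hF'c.aestronglyMeasurable hS.measurableSet)
    (by
      filter_upwards [ae_restrict_mem hS.measurableSet] with ξ hξ τ hτ
      rw [← mul_sub, norm_mul, mul_assoc]
      refine mul_le_mul ((hR ξ hξ).trans (le_abs_self _)) ?_ (norm_nonneg _) (abs_nonneg _)
      rw [mul_assoc]
      exact (hτ ξ hξ).2)
    (integrableOn_const hS.measure_lt_top.ne)
    (by
      filter_upwards [ae_restrict_mem hS.measurableSet] with ξ hξ
      have h1 : HasDerivAt (fun τ => ∑ a, L a ξ • c a τ) (∑ a, L a ξ • c' a) t :=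
        HasDerivAt.fun_sum fun a _ => (hc a).const_smul (L a ξ)
      have h2 := ((hh _ (hmem ξ hξ)).differentiableAt (by simp)).hasFDerivAt
      exact ((h2.comp_hasDerivAt t h1).const_mul (r ξ)).hasFDerivAt)
  refine hderiv.hasDerivAt.congr_deriv ?_
  rw [ContinuousLinearMap.integral_apply hint]
  simp [F']

namespace Mesh

variable {n p : ℕ} {Ω : Set (Fin (n + 1) → ℝ)} (M : Mesh n p Ω)

/-- The functions of `spaceV` have an interpolation formula on each element. -/
theorem exists_interpolation_spaceV (k : ℕ) : ∃ (t : Finset M.Kref.carrier)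
    (L : t → MvPolynomial (Fin (n + 1)) ℝ), ∀ w ∈ M.spaceV k, ∀ K, ∀ ξ ∈ M.Kref.carrier,
      w K (polyMap (M.psi K) ξ)
        = ∑ a : t, MvPolynomial.eval ξ (L a) • w K (polyMap (M.psi K) (a : M.Kref.carrier)) := by
  let Φ : MvPolynomial.restrictTotalDegree (Fin (n + 1)) ℝ k →ₗ[ℝ] (M.Kref.carrier → ℝ) :=
    { toFun := fun q ξ => MvPolynomial.eval (ξ : Fin (n + 1) → ℝ)
        (q : MvPolynomial (Fin (n + 1)) ℝ)
      map_add' := fun q r => by ext ξ; simp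
      map_smul' := fun c q => by ext ξ; simp }
  obtain ⟨t, L, hL⟩ := exists_interpolation (LinearMap.range Φ)
  choose q hq using fun a => (L a).2
  refine ⟨t, fun a => q a, fun w hw K ξ hξ => ?_⟩
  ext i
  obtain ⟨P, hP, hPw⟩ := hw K i
  have hmem : (fun η : M.Kref.carrier => w K (polyMap (M.psi K) η) i) ∈ LinearMap.range Φ := by
    refine ⟨⟨P, (MvPolynomial.mem_restrictTotalDegree _ _ _).2 hP⟩, ?_⟩
    ext η
    exact (hPw η η.2).symm
  have h := hL _ hmem ⟨ξ, hξ⟩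
  simp only at h
  rw [h, Finset.sum_apply]
  refine Finset.sum_congr rfl fun a _ => ?_
  rw [← hq a, Pi.smul_apply, smul_eq_mul, mul_comm]
  rfl

/-- The total entropy is differentiable in time. -/
theorem hasDerivAt_totalEntropy {γ : ℝ} (hγ : 1 < γ) (s0 : ℝ) {k : ℕ} {v : ℝ → M.ElemFun} {t : ℝ}
    (hmem : ∀ᶠ τ in nhds t, v τ ∈ M.spaceV k)
    (hdiff : ∀ K, ∀ x ∈ M.closedElem K, DifferentiableAt ℝ (fun τ => v τ K x) t)
    (hphys : ∀ K, ∀ x ∈ M.closedElem K, energy (v t K x) < 0) :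
    HasDerivAt (fun τ => M.totalEntropy γ s0 (v τ)) (M.volInt fun K x =>
      deriv (fun τ => consVars γ s0 (v τ K x)) t ⬝ᵥ v t K x) t := by
  unfold totalEntropy volInt
  refine HasDerivAt.fun_sum fun K _ => ?_
  simp only [M.integral_elem]
  obtain ⟨pts, L, hL⟩ := M.exists_interpolation_spaceV k
  have hpt : ∀ ξ ∈ M.Kref.carrier, polyMap (M.psi K) ξ ∈ M.closedElem K :=
    fun ξ hξ => mem_image_of_mem _ hξ
  have hvt : ∀ ξ ∈ M.Kref.carrier, v t K (polyMap (M.psi K) ξ) = ∑ a : pts,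
      MvPolynomial.eval ξ (L a) • v t K (polyMap (M.psi K) (a : M.Kref.carrier)) :=
    fun ξ hξ => hL _ hmem.self_of_nhds K ξ hξ
  have hc : ∀ a : pts, HasDerivAt (fun τ => v τ K (polyMap (M.psi K) (a : M.Kref.carrier)))
      (deriv (fun τ => v τ K (polyMap (M.psi K) (a : M.Kref.carrier))) t) t :=
    fun a => (hdiff K _ (hpt _ (a : M.Kref.carrier).2)).hasDerivAt
  obtain ⟨hev, hder⟩ := hasDerivAt_integral_comp (h := fun w => entropyH γ s0 (consE γ s0 w))
    (U := {w | energy w < 0}) (L := fun a ξ => MvPolynomial.eval ξ (L a))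
    (r := fun ξ => |(polyJac (M.psi K) ξ).det|)
    isOpen_energy_neg (fun w hw => by
      have hw' : energy w < 0 := hw
      -- Smoothness of the entropy is read off from the duality `H = v·u - (γ-1)ρ`.
      have h1 : ContDiffAt ℝ ∞ (fun w : State (n + 1) => w ⬝ᵥ consE γ s0 w
          - (γ - 1) * rhoE γ s0 w) w := by
        refine ContDiffAt.sub ?_ (contDiffAt_const.mul (contDiffAt_rhoE hγ s0 hw'))
        simp only [dotProduct]
        exact ContDiffAt.sum fun i _ => (contDiffAt_apply _ _ _ _).mul
          (contDiffAt_pi.1 (contDiffAt_consE hγ s0 hw') i)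
      refine h1.congr_of_eventuallyEq ?_
      filter_upwards [isOpen_energy_neg.mem_nhds hw'] with z hz
      rw [dotProduct_consE hγ s0 hz]
      ring)
    M.Kref.isCompact_carrier (fun a => (continuous_eval (L a)).continuousOn) hc
    ((continuous_polyJac (M.psi K)).matrix_det.abs.continuousOn) (fun ξ hξ => by
      rw [← hvt ξ hξ]
      exact hphys K _ (hpt ξ hξ))
  refine (hder.congr_of_eventuallyEq ?_).congr_deriv ?_
  · filter_upwards [hev, hmem] with τ h1 h2
    refine setIntegral_congr_fun M.Kref.measurableSet_carrier fun ξ hξ => ?_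
    have h3 := h1 ξ hξ
    have h4 := hL _ h2 K ξ hξ
    rw [← h4] at h3 ⊢
    rw [consVars_eq hγ s0 h3]
  · refine setIntegral_congr_fun M.Kref.measurableSet_carrier fun ξ hξ => ?_
    congr 1
    have hneg := hphys K _ (hpt ξ hξ)
    -- The time derivative at an arbitrary point is the interpolant of the nodal time derivatives;
    -- with `dH = vᵗ du` this identifies the integrands.
    have hd : HasDerivAt (fun τ => v τ K (polyMap (M.psi K) ξ)) (∑ a : pts,
        MvPolynomial.eval ξ (L a) •
          deriv (fun τ => v τ K (polyMap (M.psi K) (a : M.Kref.carrier))) t) t := by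
      refine HasDerivAt.congr_of_eventuallyEq
        (HasDerivAt.fun_sum fun a _ => (hc a).const_smul (MvPolynomial.eval ξ (L a))) ?_
      filter_upwards [hmem] with τ hτ using hL _ hτ K ξ hξ
    rw [← hvt ξ hξ, (hasFDerivAt_entropyH_consE hγ s0 hneg).fderiv]
    have h5 := ((differentiableAt_consE hγ s0 hneg).hasFDerivAt.congr_of_eventuallyEq
      (consVars_eventuallyEq hγ s0 hneg)).comp_hasDerivAt t hd
    have h6 := h5.deriv
    simp only [comp_def] at h6
    rw [h6, dotProduct_comm]
    simp only [dotProduct, sum_apply, smul_apply,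
      ContinuousLinearMap.comp_apply, ContinuousLinearMap.proj_apply, smul_eq_mul]

end Mesh

/-! ### The volume term of the entropy balance -/

section Potential

variable {d : ℕ}

theorem fluxN_single (γ : ℝ) (l : Fin d) (u : State d) (i : Comp d) :
    fluxN γ (Pi.single l 1) u i = flux γ u i l := by
  simp [fluxN]

/-- By linearity in `n`, `ψ_n` is the normal component of a vector field, as the divergence theorem
requires. -/
theorem potentialFlux_eq_dotProduct (γ s0 : ℝ) (n : Fin d → ℝ) (v : State d) :
    potentialFlux γ s0 n v = n ⬝ᵥ fun l => potentialFlux γ s0 (Pi.single l 1) v := by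
  simp only [potentialFlux, dotProduct, Finset.mul_sum, Pi.single_apply]
  refine Finset.sum_congr rfl fun l _ => ?_
  simp
  ring

theorem potentialFlux_neg (γ s0 : ℝ) (n : Fin d → ℝ) (v : State d) :
    potentialFlux γ s0 (-n) v = -potentialFlux γ s0 n v := by
  simp [potentialFlux]

end Potential

namespace Mesh

variable {n p : ℕ} {Ω : Set (Fin (n + 1) → ℝ)} (M : Mesh n p Ω)

/-- The volume term `(F(w), ∇w)` only depends on the values of `w` on the element boundaries. -/
theorem volInt_flux_fderiv (hn : n + 1 ≤ 3) {γ : ℝ} (hγ : 1 < γ) (s0 : ℝ) {k : ℕ} {w : M.ElemFun}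
    (hw : w ∈ M.spaceV k) (hphys : ∀ K, ∀ x ∈ M.closedElem K, energy (w K x) < 0) :
    M.volInt (fun K x => ∑ i, ∑ l, flux γ (consVars γ s0 (w K x)) i l
        * fderiv ℝ (w K) x (Pi.single l 1) i)
      = M.skelInt univ (fun K _ x ν => potentialFlux γ s0 ν (w K x)) := by
  classical
  unfold volInt skelInt
  refine Finset.sum_congr rfl fun K _ => ?_
  choose q _ hq using hw K
  let Q : (Fin (n + 1) → ℝ) → State (n + 1) := fun ξ i => MvPolynomial.eval ξ (q i)
  let Q' : (Fin (n + 1) → ℝ) → (Fin (n + 1) → ℝ) →L[ℝ] State (n + 1) := fun ξ =>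
    ContinuousLinearMap.pi fun i => ∑ m, MvPolynomial.eval ξ (MvPolynomial.pderiv m (q i)) •
      ContinuousLinearMap.proj (R := ℝ) (φ := fun _ : Fin (n + 1) => ℝ) m
  have hwQ : ∀ ξ ∈ M.Kref.carrier, w K (polyMap (M.psi K) ξ) = Q ξ := fun ξ hξ =>
    funext fun i => hq i ξ hξ
  have hQ : ∀ ξ, HasFDerivAt Q (Q' ξ) ξ := fun ξ =>
    hasFDerivAt_pi.2 fun i => (hasStrictFDerivAt_eval (q i) ξ).hasFDerivAt
  have hQ'e : ∀ ξ z i, Q' ξ z i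
      = ∑ m, MvPolynomial.eval ξ (MvPolynomial.pderiv m (q i)) * z m := by
    intro ξ z i
    simp [Q']
  have hneg : ∀ ξ ∈ M.Kref.carrier, energy (Q ξ) < 0 := fun ξ hξ => by
    rw [← hwQ ξ hξ]
    exact hphys K _ (mem_image_of_mem _ hξ)
  let g' : Fin (n + 1) → (Fin (n + 1) → ℝ) → (Fin (n + 1) → ℝ) →L[ℝ] ℝ := fun l ξ =>
    (∑ i, fluxN γ (Pi.single l 1) (consE γ s0 (Q ξ)) i •
      ContinuousLinearMap.proj (R := ℝ) (φ := fun _ : Comp (n + 1) => ℝ) i).comp (Q' ξ)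
  have hg'e : ∀ l ξ m, g' l ξ (Pi.single m 1) = ∑ i, fluxN γ (Pi.single l 1) (consE γ s0 (Q ξ)) i
      * MvPolynomial.eval ξ (MvPolynomial.pderiv m (q i)) := by
    intro l ξ m
    simp [g', hQ'e, Pi.single_apply, -Fintype.sum_sum_type]
  rw [M.integral_divergence_elem hn K (g := fun l ξ => potentialFlux γ s0 (Pi.single l 1) (Q ξ))
    (g' := g') (fun l ξ hξ => (hasFDerivAt_potentialFlux hγ s0 _ (hneg ξ hξ)).comp ξ (hQ ξ))
    (fun l m => ?_) (fun ξ hξ => ?_)]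
  · refine Finset.sum_congr rfl fun j _ => Finset.sum_congr rfl fun F _ => ?_
    simp only [mem_univ, true_and]
    split_ifs with hF
    · refine setIntegral_congr_fun M.Fref.measurableSet_carrier fun s hs => ?_
      have hx := M.phi_mem_closedElem hF hs
      simp only
      rw [potentialFlux_eq_dotProduct, ← hwQ _ (M.localCoord_mem hx), M.psi_localCoord hx]
    · rfl
  · simp only [hg'e]
    refine continuousOn_finsetSum _ fun i _ => ContinuousOn.mul (fun ξ hξ => ?_)
      (continuous_eval _).continuousOn
    have h1 := (contDiffAt_fluxN γ (Pi.single l 1)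
      (consE_mem hγ s0 (hneg ξ hξ)).1.ne').continuousAt
    have h2 := (contDiffAt_consE hγ s0 (hneg ξ hξ)).continuousAt
    have h3 : ContinuousAt (fun ξ => fluxN γ (Pi.single l 1) (consE γ s0 (Q ξ))) ξ :=
      ContinuousAt.comp (f := fun ξ => consE γ s0 (Q ξ)) h1
        (ContinuousAt.comp (f := Q) h2 (hQ ξ).continuousAt)
    exact ((continuousAt_pi.1 h3) i).continuousWithinAt
  · have hξ' := interior_subset hξ
    have hx : polyMap (M.psi K) ξ ∈ M.elem K := mem_image_of_mem _ hξ
    have hl := M.hasFDerivAt_localCoord K hx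
    rw [M.localCoord_psi K hξ'] at hl
    have hQl : HasFDerivAt Q (Q' ξ) (M.localCoord K (polyMap (M.psi K) ξ)) := by
      rw [M.localCoord_psi K hξ']
      exact hQ ξ
    -- In an open element `w` is the polynomial `Q` composed with the local coordinates. Its
    -- gradient therefore carries `(Dψ)⁻¹`, which times `det(Dψ)` is the adjugate.
    have hd : HasFDerivAt (w K) ((Q' ξ).comp (matCLM (polyJac (M.psi K) ξ)⁻¹))
        (polyMap (M.psi K) ξ) := by
      refine (hQl.comp _ hl).congr_of_eventuallyEq ?_
      filter_upwards [M.closedElem_mem_nhds hx] with y hy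
      rw [comp_apply, ← hwQ _ (M.localCoord_mem hy), M.psi_localCoord hy]
    have hadj : (polyJac (M.psi K) ξ).adjugate
        = (polyJac (M.psi K) ξ).det • (polyJac (M.psi K) ξ)⁻¹ := by
      rw [Matrix.inv_def, smul_smul, Ring.mul_inverse_cancel _ (M.isUnit_det_psi K hξ'), one_smul]
    beta_reduce
    rw [hd.fderiv, hwQ ξ hξ', consVars_eq hγ s0 (hneg ξ hξ'), hadj]
    simp only [ContinuousLinearMap.comp_apply, hQ'e, hg'e, fluxN_single, matCLM_apply,
      Matrix.mulVec_single_one, Matrix.col_apply, Matrix.smul_apply, smul_eq_mul, Finset.mul_sum]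
    rw [Finset.sum_congr rfl fun i _ => Finset.sum_comm, Finset.sum_comm]
    refine Finset.sum_congr rfl fun m _ => ?_
    rw [Finset.sum_comm]
    exact Finset.sum_congr rfl fun l _ => Finset.sum_congr rfl fun i _ => by ring

end Mesh

/-! ### Continuity of the numerical flux -/

section FluxContinuity

variable {d : ℕ} {X : Type*} [TopologicalSpace X]

theorem continuous_fluxN (γ : ℝ) {u : X → State d} {n : X → Fin d → ℝ} (hu : Continuous u)
    (hn : Continuous n) (hρ : ∀ x, density (u x) ≠ 0) :
    Continuous fun x => fluxN γ (n x) (u x) := by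
  simp only [fluxN_eq]
  have hV := continuous_velocity hu hρ
  have hp := continuous_pressure γ hu hρ
  have hVn := hV.dotProduct hn
  have hE : Continuous fun x => energy (u x) := continuous_energy.comp hu
  have hm := (continuous_density hu).mul hVn
  exact continuous_mkState hm ((hm.smul hV).add (hp.smul hn)) ((hE.add hp).mul hVn)

theorem continuous_fluxN_consE {γ : ℝ} (hγ : 1 < γ) (s0 : ℝ) {f : X → State d}
    {n : X → Fin d → ℝ} (hf : Continuous f) (hn : Continuous n) (hneg : ∀ x, energy (f x) < 0) :
    Continuous fun x => fluxN γ (n x) (consE γ s0 (f x)) :=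
  continuous_fluxN γ (continuous_consE hγ s0 hf hneg) hn fun x =>
    (consE_mem hγ s0 (hneg x)).1.ne'

theorem continuous_potentialFlux {γ : ℝ} (hγ : 1 < γ) (s0 : ℝ) {f : X → State d}
    {n : X → Fin d → ℝ} (hf : Continuous f) (hn : Continuous n) (hneg : ∀ x, energy (f x) < 0) :
    Continuous fun x => potentialFlux γ s0 (n x) (f x) := by
  have h : (fun x => potentialFlux γ s0 (n x) (f x))
      = fun x => n x ⬝ᵥ fun l => potentialFlux γ s0 (Pi.single l 1) (f x) :=
    funext fun x => potentialFlux_eq_dotProduct γ s0 (n x) (f x)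
  rw [h]
  exact hn.dotProduct (continuous_pi fun l => continuous_iff_continuousAt.2 fun x =>
    (contDiffAt_potentialFlux hγ s0 _ (hneg x)).continuousAt.comp hf.continuousAt)

/-- Arbitrary paths need not depend continuously on their end points. For straight ones the
integrand is jointly continuous in `x` and `θ`, so the parametric integral is continuous. -/
theorem continuous_sigmaMV {γ s0 : ℝ} (hγ : 1 < γ) {path : ℝ → State d → State d → State d}
    (hstraight : ∀ v₁ ∈ physicalV d γ s0, ∀ v₂ ∈ physicalV d γ s0, ∀ θ ∈ Icc (0 : ℝ) 1,
      path θ v₁ v₂ = (1 - θ) • v₁ + θ • v₂) {f g : X → State d} {n : X → Fin d → ℝ}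
    (hf : Continuous f) (hg : Continuous g) (hn : Continuous n) (hfneg : ∀ x, energy (f x) < 0)
    (hgneg : ∀ x, energy (g x) < 0) (hn0 : ∀ x, n x ≠ 0) :
    Continuous fun x => sigmaMV γ s0 path (f x) (g x) (n x) := by
  -- Clamping `θ` keeps the segment physical for all real `θ`, as global joint continuity demands,
  -- without changing the integral over `[0, 1]`.
  let c : ℝ → ℝ := fun θ => projIcc 0 1 zero_le_one θ
  have hc : Continuous c := continuous_subtype_val.comp continuous_projIcc
  have hgen : ∀ {f g : X → State d}, Continuous f → Continuous g → (∀ x, energy (f x) < 0) →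
      (∀ x, energy (g x) < 0) → Continuous fun z : X × ℝ =>
        genAbs γ s0 (n z.1) ((1 - c z.2) • f z.1 + c z.2 • g z.1) := by
    intro f g hf hg hfneg hgneg
    have hc' := hc.comp (continuous_snd (X := X))
    exact continuous_genAbs hγ s0 (((continuous_const.sub hc').smul (hf.comp continuous_fst)).add
      (hc'.smul (hg.comp continuous_fst))) (hn.comp continuous_fst)
      (fun z => energy_segment_neg (hfneg z.1) (hgneg z.1) (projIcc 0 1 zero_le_one z.2).2)
      fun z => hn0 z.1
  refine continuous_matrix fun i j => ?_
  have h : ∀ x, sigmaMV γ s0 path (f x) (g x) (n x) i j = ∫ θ in (0 : ℝ)..1, (1 - θ) *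
      (genAbs γ s0 (n x) ((1 - c θ) • f x + c θ • g x) i j
        + genAbs γ s0 (n x) ((1 - c θ) • g x + c θ • f x) i j) := by
    intro x
    refine intervalIntegral.integral_congr fun θ hθ => ?_
    rw [uIcc_of_le zero_le_one] at hθ
    have hθc : c θ = θ := congrArg Subtype.val (projIcc_of_mem zero_le_one hθ)
    have h1 := (mem_physicalV_iff (s0 := s0) hγ).2 (hfneg x)
    have h2 := (mem_physicalV_iff (s0 := s0) hγ).2 (hgneg x)
    rw [hθc, hstraight _ h1 _ h2 θ hθ, hstraight _ h2 _ h1 θ hθ]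
  simp only [h]
  refine intervalIntegral.continuous_parametric_intervalIntegral_of_continuous' ?_ 0 1
  exact (continuous_const.sub continuous_snd).mul
    (((hgen hf hg hfneg hgneg).matrix_elem i j).add ((hgen hg hf hgneg hfneg).matrix_elem i j))

theorem continuous_numFlux {γ s0 : ℝ} (hγ : 1 < γ) {path : ℝ → State d → State d → State d}
    (hstraight : ∀ v₁ ∈ physicalV d γ s0, ∀ v₂ ∈ physicalV d γ s0, ∀ θ ∈ Icc (0 : ℝ) 1,
      path θ v₁ v₂ = (1 - θ) • v₁ + θ • v₂) {f g : X → State d} {n : X → Fin d → ℝ}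
    (hf : Continuous f) (hg : Continuous g) (hn : Continuous n) (hfneg : ∀ x, energy (f x) < 0)
    (hgneg : ∀ x, energy (g x) < 0) (hn0 : ∀ x, n x ≠ 0) :
    Continuous fun x => numFlux γ s0 (sigmaMV γ s0 path) (f x) (g x) (n x) := by
  unfold numFlux
  simp only [consVars_eq hγ s0 (hfneg _), consVars_eq hγ s0 (hgneg _)]
  exact (((continuous_fluxN_consE hγ s0 hf hn hfneg).add
    (continuous_fluxN_consE hγ s0 hg hn hgneg)).const_smul (1 / 2 : ℝ)).add
    (((continuous_sigmaMV hγ hstraight hf hg hn hfneg hgneg hn0).matrix_mulVec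
      (hg.sub hf)).const_smul (1 / 2 : ℝ))

end FluxContinuity

namespace Mesh

variable {n p : ℕ} {Ω : Set (Fin (n + 1) → ℝ)} (M : Mesh n p Ω)

/-! ### Integration over the skeleton -/

/-- Integrability over the parts of the element boundaries that belong to faces in `S`. -/
def SkelIntegrable (S : Set M.Face)
    (g : M.Elem → M.Face → (Fin (n + 1) → ℝ) → (Fin (n + 1) → ℝ) → ℝ) : Prop :=
  ∀ K j, ∀ F ∈ S, M.face F ⊆ M.side K j → IntegrableOn (fun s =>
    g K F (polyMap (M.phi F) s) (M.normal K j (polyMap (M.phi F) s)) * M.surfElem F s)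
    M.Fref.carrier

variable {S : Set M.Face}
  {g h : M.Elem → M.Face → (Fin (n + 1) → ℝ) → (Fin (n + 1) → ℝ) → ℝ}

theorem SkelIntegrable.mono {T : Set M.Face} (hg : M.SkelIntegrable T g) (hST : S ⊆ T) :
    M.SkelIntegrable S g := fun K j F hFS hF => hg K j F (hST hFS) hF

theorem SkelIntegrable.sub (hg : M.SkelIntegrable S g) (hh : M.SkelIntegrable S h) :
    M.SkelIntegrable S (fun K F x ν => g K F x ν - h K F x ν) := fun K j F hFS hF => by
  simp only [sub_mul]
  exact (hg K j F hFS hF).sub (hh K j F hFS hF)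

theorem skelInt_congr (hgh : ∀ K j, ∀ F ∈ S, M.face F ⊆ M.side K j → ∀ s ∈ M.Fref.carrier,
      g K F (polyMap (M.phi F) s) (M.normal K j (polyMap (M.phi F) s))
        = h K F (polyMap (M.phi F) s) (M.normal K j (polyMap (M.phi F) s))) :
    M.skelInt S g = M.skelInt S h := by
  refine Finset.sum_congr rfl fun K _ => Finset.sum_congr rfl fun j _ =>
    Finset.sum_congr rfl fun F _ => ?_
  split_ifs with hF
  · refine setIntegral_congr_fun M.Fref.measurableSet_carrier fun s hs => ?_
    simp only [hgh K j F hF.1 hF.2 s hs]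
  · rfl

theorem skelInt_sub (hg : M.SkelIntegrable S g) (hh : M.SkelIntegrable S h) :
    M.skelInt S (fun K F x ν => g K F x ν - h K F x ν) = M.skelInt S g - M.skelInt S h := by
  unfold skelInt
  simp only [← Finset.sum_sub_distrib]
  refine Finset.sum_congr rfl fun K _ => Finset.sum_congr rfl fun j _ =>
    Finset.sum_congr rfl fun F _ => ?_
  split_ifs with hF
  · simp only [faceInt, sub_mul]
    exact integral_sub (hg K j F hF.1 hF.2) (hh K j F hF.1 hF.2)
  · simp

/-- A scalar factor needs no integrability. Hence the rewriting of the face term is valid for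
arbitrary paths, where integrability over faces is not available. -/
theorem skelInt_const_mul (c : ℝ) :
    M.skelInt S (fun K F x ν => c * g K F x ν) = c * M.skelInt S g := by
  unfold skelInt
  simp only [Finset.mul_sum]
  refine Finset.sum_congr rfl fun K _ => Finset.sum_congr rfl fun j _ =>
    Finset.sum_congr rfl fun F _ => ?_
  split_ifs with hF
  · simp only [faceInt, mul_assoc]
    exact integral_const_mul _ _
  · simp

theorem skelInt_univ (T : Set M.Face) : M.skelInt univ g = M.skelInt Tᶜ g + M.skelInt T g := by
  classical
  unfold skelInt
  simp only [← Finset.sum_add_distrib]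
  refine Finset.sum_congr rfl fun K _ => Finset.sum_congr rfl fun j _ =>
    Finset.sum_congr rfl fun F _ => ?_
  by_cases hT : F ∈ T <;> simp [hT]

theorem continuous_surfElem (F : M.Face) : Continuous (M.surfElem F) :=
  (((continuous_polyJac (M.phi F)).matrix_transpose.matrix_mul
    (continuous_polyJac (M.phi F))).matrix_det).sqrt

theorem skelIntegrable_of_continuous (hg : ∀ K j, ∀ F ∈ S, M.face F ⊆ M.side K j →
    Continuous fun s : M.Fref.carrier => g K F (polyMap (M.phi F) s)
      (M.normal K j (polyMap (M.phi F) s))) : M.SkelIntegrable S g := fun K j F hFS hF =>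
  ((continuousOn_iff_continuous_domRestrict.2 (hg K j F hFS hF)).mul
    (M.continuous_surfElem F).continuousOn).integrableOn_compact M.Fref.isCompact_carrier

section Face

variable {K : M.Elem} {j : M.Kref.Facet} {F : M.Face}

theorem continuous_localCoord_phi (hF : M.face F ⊆ M.side K j) :
    Continuous fun s : M.Fref.carrier => M.localCoord K (polyMap (M.phi F) s) :=
  continuousOn_iff_continuous_domRestrict.1 fun _ hs =>
    (M.hasFDerivWithinAt_localCoord_phi hF hs).continuousWithinAt

theorem continuous_normal (hF : M.face F ⊆ M.side K j) :
    Continuous fun s : M.Fref.carrier => M.normal K j (polyMap (M.phi F) s) := by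
  have h1 : Continuous fun s : M.Fref.carrier => M.conormal K j (polyMap (M.phi F) s) :=
    (continuous_matrix_inv ((continuous_polyJac (M.psi K)).comp (M.continuous_localCoord_phi hF))
      fun s => M.isUnit_det_psi K (M.localCoord_mem
        (M.phi_mem_closedElem hF s.2))).matrix_transpose.matrix_mulVec continuous_const
  exact ((h1.dotProduct h1).sqrt.inv₀ fun s => (Real.sqrt_pos.2
    (dotProduct_self_pos (M.conormal_ne_zero hF s.2))).ne').smul h1

theorem normal_ne_zero (hF : M.face F ⊆ M.side K j) {s : Fin n → ℝ} (hs : s ∈ M.Fref.carrier) :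
    M.normal K j (polyMap (M.phi F) s) ≠ 0 := by
  intro h
  have := M.normal_unit hF hs
  rw [h] at this
  simp at this

theorem continuous_elemFun_phi {k : ℕ} {w : M.ElemFun} (hw : w ∈ M.spaceV k)
    (hF : M.face F ⊆ M.side K j) :
    Continuous fun s : M.Fref.carrier => w K (polyMap (M.phi F) s) := by
  refine continuous_pi fun i => ?_
  obtain ⟨q, _, hq⟩ := hw K i
  refine ((continuous_eval q).comp (M.continuous_localCoord_phi hF)).congr fun s => ?_
  have hx := M.phi_mem_closedElem hF s.2
  rw [comp_apply, ← hq _ (M.localCoord_mem hx), M.psi_localCoord hx]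

theorem continuous_faceFun_phi {k : ℕ} {EE : Set M.Face} {μ : M.FaceFun}
    (hμ : μ ∈ M.spaceM k EE) (F : M.Face) :
    Continuous fun s : M.Fref.carrier => μ F (polyMap (M.phi F) s) := by
  refine continuous_pi fun i => ?_
  obtain ⟨q, _, hq⟩ := hμ.1 F i
  exact ((continuous_eval q).comp continuous_subtype_val).congr fun s => (hq s s.2).symm

end Face

end Mesh

namespace Mesh

variable {n p : ℕ} {Ω : Set (Fin (n + 1) → ℝ)} (M : Mesh n p Ω)

/-! ### The entropy balance -/

theorem isPhysical_iff {γ : ℝ} (hγ : 1 < γ) {s0 : ℝ} {v : M.ElemFun} {vhat : M.FaceFun} :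
    M.IsPhysical γ s0 v vhat ↔ (∀ K, ∀ x ∈ M.closedElem K, energy (v K x) < 0) ∧
      ∀ F, ∀ x ∈ M.face F, energy (vhat F x) < 0 := by
  simp only [IsPhysical, mem_physicalV_iff hγ]

/-- The face term of the mean-value stabilization. -/
theorem faceTerm_sigmaMV {γ : ℝ} (hγ : 1 < γ) {s0 : ℝ}
    {path : ℝ → State (n + 1) → State (n + 1) → State (n + 1)} (hpath : IsPath γ s0 path)
    {v : M.ElemFun} {vhat : M.FaceFun} (hphys : M.IsPhysical γ s0 v vhat) :
    M.faceTerm γ s0 path (sigmaMV γ s0 path) v vhat = M.meanValueFaceTerm γ s0 path v vhat := by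
  unfold faceTerm meanValueFaceTerm
  rw [← skelInt_const_mul]
  exact M.skelInt_congr fun K j F _ hF s hs => dotProduct_sigmaMV_sub_bigSigma hpath hγ
    (hphys.1 K _ (M.phi_mem_closedElem hF hs)) (hphys.2 F _ (mem_image_of_mem _ hs)) _

section Balance

variable {γ s0 : ℝ} (hγ : 1 < γ) {path : ℝ → State (n + 1) → State (n + 1) → State (n + 1)}
  (hstraight : ∀ v₁ ∈ physicalV (n + 1) γ s0, ∀ v₂ ∈ physicalV (n + 1) γ s0, ∀ θ ∈ Icc (0 : ℝ) 1,
    path θ v₁ v₂ = (1 - θ) • v₁ + θ • v₂)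
  {k : ℕ} {EE : Set M.Face} {v : M.ElemFun} {vhat : M.FaceFun} (hv : v ∈ M.spaceV k)
  (hvhat : vhat ∈ M.spaceM k EE) (hphys : M.IsPhysical γ s0 v vhat)

include hγ hvhat hphys in
theorem skelIntegrable_potentialFlux_faceFun :
    M.SkelIntegrable univ fun _ F x ν => potentialFlux γ s0 ν (vhat F x) :=
  M.skelIntegrable_of_continuous fun _ _ F _ hF => continuous_potentialFlux hγ s0
    (M.continuous_faceFun_phi hvhat F) (M.continuous_normal hF) fun s =>
      ((M.isPhysical_iff hγ).1 hphys).2 F _ (mem_image_of_mem _ s.2)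

include hγ hv hphys in
theorem skelIntegrable_potentialFlux_elemFun :
    M.SkelIntegrable univ fun K _ x ν => potentialFlux γ s0 ν (v K x) :=
  M.skelIntegrable_of_continuous fun K _ _ _ hF => continuous_potentialFlux hγ s0
    (M.continuous_elemFun_phi hv hF) (M.continuous_normal hF) fun s =>
      ((M.isPhysical_iff hγ).1 hphys).1 K _ (M.phi_mem_closedElem hF s.2)

include hγ hvhat hphys in
theorem skelIntegrable_dotProduct_fluxN :
    M.SkelIntegrable univ fun _ F x ν => vhat F x ⬝ᵥ fluxN γ ν (consVars γ s0 (vhat F x)) := by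
  refine M.skelIntegrable_of_continuous fun _ _ F _ hF => ?_
  have hneg := fun s : M.Fref.carrier =>
    ((M.isPhysical_iff hγ).1 hphys).2 F _ (mem_image_of_mem _ s.2)
  have hc := M.continuous_faceFun_phi hvhat F
  simp only [consVars_eq hγ s0 (hneg _)]
  exact hc.dotProduct (continuous_fluxN_consE hγ s0 hc (M.continuous_normal hF) hneg)

include hγ hstraight hv hvhat hphys

theorem continuous_numFlux_phi {K : M.Elem} {j : M.Kref.Facet} {F : M.Face}
    (hF : M.face F ⊆ M.side K j) : Continuous fun s : M.Fref.carrier =>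
      numFlux γ s0 (sigmaMV γ s0 path) (vhat F (polyMap (M.phi F) s)) (v K (polyMap (M.phi F) s))
        (M.normal K j (polyMap (M.phi F) s)) :=
  continuous_numFlux hγ hstraight (M.continuous_faceFun_phi hvhat F)
    (M.continuous_elemFun_phi hv hF) (M.continuous_normal hF)
    (fun s => ((M.isPhysical_iff hγ).1 hphys).2 F _ (mem_image_of_mem _ s.2))
    (fun s => ((M.isPhysical_iff hγ).1 hphys).1 K _ (M.phi_mem_closedElem hF s.2))
    fun s => M.normal_ne_zero hF s.2

theorem skelIntegrable_numFlux_elemFun : M.SkelIntegrable univ fun K F x ν =>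
    numFlux γ s0 (sigmaMV γ s0 path) (vhat F x) (v K x) ν ⬝ᵥ v K x :=
  M.skelIntegrable_of_continuous fun _ _ _ _ hF =>
    (M.continuous_numFlux_phi hγ hstraight hv hvhat hphys hF).dotProduct
      (M.continuous_elemFun_phi hv hF)

theorem skelIntegrable_numFlux_faceFun : M.SkelIntegrable univ fun K F x ν =>
    numFlux γ s0 (sigmaMV γ s0 path) (vhat F x) (v K x) ν ⬝ᵥ vhat F x :=
  M.skelIntegrable_of_continuous fun _ _ F _ hF =>
    (M.continuous_numFlux_phi hγ hstraight hv hvhat hphys hF).dotProduct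
      (M.continuous_faceFun_phi hvhat F)

/-- The face terms of the entropy balance combine to the dissipation term. -/
theorem skelInt_numFlux_balance (hpath : IsPath γ s0 path) :
    M.skelInt univ (fun K F x ν => numFlux γ s0 (sigmaMV γ s0 path) (vhat F x) (v K x) ν ⬝ᵥ v K x)
      - M.skelInt univ (fun K F x ν =>
          numFlux γ s0 (sigmaMV γ s0 path) (vhat F x) (v K x) ν ⬝ᵥ vhat F x)
      - (M.skelInt univ (fun K _ x ν => potentialFlux γ s0 ν (v K x))
        - M.skelInt univ (fun _ F x ν => potentialFlux γ s0 ν (vhat F x)))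
      = M.meanValueFaceTerm γ s0 path v vhat := by
  have i1 := M.skelIntegrable_numFlux_elemFun hγ hstraight hv hvhat hphys
  have i2 := M.skelIntegrable_numFlux_faceFun hγ hstraight hv hvhat hphys
  have i3 := M.skelIntegrable_potentialFlux_elemFun hγ hv hphys
  have i4 := M.skelIntegrable_potentialFlux_faceFun hγ hvhat hphys
  have i12 := i1.sub M i2
  have i34 := i3.sub M i4
  rw [← M.skelInt_sub i1 i2, ← M.skelInt_sub i3 i4, ← M.skelInt_sub i12 i34, meanValueFaceTerm]
  refine M.skelInt_congr fun K j F _ hF s hs => ?_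
  have h1 := hphys.1 K _ (M.phi_mem_closedElem hF hs)
  have h2 := hphys.2 F _ (mem_image_of_mem _ hs)
  rw [← dotProduct_sigmaMV_sub_bigSigma hpath hγ h1 h2,
    ← numFlux_entropy_balance hpath hγ hstraight h1 h2, dotProduct_sub]

/-- The boundary term in terms of the potential flux. -/
theorem boundaryTerm_eq {bhat : M.Face → State (n + 1) → State (n + 1) → State (n + 1) →
      (Fin (n + 1) → ℝ) → State (n + 1)} {vbd : (Fin (n + 1) → ℝ) → State (n + 1)}
    (hb : ∀ i, M.SkelIntegrable M.boundaryFaces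
      fun K F x ν => bhat F (vhat F x) (v K x) (vbd x) ν i) :
    M.boundaryTerm γ s0 (sigmaMV γ s0 path) bhat vbd v vhat
      = M.skelInt M.boundaryFaces (fun K F x ν =>
          numFlux γ s0 (sigmaMV γ s0 path) (vhat F x) (v K x) ν ⬝ᵥ vhat F x)
        - M.skelInt M.boundaryFaces
            (fun K F x ν => bhat F (vhat F x) (v K x) (vbd x) ν ⬝ᵥ vhat F x)
        - M.skelInt M.boundaryFaces (fun _ F x ν => potentialFlux γ s0 ν (vhat F x)) := by
  have i2 := (M.skelIntegrable_numFlux_faceFun hγ hstraight hv hvhat hphys).mono M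
    (subset_univ M.boundaryFaces)
  have i4 := (M.skelIntegrable_potentialFlux_faceFun hγ hvhat hphys).mono M
    (subset_univ M.boundaryFaces)
  have i5 := (M.skelIntegrable_dotProduct_fluxN hγ hvhat hphys).mono M
    (subset_univ M.boundaryFaces)
  -- The boundary flux is merely integrable; pairing it with the continuous bounded `v̂` preserves
  -- this.
  have ib : M.SkelIntegrable M.boundaryFaces
      fun K F x ν => bhat F (vhat F x) (v K x) (vbd x) ν ⬝ᵥ vhat F x := by
    intro K j F hFb hF
    have hsum : ∀ i, IntegrableOn (fun s => vhat F (polyMap (M.phi F) s) i *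
        (bhat F (vhat F (polyMap (M.phi F) s)) (v K (polyMap (M.phi F) s))
          (vbd (polyMap (M.phi F) s)) (M.normal K j (polyMap (M.phi F) s)) i * M.surfElem F s))
        M.Fref.carrier := fun i => by
      refine IntegrableOn.continuousOn_mul ?_ (hb i K j F hFb hF) M.Fref.isCompact_carrier
      exact continuousOn_iff_continuous_domRestrict.2
        ((continuous_apply i).comp (M.continuous_faceFun_phi hvhat F))
    refine (integrable_finsetSum Finset.univ fun i _ => hsum i).congr (ae_of_all _ fun s => ?_)
    simp only [dotProduct, Finset.sum_mul]
    exact Finset.sum_congr rfl fun i _ => by ring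
  -- Since `𝓕_n = v̂ᵗF_n - ψ_n`, the first two boundary integrals combine to that of `-ψ_n(v̂)`.
  have e1 : M.skelInt M.boundaryFaces
      (fun _ F x ν => entropyFluxN γ s0 ν (consVars γ s0 (vhat F x)))
      = M.skelInt M.boundaryFaces (fun _ F x ν => vhat F x ⬝ᵥ fluxN γ ν (consVars γ s0 (vhat F x)))
        - M.skelInt M.boundaryFaces (fun _ F x ν => potentialFlux γ s0 ν (vhat F x)) := by
    rw [← M.skelInt_sub i5 i4]
    refine M.skelInt_congr fun K j F _ hF s hs => ?_
    have h2 := ((M.isPhysical_iff hγ).1 hphys).2 F _ (mem_image_of_mem _ hs)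
    rw [consVars_eq hγ s0 h2, dotProduct_fluxN_consE hγ s0 _ h2, add_sub_cancel_right]
  rw [boundaryTerm, e1, ← M.skelInt_sub i2 ib]
  have e2 : M.skelInt M.boundaryFaces (fun K F x ν => vhat F x ⬝ᵥ
      (numFlux γ s0 (sigmaMV γ s0 path) (vhat F x) (v K x) ν - bhat F (vhat F x) (v K x) (vbd x) ν))
      = M.skelInt M.boundaryFaces (fun K F x ν =>
          numFlux γ s0 (sigmaMV γ s0 path) (vhat F x) (v K x) ν ⬝ᵥ vhat F x
          - bhat F (vhat F x) (v K x) (vbd x) ν ⬝ᵥ vhat F x) :=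
    M.skelInt_congr fun K j F _ hF s hs => by rw [dotProduct_sub, dotProduct_comm, dotProduct_comm (vhat F _)]
  rw [e2]
  ring

end Balance

/-- The time evolution of the total generalized entropy. -/
theorem hasDerivAt_totalEntropy_of_isHDGSolution (hn : n + 1 ≤ 3) {γ s0 tf : ℝ} (hγ : 1 < γ)
    {path : ℝ → State (n + 1) → State (n + 1) → State (n + 1)} (hpath : IsPath γ s0 path)
    (hstraight : ∀ v₁ ∈ physicalV (n + 1) γ s0, ∀ v₂ ∈ physicalV (n + 1) γ s0,
      ∀ θ ∈ Icc (0 : ℝ) 1, path θ v₁ v₂ = (1 - θ) • v₁ + θ • v₂)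
    {k : ℕ} {EE : Set M.Face} {bhat : M.Face → State (n + 1) → State (n + 1) → State (n + 1) →
      (Fin (n + 1) → ℝ) → State (n + 1)} {vbd : ℝ → (Fin (n + 1) → ℝ) → State (n + 1)}
    {u₀ : (Fin (n + 1) → ℝ) → State (n + 1)} {v : ℝ → M.ElemFun} {vhat : ℝ → M.FaceFun}
    (hsol : M.IsHDGSolution k EE γ s0 tf (sigmaMV γ s0 path) bhat vbd u₀ v vhat) {t : ℝ}
    (ht : t ∈ Ioo 0 tf) (hphys : M.IsPhysical γ s0 (v t) (vhat t)) :
    HasDerivAt (fun τ => M.totalEntropy γ s0 (v τ))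
      (-M.meanValueFaceTerm γ s0 path (v t) (vhat t)
        - M.boundaryTerm γ s0 (sigmaMV γ s0 path) bhat (vbd t) (v t) (vhat t)) t := by
  have hv := hsol.mem_V t (Ioo_subset_Ico_self ht)
  have hvhat := hsol.mem_M t ht
  have hneg := ((M.isPhysical_iff hγ).1 hphys).1
  refine (M.hasDerivAt_totalEntropy hγ s0 (k := k) ?_ (hsol.differentiable t ht)
    hneg).congr_deriv ?_
  · filter_upwards [isOpen_Ioo.mem_nhds ht] with τ hτ using hsol.mem_V τ (Ioo_subset_Ico_self hτ)
  -- The solution itself is the test function: `w = v_h` here and `μ = v̂_h` in the face equation.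
  have h1 := hsol.elem_eq t ht _ hv
  have h2 := hsol.face_eq t ht _ hvhat
  have h3 := M.volInt_flux_fderiv hn hγ s0 hv hneg
  have h4 := M.skelInt_numFlux_balance hγ hstraight hv hvhat hphys hpath
  have h5 := M.boundaryTerm_eq hγ hstraight hv hvhat hphys (bhat := bhat) (vbd := vbd t)
    fun i K j F hFb hF => hsol.bhat_integrable t ht K j F hFb hF i
  have h6 := M.skelInt_univ (g := fun _ F x ν => potentialFlux γ s0 ν (vhat t F x)) M.boundaryFaces
  have h7 := M.skelInt_univ (g := fun K F x ν =>
    numFlux γ s0 (sigmaMV γ s0 path) (vhat t F x) (v t K x) ν ⬝ᵥ vhat t F x) M.boundaryFaces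
  have h8 := M.skelInt_interior_eq_zero (fun F x ν => potentialFlux γ s0 ν (vhat t F x))
    fun F x ν => potentialFlux_neg γ s0 ν (vhat t F x)
  -- With `T` the time term, `h1`, `h3` and `h4` give `T = -𝓓 - ∫ f̂·v̂ + ∫ ψ_n(v̂)` over all
  -- element boundaries. The interior part of the last integral vanishes by `h8`. The face equation
  -- `h2` replaces the interior part of `∫ f̂·v̂` by `-∫ b̂·v̂` over `∂Ω`, and what is left is `-𝓑`
  -- by `h5`.
  linarith

end Mesh

end EntropyHDG

end

/-! ### The main theorem -/

theorem mainTheorem7 {n p k : ℕ} (hn : n + 1 ≤ 3) {Ω : Set (Fin (n + 1) → ℝ)}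
    (hΩ : IsOpen Ω) (hΩc : IsConnected Ω) (hΩb : Bornology.IsBounded Ω)
    (M : EntropyHDG.Mesh n p Ω) (EE : Set M.Face)
    (γ s0 tf : ℝ) (hγ : 1 < γ)
    (path : ℝ → EntropyHDG.State (n + 1) → EntropyHDG.State (n + 1) →
      EntropyHDG.State (n + 1))
    (hpath : EntropyHDG.IsPath γ s0 path) :
    -- the equivalent expressions of the generalized absolute value and of the two parts
    (∀ w ∈ EntropyHDG.physicalV (n + 1) γ s0, ∀ ν : Fin (n + 1) → ℝ,
      EntropyHDG.genAbs γ s0 ν w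
          = EntropyHDG.matAbs (EntropyHDG.jacN γ s0 ν w) * EntropyHDG.metric γ s0 w ∧
      EntropyHDG.jacPlus γ s0 ν w
          = (1 / 2 : ℝ) • (EntropyHDG.symJacN γ s0 ν w + EntropyHDG.genAbs γ s0 ν w) ∧
      EntropyHDG.jacMinus γ s0 ν w
          = (1 / 2 : ℝ) • (EntropyHDG.symJacN γ s0 ν w - EntropyHDG.genAbs γ s0 ν w)) ∧
    -- the form of the face term, for every choice of path
    (∀ v ∈ M.spaceV k, ∀ vhat ∈ M.spaceM k EE, M.IsPhysical γ s0 v vhat →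
      M.faceTerm γ s0 path (EntropyHDG.sigmaMV γ s0 path) v vhat
        = M.meanValueFaceTerm γ s0 path v vhat) ∧
    -- the time evolution of total generalized entropy, for straight paths
    ((∀ v₁ ∈ EntropyHDG.physicalV (n + 1) γ s0, ∀ v₂ ∈ EntropyHDG.physicalV (n + 1) γ s0,
        ∀ θ ∈ Set.Icc (0 : ℝ) 1, path θ v₁ v₂ = (1 - θ) • v₁ + θ • v₂) →
      ∀ (bhat : M.Face → EntropyHDG.State (n + 1) → EntropyHDG.State (n + 1) →
          EntropyHDG.State (n + 1) → (Fin (n + 1) → ℝ) → EntropyHDG.State (n + 1))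
        (vbd : ℝ → (Fin (n + 1) → ℝ) → EntropyHDG.State (n + 1))
        (u₀ : (Fin (n + 1) → ℝ) → EntropyHDG.State (n + 1))
        (v : ℝ → M.ElemFun) (vhat : ℝ → M.FaceFun),
        M.IsHDGSolution k EE γ s0 tf (EntropyHDG.sigmaMV γ s0 path) bhat vbd u₀ v vhat →
        ∀ t ∈ Set.Ioo 0 tf, M.IsPhysical γ s0 (v t) (vhat t) →
          ∃ E' : ℝ, HasDerivAt (fun τ => M.totalEntropy γ s0 (v τ)) E' t ∧
            E' + M.meanValueFaceTerm γ s0 path (v t) (vhat t)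
              + M.boundaryTerm γ s0 (EntropyHDG.sigmaMV γ s0 path) bhat (vbd t) (v t) (vhat t)
              = 0) := by
  refine ⟨fun w hw ν => ?_, fun v _ vhat _ hphys => M.faceTerm_sigmaMV hγ hpath hphys,
    fun hstraight bhat vbd u₀ v vhat hsol t ht hphys => ?_⟩
  · have hw' := (EntropyHDG.mem_physicalV_iff hγ).1 hw
    exact ⟨EntropyHDG.genAbs_eq hγ s0 hw' ν, EntropyHDG.jacPlus_eq hγ s0 hw' ν,
      EntropyHDG.jacMinus_eq hγ s0 hw' ν⟩
  · exact ⟨_, M.hasDerivAt_totalEntropy_of_isHDGSolution hn hγ hpath hstraight hsol ht hphys,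
      by ring⟩
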